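/- Let $a,b,\ell$ be integers with $b\ge a\ge \ell\ge 4$. All graphs are finite, simple and undirected, and a graph is $2$-connected if it is connected and remains connected after deleting any single vertex. Let $B_2(a,b,2\ell)$ be the bipartite graph obtained from the complete bipartite graph $K_{\ell-2,\,b}$ by adding $a-\ell+2$ independent vertices, each adjacent to exactly the same two vertices of the part of size $b$ (so its parts have sizes $a$ and $b$). Let $G$ be a $2$-connected bipartite graph with bipartition classes of sizes $a$ and $b$ that contains no cycle of length at least $2\ell$. Then $$|E(G)|\le \frac{\ell}{2}(a+b)+\left(\frac{\ell}{2}-2\right)(b-a-4)-4,$$ where the right-hand side equals $(\ell-2)b+2(a-\ell+2)$. Equality holds if and only if $G$ is isomorphic to $B_2(a,b,2\ell)$. Moreover, $B_2(a,b,2\ell)$ is itself $2$-connected, is bipartite with parts of sizes $a$ and $b$, and has no cycle of length at least $2\ell$, so the bound is attained. -/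

import Mathlib

namespace SimpleGraph

/-- A graph is `2`-connected if it is connected and remains connected after deleting any single
vertex. -/
def IsTwoConnected {V : Type*} (G : SimpleGraph V) : Prop :=
  G.Connected ∧ ∀ v : V, (G.induce ({v}ᶜ : Set V)).Connected

/-- `G` contains no cycle of length at least `k`. -/
def NoCycleGE {V : Type*} (G : SimpleGraph V) (k : ℕ) : Prop :=
  ∀ (v : V) (c : G.Walk v v), c.IsCycle → c.length < k

/-- `A` and `B` are the two classes of a bipartition of the whole vertex set of `G`. -/
def IsBipartition {V : Type*} [Fintype V] [DecidableEq V] (G : SimpleGraph V)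
    (A B : Finset V) : Prop :=
  A ∪ B = Finset.univ ∧ G.IsBipartiteWith (A : Set V) (B : Set V)

/-- The graph `B₂(a, b, 2ℓ)`, with classes `Fin a` and `Fin b`. The first `ℓ - 2` vertices of the
class of size `a` are joined to all the vertices of the class of size `b`; each of the other
`a - (ℓ - 2)` vertices is joined exactly to the vertices `0` and `1` of the class of size `b`. -/
def graphB2 (a b ℓ : ℕ) : SimpleGraph (Fin a ⊕ Fin b) where
  Adj
    | .inl i, .inr j => (i : ℕ) < ℓ - 2 ∨ (j : ℕ) < 2
    | .inr j, .inl i => (i : ℕ) < ℓ - 2 ∨ (j : ℕ) < 2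
    | _, _ => False
  symm := ⟨by rintro (i | i) (j | j) h <;> exact h⟩
  loopless := ⟨by rintro (i | i) h <;> exact h⟩

end SimpleGraph

/-! ### Paths recorded by their vertex sets, and as indexed sequences -/

namespace SimpleGraph

variable {V : Type*} [DecidableEq V] {G : SimpleGraph V}

/-! The proof follows the method of Pósa and Kopylov. Enlarging `G` to an edge-maximal graph
(`exists_extremal`) makes any two non-adjacent vertices of opposite classes the ends of a path on at
least `2ℓ` vertices. A longest path from a set `S` to a set `T` contains all neighbours in `S` of
its first vertex and all neighbours in `T` of its last (`exists_saturated`). The ends of a path on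
at least `2ℓ` vertices have together at most `ℓ` neighbours on it if they lie in different classes,
and at most `ℓ + 1` if they lie in the same class (`IPath.card_add_card_le_of_odd`,
`IPath.card_add_card_le_of_even`). When neighbours of the two ends cross, this comes from the cycle
of a tightest crossing; otherwise from a cycle built with 2-connectedness through a `Linkage`. Hence
sets with large enough inner degrees are completely joined (`Extremal.adj_of_degIn`).

Let `s = ⌊ℓ/2⌋` and `t = ⌈ℓ/2⌉`. If `G` can be dismantled by removing vertices with at most `s`
remaining neighbours from `A` and at most `t` from `B`, it has at most `s|A| + t|B| - st` edges,
which is below the claimed bound by `(s - 2)(t - 2 + |B| - |A|)`; likewise with `s` and `t`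
exchanged. If both dismantlings fail, their two cores are completely joined, hence coincide and form
a maximal biclique `K` (`Extremal.exists_isBiclique`). Its smaller side has at most `ℓ - 2`
vertices, and peeling off everything outside `K` with thresholds fitted to its size gives the bound
(`Extremal.degSum_le_of_isBiclique`).

Equality with a biclique forces `ℓ - 2` vertices of one class to be joined to the whole other class.
Equality with a dismantling is possible only for `ℓ = 4` and `ℓ = 5`. For `ℓ = 4` the same
conclusion follows by putting the removed vertices back (`IsSplit.hasTwoFull`). For `ℓ = 5` a tight
dismantling shows that no two vertices of the relevant class separate `G`; three parallel paths then
yield a long cycle, which sharpens the end-degree bound just enough for the core argument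
(`Extremal.hasFull_of_five`). Given the `ℓ - 2` full vertices, the edge count and minimum degree two
leave every other vertex of that class with exactly two neighbours, and two different neighbour
pairs would close a cycle of length `2ℓ` (`IsSplit.adj_of_adj_of_full`). -/

/-- There is a path of `G` from `x` to `y` whose vertex set is exactly `s`. -/
def PathOn (G : SimpleGraph V) (x y : V) (s : Finset V) : Prop :=
  ∃ w : G.Walk x y, w.IsPath ∧ w.support.toFinset = s

namespace PathOn

variable {x y z w : V} {s t : Finset V}

theorem refl (x : V) : G.PathOn x x {x} := ⟨Walk.nil, by simp, by simp⟩

theorem symm (h : G.PathOn x y s) : G.PathOn y x s := by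
  obtain ⟨p, hp, rfl⟩ := h
  exact ⟨p.reverse, hp.reverse, by simp⟩

theorem left_mem (h : G.PathOn x y s) : x ∈ s := by
  obtain ⟨p, hp, rfl⟩ := h; simp

theorem right_mem (h : G.PathOn x y s) : y ∈ s := h.symm.left_mem

/-- Join two disjoint paths by an edge. -/
theorem join (h : G.PathOn x y s) (ha : G.Adj y z) (h' : G.PathOn z w t) (hd : Disjoint s t) :
    G.PathOn x w (s ∪ t) := by
  obtain ⟨p, hp, rfl⟩ := h
  obtain ⟨q, hq, rfl⟩ := h'
  refine ⟨p.append (Walk.cons ha q), ?_, ?_⟩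
  · rw [Walk.isPath_def, Walk.support_append, Walk.support_cons, List.tail_cons,
      List.nodup_append']
    refine ⟨hp.support_nodup, hq.support_nodup, ?_⟩
    rw [List.disjoint_left]
    intro u hu hu'
    exact Finset.disjoint_left.1 hd (by simpa using hu) (by simpa using hu')
  · rw [Walk.support_append, Walk.support_cons, List.tail_cons, List.toFinset_append]

theorem cons (ha : G.Adj x y) (h : G.PathOn y z s) (hx : x ∉ s) : G.PathOn x z (insert x s) := by
  simpa using (refl x).join ha h (by simpa using hx)

theorem concat (h : G.PathOn x y s) (ha : G.Adj y z) (hz : z ∉ s) :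
    G.PathOn x z (insert z s) := (cons ha.symm h.symm hz).symm

/-- Concatenate two paths which share only an end. -/
theorem glue (h : G.PathOn x y s) (h' : G.PathOn y z t) (hd : s ∩ t ⊆ {y}) :
    G.PathOn x z (s ∪ t) := by
  obtain ⟨p, hp, rfl⟩ := h
  obtain ⟨q, hq, rfl⟩ := h'
  have hq' : q.support = y :: q.support.tail := by simp
  refine ⟨p.append q, ?_, ?_⟩
  · rw [Walk.isPath_def, Walk.support_append, List.nodup_append']
    refine ⟨hp.support_nodup, hq.support_nodup.tail, ?_⟩
    rw [List.disjoint_left]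
    intro u hu hu'
    have h1 : u = y := by
      have := @hd u (by simp [hu, List.mem_of_mem_tail hu'])
      simpa using this
    subst h1
    have := hq.support_nodup
    rw [hq'] at this
    exact (List.nodup_cons.1 this).1 hu'
  · ext u
    have := p.end_mem_support
    simp only [Walk.mem_support_append_iff, List.mem_toFinset, Finset.mem_union]

/-- Split a path at one of its vertices. -/
theorem split (h : G.PathOn x y s) (hz : z ∈ s) :
    ∃ s₁ s₂, G.PathOn x z s₁ ∧ G.PathOn z y s₂ ∧ s₁ ∪ s₂ = s ∧ s₁ ∩ s₂ = {z} := by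
  obtain ⟨p, hp, rfl⟩ := h
  have hz' : z ∈ p.support := by simpa using hz
  refine ⟨(p.takeUntil z hz').support.toFinset, (p.dropUntil z hz').support.toFinset,
    ⟨_, hp.takeUntil hz', rfl⟩, ⟨_, hp.dropUntil hz', rfl⟩, ?_, ?_⟩
  · ext u
    rw [Finset.mem_union, List.mem_toFinset, List.mem_toFinset, List.mem_toFinset,
      ← Walk.mem_support_append_iff, Walk.take_spec]
  · ext u
    simp only [Finset.mem_inter, List.mem_toFinset, Finset.mem_singleton]
    constructor
    · rintro ⟨h1, h2⟩
      by_contra hne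
      have hnd := hp.support_nodup
      rw [← p.take_spec hz', Walk.support_append, List.nodup_append'] at hnd
      refine List.disjoint_left.1 hnd.2.2 h1 ?_
      have : (p.dropUntil z hz').support = z :: (p.dropUntil z hz').support.tail := by simp
      rw [this] at h2
      exact (List.mem_cons.1 h2).resolve_left hne
    · rintro rfl
      simp

theorem card_eq (p : G.Walk x y) (hp : p.IsPath) : p.support.toFinset.card = p.length + 1 := by
  rw [List.toFinset_card_of_nodup hp.support_nodup, Walk.length_support]

/-- A path with adjacent ends closes up to a cycle. -/
theorem exists_isCycle (h : G.PathOn x y s) (ha : G.Adj x y) (hs : 3 ≤ s.card) :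
    ∃ c : G.Walk y y, c.IsCycle ∧ c.length = s.card := by
  obtain ⟨p, hp, rfl⟩ := h
  rw [card_eq p hp] at hs ⊢
  refine ⟨Walk.cons ha.symm p, ?_, by simp⟩
  rw [Walk.isCycle_iff_isPath_tail_and_le_length]
  exact ⟨by simpa using hp, by simpa using hs⟩

theorem card_lt {k : ℕ} (hk : 3 ≤ k) (hG : G.NoCycleGE k) (h : G.PathOn x y s)
    (ha : G.Adj x y) : s.card < k := by
  by_cases hs : 3 ≤ s.card
  · obtain ⟨c, hc, hl⟩ := h.exists_isCycle ha hs
    exact hl ▸ hG _ c hc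
  · omega

/-- Two paths which share exactly their ends form a cycle. -/
theorem exists_adj_pathOn (h : G.PathOn x y s) (h' : G.PathOn x y t) (hd : s ∩ t ⊆ {x, y})
    (hs : 3 ≤ s.card) : ∃ u, G.Adj u x ∧ G.PathOn u x (s ∪ t) := by
  obtain ⟨p, hp, rfl⟩ := h
  cases p with
  | nil => simp at hs
  | @cons _ u _ ha p =>
    -- The cycle is cut at the edge from `x` to the second vertex `u` of the first path, so that it
    -- is again a path with adjacent ends.
    have hup : G.PathOn u y p.support.toFinset := ⟨p, by simpa using hp.of_cons, rfl⟩
    have hxp : x ∉ p.support := ((Walk.cons_isPath_iff ..).1 hp).2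
    have h1 := hup.glue h'.symm (by
      intro z hz
      simp only [Finset.mem_inter, List.mem_toFinset] at hz
      have := @hd z (by simp [hz.1, hz.2])
      simp only [Finset.mem_insert, Finset.mem_singleton] at this ⊢
      rcases this with rfl | rfl
      · exact absurd hz.1 hxp
      · rfl)
    refine ⟨u, ha.symm, ?_⟩
    convert h1 using 1
    ext z
    simp only [Walk.support_cons, List.toFinset_cons, Finset.mem_union, Finset.mem_insert,
      List.mem_toFinset]
    constructor
    · rintro ((rfl | h) | h)
      · exact Or.inr h'.left_mem
      · exact Or.inl h
      · exact Or.inr h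
    · tauto

end PathOn

/-- `v 0, …, v M` are the successive vertices of a path of `G`. -/
structure IPath (G : SimpleGraph V) (v : ℕ → V) (M : ℕ) : Prop where
  adj : ∀ i < M, G.Adj (v i) (v (i + 1))
  inj : ∀ i ≤ M, ∀ j ≤ M, v i = v j → i = j

namespace IPath

variable {v : ℕ → V} {M : ℕ}

theorem pathOn (h : G.IPath v M) {i j : ℕ} (hij : i ≤ j) (hj : j ≤ M) :
    G.PathOn (v i) (v j) ((Finset.Icc i j).image v) := by
  induction j, hij using Nat.le_induction with
  | base => simpa using PathOn.refl (v i)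
  | succ j hij ih =>
    have h1 := (ih (by omega)).concat (h.adj j (by omega)) (by
      simp only [Finset.mem_image, Finset.mem_Icc, not_exists, not_and]
      intro k hk he
      have := h.inj k (by omega) (j + 1) hj he
      omega)
    rwa [← Finset.image_insert, Finset.insert_Icc_right_eq_Icc_add_one (by omega)] at h1

theorem card_image (h : G.IPath v M) {I : Finset ℕ} (hI : I ⊆ Finset.Icc 0 M) :
    (I.image v).card = I.card := by
  refine Finset.card_image_of_injOn fun i hi j hj he => ?_
  have h1 := Finset.mem_Icc.1 (hI hi)
  have h2 := Finset.mem_Icc.1 (hI hj)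
  exact h.inj i h1.2 j h2.2 he

theorem disjoint_image (h : G.IPath v M) {I J : Finset ℕ} (hI : I ⊆ Finset.Icc 0 M)
    (hJ : J ⊆ Finset.Icc 0 M) (hd : Disjoint I J) : Disjoint (I.image v) (J.image v) := by
  simp only [Finset.disjoint_left, Finset.mem_image, not_exists, not_and]
  rintro _ ⟨i, hi, rfl⟩ j hj he
  have := h.inj j (Finset.mem_Icc.1 (hJ hj)).2 i (Finset.mem_Icc.1 (hI hi)).2 he
  exact Finset.disjoint_left.1 hd hi (this ▸ hj)

theorem mem_image (h : G.IPath v M) {I : Finset ℕ} (hI : I ⊆ Finset.Icc 0 M) {i : ℕ}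
    (hi : i ≤ M) : v i ∈ I.image v ↔ i ∈ I := by
  simp only [Finset.mem_image]
  constructor
  · rintro ⟨j, hj, he⟩
    have := h.inj j (Finset.mem_Icc.1 (hI hj)).2 i hi he
    exact this ▸ hj
  · exact fun h => ⟨i, h, rfl⟩

end IPath

theorem PathOn.exists_iPath {x y : V} {s : Finset V} (h : G.PathOn x y s) :
    ∃ v M, G.IPath v M ∧ v 0 = x ∧ v M = y ∧ s.card = M + 1 ∧
      s = (Finset.Icc 0 M).image v := by
  obtain ⟨p, hp, rfl⟩ := h
  refine ⟨p.getVert, p.length, ⟨fun i hi => p.adj_getVert_succ hi, fun i hi j hj he =>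
    hp.getVert_injOn hi hj he⟩, by simp, by simp, PathOn.card_eq p hp, ?_⟩
  ext u
  simp only [List.mem_toFinset, Finset.mem_image, Finset.mem_Icc, Walk.mem_support_iff_exists_getVert]
  constructor
  · rintro ⟨n, h1, h2⟩; exact ⟨n, ⟨by omega, h2⟩, h1⟩
  · rintro ⟨n, h1, h2⟩; exact ⟨n, h2, h1.2⟩

end SimpleGraph

/-! ### Linkages along a path in a 2-connected graph -/

namespace SimpleGraph

variable {V : Type*} [DecidableEq V] {G : SimpleGraph V}

/-- A walk from `U` to `T` avoiding `Z` yields a path which meets `U` and `T` only in its ends. -/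
theorem exists_pathOn_of_walk {U T Z : Set V} {u w : V} (p : G.Walk u w) (hu : u ∈ U)
    (hw : w ∈ T) (hp : ∀ z ∈ p.support, z ∉ Z) :
    ∃ u' ∈ U, ∃ w' ∈ T, ∃ s, G.PathOn u' w' s ∧ (∀ z ∈ s, z ∉ Z) ∧ (∀ z ∈ s, z ∈ U → z = u') ∧
      ∀ z ∈ s, z ∈ T → z = w' := by
  -- Take such a path with fewest vertices: a further vertex in `U` or in `T` would split off a
  -- smaller one.
  have hex : ∃ n, ∃ u' ∈ U, ∃ w' ∈ T, ∃ s, G.PathOn u' w' s ∧ (∀ z ∈ s, z ∉ Z) ∧ s.card = n :=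
    ⟨_, u, hu, w, hw, p.bypass.support.toFinset, ⟨_, p.bypass_isPath, rfl⟩, fun z hz =>
      hp z (p.support_bypass_subset_support (by simpa using hz)), rfl⟩
  classical
  obtain ⟨u', hu', w', hw', s, hs, hZ, hn⟩ := Nat.find_spec hex
  refine ⟨u', hu', w', hw', s, hs, hZ, fun z hz hzU => ?_, fun z hz hzT => ?_⟩
  · by_contra hne
    obtain ⟨s₁, s₂, h1, h2, h3, h4⟩ := hs.split hz
    refine Nat.find_min hex (m := s₂.card) ?_
      ⟨z, hzU, w', hw', s₂, h2, fun y hy => hZ y (h3 ▸ Finset.mem_union_right _ hy), rfl⟩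
    rw [← hn]
    refine Finset.card_lt_card ⟨h3 ▸ Finset.subset_union_right, fun hsub => hne ?_⟩
    have : u' ∈ s₁ ∩ s₂ := Finset.mem_inter.2 ⟨h1.left_mem, hsub hs.left_mem⟩
    rw [h4, Finset.mem_singleton] at this
    exact this.symm
  · by_contra hne
    obtain ⟨s₁, s₂, h1, h2, h3, h4⟩ := hs.split hz
    refine Nat.find_min hex (m := s₁.card) ?_
      ⟨u', hu', z, hzT, s₁, h1, fun y hy => hZ y (h3 ▸ Finset.mem_union_left _ hy), rfl⟩
    rw [← hn]
    refine Finset.card_lt_card ⟨h3 ▸ Finset.subset_union_left, fun hsub => hne ?_⟩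
    have : w' ∈ s₁ ∩ s₂ := Finset.mem_inter.2 ⟨hsub hs.right_mem, h2.right_mem⟩
    rw [h4, Finset.mem_singleton] at this
    exact this.symm

omit [DecidableEq V] in
theorem IsTwoConnected.exists_walk (h : G.IsTwoConnected) {u w z : V} (hu : u ≠ z) (hw : w ≠ z) :
    ∃ p : G.Walk u w, ∀ y ∈ p.support, y ∉ ({z} : Set V) := by
  obtain ⟨p⟩ := (h.2 z).preconnected ⟨u, hu⟩ ⟨w, hw⟩
  refine ⟨p.map (Embedding.induce _).toHom, fun y hy => ?_⟩
  erw [Walk.support_map, List.mem_map] at hy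
  obtain ⟨⟨a, ha⟩, -, rfl⟩ := hy
  exact ha

/-- Two disjoint paths starting at `v p` and at some `v n` with `n < p`, and ending at `v m` and
at `v k`, which use no other vertices `v n` with `n < p` or `m < n`. -/
structure Linkage (G : SimpleGraph V) (v : ℕ → V) (M p m k : ℕ) : Prop where
  le : p ≤ m
  lt : m < k
  kle : k ≤ M
  ex : ∃ α < p, ∃ x y : V, (x = v p ∧ y = v α ∨ x = v α ∧ y = v p) ∧ ∃ S S' : Finset V,
    G.PathOn x (v k) S ∧ G.PathOn y (v m) S' ∧ Disjoint S S' ∧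
      ∀ n ≤ M, v n ∈ S ∪ S' → n = α ∨ p ≤ n ∧ n ≤ m ∨ n = k

/-- Deleting `v p` leaves a path from the vertices before it to those after it; the second path of
the linkage is `v p` alone. -/
theorem Linkage.start {v : ℕ → V} {M p : ℕ} (hG : G.IsTwoConnected) (hv : G.IPath v M)
    (hp : 1 ≤ p) (hpM : p < M) : ∃ k, G.Linkage v M p p k := by
  obtain ⟨w, hw⟩ := hG.exists_walk (u := v 0) (w := v M) (z := v p)
    (fun h => by have := hv.inj _ (by omega) _ (by omega) h; omega)
    (fun h => by have := hv.inj _ (by omega) _ (by omega) h; omega)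
  obtain ⟨_, ⟨α, hα, rfl⟩, _, ⟨k, ⟨hk, hkM⟩, rfl⟩, S, hS, hZ, hU, hT⟩ :=
    exists_pathOn_of_walk (U := {x | ∃ n < p, x = v n}) (T := {x | ∃ n, (p < n ∧ n ≤ M) ∧ x = v n})
      w ⟨0, by omega, rfl⟩ ⟨M, ⟨by omega, le_rfl⟩, rfl⟩ hw
  refine ⟨k, le_rfl, hk, hkM, α, hα, v α, v p, Or.inr ⟨rfl, rfl⟩, S, {v p}, hS, PathOn.refl _,
    by simpa using fun h => hZ _ h rfl, fun n hn hmem => ?_⟩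
  rw [Finset.mem_union, Finset.mem_singleton] at hmem
  rcases hmem with h | h
  · rcases lt_trichotomy n p with h' | rfl | h'
    · exact Or.inl (hv.inj _ hn _ (by omega) (hU _ h ⟨n, h', rfl⟩))
    · exact Or.inr (Or.inl ⟨le_rfl, le_rfl⟩)
    · exact Or.inr (Or.inr (hv.inj _ hn _ (by omega) (hT _ h ⟨n, ⟨h', hn⟩, rfl⟩)))
  · have := hv.inj _ hn _ (by omega) h
    omega

/-- Since `v k` is not a cut vertex, some path `Q` avoids it and leads beyond it from what has been
used so far. It is attached where it starts: on either path of the linkage, on the segment from `v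
m` to `v k`, or before `v p`. The path left over has to end at `v k`: it does so already, or it is
prolonged there along `v`. When `Q` starts before `v p` it replaces the path starting at `v α`. -/
theorem Linkage.step {v : ℕ → V} {M p m k : ℕ} (hG : G.IsTwoConnected) (hv : G.IPath v M)
    (h : G.Linkage v M p m k) (hk : k < M) : ∃ k', G.Linkage v M p k k' := by
  obtain ⟨hpm, hmk, -, α, hα, x, y, hxy, S, S', hS, hS', hd, hav⟩ := h
  obtain ⟨w, hw⟩ := hG.exists_walk (u := v m) (w := v M) (z := v k)
    (fun h => by have := hv.inj _ (by omega) _ (by omega) h; omega)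
    (fun h => by have := hv.inj _ (by omega) _ (by omega) h; omega)
  obtain ⟨u, hu, _, ⟨k', ⟨hk', hkM'⟩, rfl⟩, Q, hQ, hQZ, hQU, hQT⟩ :=
    exists_pathOn_of_walk (U := {x | x ∈ S ∪ S' ∨ ∃ n, (n < p ∨ m < n ∧ n < k) ∧ x = v n})
      (T := {x | ∃ n, (k < n ∧ n ≤ M) ∧ x = v n})
      w (Or.inl (Finset.mem_union_right _ hS'.right_mem)) ⟨M, ⟨by omega, le_rfl⟩, rfl⟩ hw
  have huk : u ≠ v k := fun h => hQZ _ hQ.left_mem h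
  have hkQ : v k ∉ Q := fun h => hQZ _ h rfl
  have hQS : ∀ z ∈ Q, z ∈ S → z = u := fun z hz hz' =>
    hQU z hz (Or.inl (Finset.mem_union_left _ hz'))
  have hQS' : ∀ z ∈ Q, z ∈ S' → z = u := fun z hz hz' =>
    hQU z hz (Or.inl (Finset.mem_union_right _ hz'))
  have hSS' : ∀ z ∈ S, z ∉ S' := fun z hz hz' => Finset.disjoint_left.1 hd hz hz'
  have hQn : ∀ n ≤ M, v n ∈ Q → v n = u ∨ p ≤ n ∧ n ≤ m ∨ n = k' := by
    intro n hn hnQ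
    by_cases h1 : n < p ∨ m < n ∧ n < k
    · exact Or.inl (hQU _ hnQ (Or.inr ⟨n, h1, rfl⟩))
    · by_cases h2 : k < n
      · exact Or.inr (Or.inr (hv.inj _ hn _ hkM' (hQT _ hnQ ⟨n, ⟨h2, hn⟩, rfl⟩)))
      · have h3 : n ≠ k := by rintro rfl; exact hkQ hnQ
        right; left; omega
  have havS : ∀ n ≤ M, v n ∈ S → n = α ∨ p ≤ n ∧ n ≤ m ∨ n = k := fun n hn h' =>
    hav n hn (Finset.mem_union_left _ h')
  have havS' : ∀ n ≤ M, v n ∈ S' → n = α ∨ p ≤ n ∧ n ≤ m ∨ n = k := fun n hn h' =>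
    hav n hn (Finset.mem_union_right _ h')
  have hkS' : v k ∉ S' := hSS' _ hS.right_mem
  -- the path ending at `v m`, prolonged along `v`
  have hext : ∀ n, m ≤ n → n ≤ k → G.PathOn y (v n) (S' ∪ (Finset.Icc m n).image v) := by
    intro n h1 h2
    refine hS'.glue (hv.pathOn h1 (by omega)) fun z hz => ?_
    rw [Finset.mem_inter, Finset.mem_image] at hz
    obtain ⟨hz1, i, hi, rfl⟩ := hz
    rw [Finset.mem_Icc] at hi
    rcases havS' i (by omega) hz1 with h | h | h
    · omega
    · rw [show i = m by omega]; simp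
    · exact absurd (h ▸ hz1) hkS'
  have hIcc : ∀ n ≤ k, ∀ z ∈ (Finset.Icc m n).image v, ∃ i, m ≤ i ∧ i ≤ n ∧ z = v i := by
    intro n _ z hz
    obtain ⟨i, hi, rfl⟩ := Finset.mem_image.1 hz
    exact ⟨i, (Finset.mem_Icc.1 hi).1, (Finset.mem_Icc.1 hi).2, rfl⟩
  by_cases huS' : u ∈ S'
  · -- leave the path ending at `v m`
    obtain ⟨s₁, s₂, h1, h2, h3, h4⟩ := hS'.split huS'
    have hs₁ : ∀ z ∈ s₁, z ∈ S' := fun z hz => h3 ▸ Finset.mem_union_left _ hz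
    refine ⟨k', by omega, hk', hkM', α, hα, y, x, by tauto, s₁ ∪ Q, S, h1.glue hQ ?_, hS, ?_, ?_⟩
    · intro z hz
      rw [Finset.mem_inter] at hz
      simpa using hQS' z hz.2 (hs₁ z hz.1)
    · rw [Finset.disjoint_left]
      intro z hz hzS
      rcases Finset.mem_union.1 hz with hz | hz
      · exact hSS' z hzS (hs₁ z hz)
      · exact hSS' z hzS (hQS z hz hzS ▸ huS')
    · intro n hn hmem
      simp only [Finset.mem_union] at hmem
      rcases hmem with (h | h) | h
      · have := havS' n hn (hs₁ _ h); omega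
      · rcases hQn n hn h with h | h | h
        · have := havS' n hn (h ▸ huS'); omega
        · omega
        · omega
      · have := havS n hn h; omega
  by_cases huS : u ∈ S
  · -- leave the path ending at `v k`
    obtain ⟨s₁, s₂, h1, h2, h3, h4⟩ := hS.split huS
    have hs₁ : ∀ z ∈ s₁, z ∈ S := fun z hz => h3 ▸ Finset.mem_union_left _ hz
    have hks₁ : v k ∉ s₁ := by
      intro hk1
      have : v k ∈ s₁ ∩ s₂ := Finset.mem_inter.2 ⟨hk1, h2.right_mem⟩
      rw [h4, Finset.mem_singleton] at this
      exact huk this.symm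
    refine ⟨k', by omega, hk', hkM', α, hα, x, y, hxy, s₁ ∪ Q, _, h1.glue hQ ?_,
      hext k hmk.le le_rfl, ?_, ?_⟩
    · intro z hz
      rw [Finset.mem_inter] at hz
      simpa using hQS z hz.2 (hs₁ z hz.1)
    · rw [Finset.disjoint_left]
      intro z hz hz'
      rcases Finset.mem_union.1 hz with hz | hz <;> rcases Finset.mem_union.1 hz' with hz' | hz'
      · exact hSS' z (hs₁ z hz) hz'
      · obtain ⟨i, hi1, hi2, rfl⟩ := hIcc k le_rfl z hz'
        rcases havS i (by omega) (hs₁ _ hz) with h | h | h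
        · omega
        · rw [show i = m by omega] at hz
          exact hSS' _ (hs₁ _ hz) hS'.right_mem
        · exact hks₁ (h ▸ hz)
      · exact huS' (hQS' z hz hz' ▸ hz')
      · obtain ⟨i, hi1, hi2, rfl⟩ := hIcc k le_rfl z hz'
        rcases hQn i (by omega) hz with h | h | h
        · rcases havS i (by omega) (h ▸ huS) with h' | h' | h'
          · omega
          · rw [show i = m by omega] at h
            exact huS' (h ▸ hS'.right_mem)
          · exact huk (h' ▸ h.symm)
        · rw [show i = m by omega] at hz
          exact huS' (hQS' _ hz hS'.right_mem ▸ hS'.right_mem)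
        · omega
    · intro n hn hmem
      simp only [Finset.mem_union] at hmem
      rcases hmem with (h | h) | h | h
      · have := havS n hn (hs₁ _ h); omega
      · rcases hQn n hn h with h | h | h
        · have := havS n hn (h ▸ huS); omega
        · omega
        · omega
      · have := havS' n hn h; omega
      · obtain ⟨i, hi1, hi2, he⟩ := hIcc k le_rfl _ h
        have := hv.inj _ hn _ (by omega) he
        omega
  -- now `u = v i`
  obtain ⟨i, hi, rfl⟩ : ∃ n, (n < p ∨ m < n ∧ n < k) ∧ u = v n := by
    rcases hu with hu | hu
    · rcases Finset.mem_union.1 hu with h | h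
      · exact absurd h huS
      · exact absurd h huS'
    · exact hu
  rcases hi with hi | hi
  · -- start afresh from `v i`
    have hQn' : ∀ n ≤ M, v n ∈ Q → n = i ∨ p ≤ n ∧ n ≤ k ∨ n = k' := by
      intro n hn h
      rcases hQn n hn h with h | h | h
      · left; exact hv.inj _ hn _ (by omega) h
      · right; left; omega
      · right; right; exact h
    rcases hxy with ⟨rfl, rfl⟩ | ⟨rfl, rfl⟩
    · refine ⟨k', by omega, hk', hkM', i, hi, v i, v p, Or.inr ⟨rfl, rfl⟩, Q, S, hQ, hS, ?_, ?_⟩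
      · rw [Finset.disjoint_left]
        exact fun z hz hz' => huS (hQS z hz hz' ▸ hz')
      · intro n hn hmem
        rcases Finset.mem_union.1 hmem with h | h
        · exact hQn' n hn h
        · have h1 := havS n hn h
          have h2 : n ≠ α := by rintro rfl; exact hSS' _ h hS'.left_mem
          omega
    · refine ⟨k', by omega, hk', hkM', i, hi, v i, v p, Or.inr ⟨rfl, rfl⟩, Q, _, hQ,
        hext k hmk.le le_rfl, ?_, ?_⟩
      · rw [Finset.disjoint_left]
        intro z hz hz'
        rcases Finset.mem_union.1 hz' with hz' | hz'
        · exact huS' (hQS' z hz hz' ▸ hz')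
        · obtain ⟨j, hj1, hj2, rfl⟩ := hIcc k le_rfl z hz'
          by_cases hjm : j = m
          · subst hjm
            exact huS' (hQS' _ hz hS'.right_mem ▸ hS'.right_mem)
          · rcases hQn' j (by omega) hz with h | h | h
            · omega
            · by_cases hjk : j = k
              · exact hkQ (hjk ▸ hz)
              · rcases hQn j (by omega) hz with h' | h' | h'
                · have := hv.inj _ (by omega) _ (by omega) h'; omega
                · omega
                · omega
            · omega
      · intro n hn hmem
        rcases Finset.mem_union.1 hmem with h | h
        · exact hQn' n hn h
        · rcases Finset.mem_union.1 h with h | h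
          · have h1 := havS' n hn h
            have h2 : n ≠ α := by rintro rfl; exact hSS' _ hS.left_mem h
            omega
          · obtain ⟨j, hj1, hj2, he⟩ := hIcc k le_rfl _ h
            have := hv.inj _ hn _ (by omega) he
            omega
  · -- prolong along `v` up to `v i`
    refine ⟨k', by omega, hk', hkM', α, hα, y, x, by tauto, _, S,
      (hext i hi.1.le hi.2.le).glue hQ ?_, hS, ?_, ?_⟩
    · intro z hz
      rw [Finset.mem_inter, Finset.mem_union] at hz
      obtain ⟨hz | hz, hzQ⟩ := hz
      · simpa using hQS' z hzQ hz
      · obtain ⟨j, hj1, hj2, rfl⟩ := hIcc i hi.2.le z hz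
        by_cases hjm : j = m
        · subst hjm
          simpa using hQS' _ hzQ hS'.right_mem
        · simpa using hQU _ hzQ (Or.inr ⟨j, Or.inr ⟨by omega, by omega⟩, rfl⟩)
    · rw [Finset.disjoint_left]
      intro z hz hzS
      rcases Finset.mem_union.1 hz with hz | hz
      · rcases Finset.mem_union.1 hz with hz | hz
        · exact hSS' z hzS hz
        · obtain ⟨j, hj1, hj2, rfl⟩ := hIcc i hi.2.le z hz
          rcases havS j (by omega) hzS with h | h | h
          · omega
          · rw [show j = m by omega] at hzS
            exact hSS' _ hzS hS'.right_mem
          · omega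
      · exact huS (hQS z hz hzS ▸ hzS)
    · intro n hn hmem
      simp only [Finset.mem_union] at hmem
      rcases hmem with ((h | h) | h) | h
      · have := havS' n hn h; omega
      · obtain ⟨j, hj1, hj2, he⟩ := hIcc i hi.2.le _ h
        have := hv.inj _ hn _ (by omega) he
        omega
      · rcases hQn n hn h with h | h | h
        · have := hv.inj _ hn _ (by omega) h; omega
        · omega
        · omega
      · have := havS n hn h; omega

/-- A step turns the landing point `k` into the new `m`, so the successive intervals from `m` to `k`
leave no gap and one of them straddles `q`. -/
theorem Linkage.exists_le_lt {v : ℕ → V} {M p q : ℕ} (hG : G.IsTwoConnected) (hv : G.IPath v M)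
    (hp : 1 ≤ p) (hpq : p ≤ q) (hq : q < M) : ∃ m k, m ≤ q ∧ q < k ∧ G.Linkage v M p m k := by
  induction q, hpq using Nat.le_induction with
  | base =>
    obtain ⟨k, hk⟩ := Linkage.start hG hv hp hq
    exact ⟨p, k, le_rfl, hk.lt, hk⟩
  | succ q hpq ih =>
    obtain ⟨m, k, h1, h2, h3⟩ := ih (by omega)
    by_cases hk : k = q + 1
    · subst hk
      obtain ⟨k', hk'⟩ := h3.step hG hv hq
      exact ⟨q + 1, k', le_rfl, hk'.lt, hk'⟩
    · exact ⟨m, k, by omega, by omega, h3⟩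

end SimpleGraph

/-! ### Neighbours of the two ends of a long path in a bipartite graph -/

namespace SimpleGraph

variable {V : Type*} [DecidableEq V] {G : SimpleGraph V} {A : Finset V}

/-- `A` is one of the two classes of a bipartition. -/
def IsClass (G : SimpleGraph V) (A : Finset V) : Prop := ∀ x y, G.Adj x y → (x ∈ A ↔ y ∉ A)

theorem IPath.mem_iff {v : ℕ → V} {M : ℕ} (hA : G.IsClass A) (hv : G.IPath v M) {i : ℕ}
    (hi : i ≤ M) : v i ∈ A ↔ (v 0 ∈ A ↔ Even i) := by
  induction i with
  | zero => simp
  | succ i ih =>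
    have h1 := hA _ _ (hv.adj i hi)
    have h2 := ih (by omega)
    rw [Nat.even_add_one]
    tauto

theorem PathOn.mem_iff {x y : V} {s : Finset V} (hA : G.IsClass A) (h : G.PathOn x y s) :
    (x ∈ A ↔ y ∈ A) ↔ Odd s.card := by
  obtain ⟨v, M, hv, rfl, rfl, hc, -⟩ := h.exists_iPath
  rw [hc, hv.mem_iff hA le_rfl, Nat.odd_add_one, Nat.not_odd_iff_even]
  tauto

theorem PathOn.even_card {x y : V} {s : Finset V} (hA : G.IsClass A) (h : G.PathOn x y s)
    (ha : G.Adj x y) : Even s.card := by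
  have h1 := h.mem_iff hA
  have h2 := hA _ _ ha
  rw [← Nat.not_odd_iff_even, ← h1]
  tauto

open Classical in
/-- The indices of the neighbours of `u` among `v 0, …, v M`. -/
noncomputable def nbrIdx (G : SimpleGraph V) (v : ℕ → V) (M : ℕ) (u : V) : Finset ℕ :=
  (Finset.range (M + 1)).filter fun i => G.Adj u (v i)

omit [DecidableEq V] in
theorem mem_nbrIdx {v : ℕ → V} {M : ℕ} {u : V} {i : ℕ} :
    i ∈ G.nbrIdx v M u ↔ i ≤ M ∧ G.Adj u (v i) := by
  simp [nbrIdx]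

namespace IPath

variable {v : ℕ → V} {M : ℕ}

omit [DecidableEq V] in
theorem lt_of_mem {i : ℕ} (hi : i ∈ G.nbrIdx v M (v M)) : i < M := by
  obtain ⟨h1, h2⟩ := mem_nbrIdx.1 hi
  rcases h1.lt_or_eq with h | rfl
  · exact h
  · exact absurd h2 (G.loopless.irrefl _)

theorem odd_of_mem (hA : G.IsClass A) (hv : G.IPath v M) {i : ℕ}
    (hi : i ∈ G.nbrIdx v M (v 0)) : i % 2 = 1 := by
  obtain ⟨h1, h2⟩ := mem_nbrIdx.1 hi
  have h3 := hA _ _ h2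
  have h4 := hv.mem_iff hA h1
  rw [← Nat.odd_iff, ← Nat.not_even_iff_odd]
  tauto

theorem parity_of_mem (hA : G.IsClass A) (hv : G.IPath v M) {i : ℕ}
    (hi : i ∈ G.nbrIdx v M (v M)) : (i + M) % 2 = 1 := by
  obtain ⟨h1, h2⟩ := mem_nbrIdx.1 hi
  have h3 := hA _ _ h2
  have h4 := hv.mem_iff hA h1
  have h5 := hv.mem_iff hA le_rfl
  rw [← Nat.odd_iff, ← Nat.not_even_iff_odd, Nat.even_add]
  tauto

/-- Pósa's argument for a path whose ends have no crossing neighbours. -/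
theorem card_add_card_le_of_noncrossing {ℓ : ℕ} (hℓ : 2 ≤ ℓ) (hA : G.IsClass A)
    (hG : G.IsTwoConnected) (hC : G.NoCycleGE (2 * ℓ)) (hv : G.IPath v M) (hM : 1 ≤ M)
    (hnc : ∀ i ∈ G.nbrIdx v M (v 0), ∀ j ∈ G.nbrIdx v M (v M), i ≤ j) :
    (G.nbrIdx v M (v 0)).card + (G.nbrIdx v M (v M)).card ≤ ℓ := by
  set X := G.nbrIdx v M (v 0) with hX
  set W := G.nbrIdx v M (v M) with hW
  have h1X : 1 ∈ X := mem_nbrIdx.2 ⟨hM, hv.adj 0 (by omega)⟩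
  have hMW : M - 1 ∈ W := by
    refine mem_nbrIdx.2 ⟨by omega, ?_⟩
    have := hv.adj (M - 1) (by omega)
    rw [show M - 1 + 1 = M by omega] at this
    exact this.symm
  -- `v p` is the last neighbour of `v 0`, and `v q` the first neighbour of `v M`.
  obtain ⟨p, hpX, hpmax⟩ := X.exists_max_image id ⟨1, h1X⟩
  obtain ⟨q, hqW, hqmin⟩ := W.exists_min_image id ⟨_, hMW⟩
  simp only [id] at hpmax hqmin
  have hp1 := hpmax 1 h1X
  have hqM := lt_of_mem hqW
  have hpq := hnc p hpX q hqW
  obtain ⟨m, k, hmq, hqk, hL⟩ := Linkage.exists_le_lt hG hv hp1 hpq hqM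
  obtain ⟨hpm, hmk, hkM, α, hα, x, y, hxy, S, S', hS, hS', hd, hav⟩ := hL
  -- The cycle runs from `v α` back to `v 0`, by the chord to `v i` and on to `v p`; at the other
  -- end from `v m` to `v j`, by the chord to `v M` and back to `v k`. The linkage joins the two
  -- parts. The choice of `i` and `j` as next to `α` and `k` means that no neighbour of an end is
  -- skipped.
  obtain ⟨i, hi, himin⟩ := (X.filter (α < ·)).exists_min_image id
    ⟨p, Finset.mem_filter.2 ⟨hpX, hα⟩⟩
  obtain ⟨j, hj, hjmax⟩ := (W.filter (· < k)).exists_max_image id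
    ⟨q, Finset.mem_filter.2 ⟨hqW, hqk⟩⟩
  rw [Finset.mem_filter] at hi hj
  simp only [id, Finset.mem_filter] at himin hjmax
  have hip := hpmax i hi.1
  have hqj := hqmin j hj.1
  have hjM := lt_of_mem hj.1
  set IL := Finset.Icc 0 α ∪ Finset.Icc i p with hIL
  set IR := Finset.Icc m j ∪ Finset.Icc k M with hIR
  have mL : ∀ n, n ∈ IL ↔ n ≤ α ∨ i ≤ n ∧ n ≤ p := by intro n; simp [hIL]
  have mR : ∀ n, n ∈ IR ↔ m ≤ n ∧ n ≤ j ∨ k ≤ n ∧ n ≤ M := by intro n; simp [hIR]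
  have sub : ∀ {I : Finset ℕ}, (∀ n ∈ I, n ≤ M) → I ⊆ Finset.Icc 0 M := fun h n hn =>
    Finset.mem_Icc.2 ⟨by omega, h n hn⟩
  have pL : G.PathOn (v α) (v p) (IL.image v) := by
    rw [hIL, Finset.image_union]
    refine (hv.pathOn (Nat.zero_le α) (by omega)).symm.join (mem_nbrIdx.1 hi.1).2
      (hv.pathOn hip (by omega)) (hv.disjoint_image (sub ?_) (sub ?_) ?_)
    · intro n hn; rw [Finset.mem_Icc] at hn; omega
    · intro n hn; rw [Finset.mem_Icc] at hn; omega
    · rw [Finset.disjoint_left]; intro n hn hn'; rw [Finset.mem_Icc] at hn hn'; omega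
  have pR : G.PathOn (v m) (v k) (IR.image v) := by
    rw [hIR, Finset.image_union]
    refine (hv.pathOn (by omega) (by omega)).join (mem_nbrIdx.1 hj.1).2.symm
      (hv.pathOn hkM le_rfl).symm (hv.disjoint_image (sub ?_) (sub ?_) ?_)
    · intro n hn; rw [Finset.mem_Icc] at hn; omega
    · intro n hn; rw [Finset.mem_Icc] at hn; omega
    · rw [Finset.disjoint_left]; intro n hn hn'; rw [Finset.mem_Icc] at hn hn'; omega
  have pL' : G.PathOn y x (IL.image v) := by
    rcases hxy with ⟨rfl, rfl⟩ | ⟨rfl, rfl⟩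
    · exact pL
    · exact pL.symm
  have hRM : IR ⊆ Finset.Icc 0 M := sub fun n hn => by rw [mR] at hn; omega
  have hLM : IL ⊆ Finset.Icc 0 M := sub fun n hn => by rw [mL] at hn; omega
  have hSS' : ∀ z ∈ S, z ∉ S' := fun z hz hz' => Finset.disjoint_left.1 hd hz hz'
  have p1 := hS'.glue pR (by
    intro z hz
    rw [Finset.mem_inter, Finset.mem_image] at hz
    obtain ⟨hz1, n, hn, rfl⟩ := hz
    rw [mR] at hn
    rcases hav n (by omega) (Finset.mem_union_right _ hz1) with h | h | h
    · omega
    · rw [show n = m by omega]; simp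
    · exact absurd (h ▸ hz1) (hSS' _ hS.right_mem))
  have p2 := p1.glue hS.symm (by
    intro z hz
    rw [Finset.mem_inter, Finset.mem_union, Finset.mem_image] at hz
    obtain ⟨hz1 | ⟨n, hn, rfl⟩, hzS⟩ := hz
    · exact absurd hz1 (hSS' _ hzS)
    · rw [mR] at hn
      rcases hav n (by omega) (Finset.mem_union_left _ hzS) with h | h | h
      · omega
      · rw [show n = m by omega] at hzS
        exact absurd hS'.right_mem (hSS' _ hzS)
      · rw [h]; simp)
  have hxy' : x ≠ y := fun h => hSS' _ hS.left_mem (h ▸ hS'.left_mem)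
  have hxk : x ≠ v k ∧ y ≠ v k := by
    have h1 : v p ≠ v k := fun h => by
      have := hv.inj _ (by omega) _ hkM h; omega
    have h2 : v α ≠ v k := fun h => by
      have := hv.inj _ (by omega) _ hkM h; omega
    rcases hxy with ⟨rfl, rfl⟩ | ⟨rfl, rfl⟩
    · exact ⟨h1, h2⟩
    · exact ⟨h2, h1⟩
  have h3 : 3 ≤ (S' ∪ IR.image v ∪ S).card := by
    have : ({x, y, v k} : Finset V).card = 3 :=
      Finset.card_eq_three.2 ⟨x, y, v k, hxy', hxk.1, hxk.2, rfl⟩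
    rw [← this]
    refine Finset.card_le_card fun z hz => ?_
    simp only [Finset.mem_insert, Finset.mem_singleton] at hz
    rcases hz with rfl | rfl | rfl
    · exact Finset.mem_union_right _ hS.left_mem
    · exact Finset.mem_union_left _ (Finset.mem_union_left _ hS'.left_mem)
    · exact Finset.mem_union_right _ hS.right_mem
  obtain ⟨u, hu, hcyc⟩ := p2.exists_adj_pathOn pL' (by
    intro z hz
    rw [Finset.mem_inter, Finset.mem_image] at hz
    obtain ⟨hz1, n, hn, rfl⟩ := hz
    rw [mL] at hn
    have key : n = α ∨ n = p → v n ∈ ({y, x} : Finset V) := by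
      rintro (rfl | rfl) <;> rcases hxy with ⟨rfl, rfl⟩ | ⟨rfl, rfl⟩ <;> simp
    apply key
    simp only [Finset.mem_union] at hz1
    have hz2 : v n ∈ S ∪ S' ∨ n ∈ IR := by
      rcases hz1 with (h | h) | h
      · exact Or.inl (Finset.mem_union_right _ h)
      · exact Or.inr ((hv.mem_image hRM (by omega)).1 h)
      · exact Or.inl (Finset.mem_union_left _ h)
    rcases hz2 with h | h
    · have := hav n (by omega) h; omega
    · rw [mR] at h; omega) h3
  have hlt := hcyc.card_lt (by omega) hC hu
  obtain ⟨c, hc⟩ := hcyc.even_card hA hu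
  -- counting
  have hXo : ∀ n ∈ X, n % 2 = 1 := fun n hn => odd_of_mem hA hv hn
  have hWo : ∀ n ∈ W, (n + M) % 2 = 1 := fun n hn => parity_of_mem hA hv hn
  -- Along with the neighbours of `v 0`, the left part contains their predecessors, except perhaps
  -- that of `v i`; parity keeps the two sets apart. On the right, successors take the place of
  -- predecessors.
  have cL : 2 * X.card - 1 ≤ IL.card := by
    have e1 : (X.image (· - 1)).card = X.card := by
      refine Finset.card_image_of_injOn fun a ha b hb hab => ?_
      have := hXo a ha; have := hXo b hb
      omega
    have e2 : Disjoint X ((X.image (· - 1)).erase (i - 1)) := by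
      rw [Finset.disjoint_left]
      intro n hn hn'
      obtain ⟨b, hb, rfl⟩ := Finset.mem_image.1 (Finset.mem_of_mem_erase hn')
      have := hXo _ hn; have := hXo b hb
      omega
    have e3 := Finset.card_union_of_disjoint e2
    have e4 : ((X.image (· - 1)).erase (i - 1)).card = X.card - 1 := by
      rw [Finset.card_erase_of_mem (Finset.mem_image_of_mem _ hi.1), e1]
    have e5 : X ∪ (X.image (· - 1)).erase (i - 1) ⊆ IL := by
      intro n hn
      rw [mL]
      rcases Finset.mem_union.1 hn with h | h
      · by_cases hnα : α < n
        · exact Or.inr ⟨himin n ⟨h, hnα⟩, hpmax n h⟩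
        · exact Or.inl (by omega)
      · obtain ⟨hne, h⟩ := Finset.mem_erase.1 h
        obtain ⟨b, hb, rfl⟩ := Finset.mem_image.1 h
        have hb1 := hXo b hb
        have hb2 := hXo i hi.1
        have hb3 := hpmax b hb
        by_cases hnα : α < b
        · have := himin b ⟨hb, hnα⟩
          right; omega
        · left; omega
    have := Finset.card_le_card e5
    omega
  have cR : 2 * W.card - 1 ≤ (IR.filter (q ≤ ·)).card := by
    have e1 : (W.image (· + 1)).card = W.card :=
      Finset.card_image_of_injective _ (add_left_injective 1)
    have e2 : Disjoint W ((W.image (· + 1)).erase (j + 1)) := by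
      rw [Finset.disjoint_left]
      intro n hn hn'
      obtain ⟨b, hb, rfl⟩ := Finset.mem_image.1 (Finset.mem_of_mem_erase hn')
      have := hWo _ hn; have := hWo b hb
      omega
    have e3 := Finset.card_union_of_disjoint e2
    have e4 : ((W.image (· + 1)).erase (j + 1)).card = W.card - 1 := by
      rw [Finset.card_erase_of_mem (Finset.mem_image_of_mem _ hj.1), e1]
    have e5 : W ∪ (W.image (· + 1)).erase (j + 1) ⊆ IR.filter (q ≤ ·) := by
      intro n hn
      rw [Finset.mem_filter, mR]
      rcases Finset.mem_union.1 hn with h | h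
      · have h1 := hqmin n h
        have h2 := lt_of_mem h
        by_cases hnk : n < k
        · have := hjmax n ⟨h, hnk⟩
          omega
        · omega
      · obtain ⟨hne, h⟩ := Finset.mem_erase.1 h
        obtain ⟨b, hb, rfl⟩ := Finset.mem_image.1 h
        have h1 := hqmin b hb
        have h2 := lt_of_mem hb
        by_cases hnk : b < k
        · have := hjmax b ⟨hb, hnk⟩
          omega
        · omega
    have := Finset.card_le_card e5
    omega
  -- An overlap occurs only at `p = q`, so the cycle has at least `2(|X| + |W|) - 3` vertices. It is
  -- even and shorter than `2ℓ`, hence at most `2ℓ - 2`, which gives the claim; without parity one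
  -- would be lost.
  have cLR : (IL ∩ IR.filter (q ≤ ·)).card ≤ 1 := by
    refine le_trans (Finset.card_le_card (t := {p}) ?_) (by simp)
    intro n hn
    rw [Finset.mem_inter, Finset.mem_filter, mL, mR] at hn
    rw [Finset.mem_singleton]
    omega
  have c1 := Finset.card_union_add_card_inter IL (IR.filter (q ≤ ·))
  have c2 : ((IL ∪ IR.filter (q ≤ ·)).image v).card ≤ (S' ∪ IR.image v ∪ S ∪ IL.image v).card := by
    refine Finset.card_le_card ?_
    rw [Finset.image_union]
    refine Finset.union_subset Finset.subset_union_right ?_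
    refine (Finset.image_subset_image (Finset.filter_subset _ _)).trans ?_
    intro z hz
    simp only [Finset.mem_union]
    tauto
  rw [hv.card_image (Finset.union_subset hLM ((Finset.filter_subset _ _).trans hRM))] at c2
  omega

omit [DecidableEq V] in
/-- A tightest crossing of the neighbours of the two ends of a path. -/
theorem exists_tightest_crossing
    (hc : ¬ ∀ i ∈ G.nbrIdx v M (v 0), ∀ j ∈ G.nbrIdx v M (v M), i ≤ j) :
    ∃ i ∈ G.nbrIdx v M (v 0), ∃ j ∈ G.nbrIdx v M (v M), j < i ∧
      ∀ i' ∈ G.nbrIdx v M (v 0), ∀ j' ∈ G.nbrIdx v M (v M), j' < i' → i - j ≤ i' - j' := by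
  push Not at hc
  obtain ⟨i, hi, j, hj, hij⟩ := hc
  obtain ⟨⟨i₀, j₀⟩, h1, h2⟩ := ((G.nbrIdx v M (v 0) ×ˢ G.nbrIdx v M (v M)).filter
    fun a => a.2 < a.1).exists_min_image (fun a => a.1 - a.2)
    ⟨(i, j), by simp [hi, hj, hij]⟩
  simp only [Finset.mem_filter, Finset.mem_product] at h1 h2
  exact ⟨i₀, h1.1.1, j₀, h1.1.2, h1.2, fun i' hi' j' hj' h => h2 (i', j') ⟨⟨hi', hj'⟩, h⟩⟩

/-- The cycle obtained from a crossing. -/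
theorem lt_of_crossing {k : ℕ} (hk : 3 ≤ k) (hC : G.NoCycleGE k) (hv : G.IPath v M) {i j : ℕ}
    (hi : i ∈ G.nbrIdx v M (v 0)) (hj : j ∈ G.nbrIdx v M (v M)) (hji : j < i) :
    j + 1 + (M + 1 - i) < k := by
  obtain ⟨hiM, hai⟩ := mem_nbrIdx.1 hi
  obtain ⟨hjM, haj⟩ := mem_nbrIdx.1 hj
  have sub : ∀ {I : Finset ℕ}, (∀ n ∈ I, n ≤ M) → I ⊆ Finset.Icc 0 M := fun h n hn =>
    Finset.mem_Icc.2 ⟨by omega, h n hn⟩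
  have hd : Disjoint (Finset.Icc 0 j) (Finset.Icc i M) := by
    rw [Finset.disjoint_left]; intro n hn hn'; rw [Finset.mem_Icc] at hn hn'; omega
  have h0 : Finset.Icc 0 j ⊆ Finset.Icc 0 M := sub fun n hn => by
    rw [Finset.mem_Icc] at hn; omega
  have h1 : Finset.Icc i M ⊆ Finset.Icc 0 M := sub fun n hn => by
    rw [Finset.mem_Icc] at hn; omega
  have hp := (hv.pathOn (Nat.zero_le j) (by omega)).join haj.symm (hv.pathOn hiM le_rfl).symm
    (hv.disjoint_image h0 h1 hd)
  have := hp.card_lt hk hC hai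
  rw [← Finset.image_union, hv.card_image (Finset.union_subset h0 h1),
    Finset.card_union_of_disjoint hd, Nat.card_Icc, Nat.card_Icc] at this
  omega

/-- A long path with ends in different classes. -/
theorem card_add_card_le_of_odd {ℓ : ℕ} (hℓ : 2 ≤ ℓ) (hA : G.IsClass A)
    (hG : G.IsTwoConnected) (hC : G.NoCycleGE (2 * ℓ)) (hv : G.IPath v M) (hM : 2 * ℓ ≤ M + 1)
    (hodd : M % 2 = 1) :
    (G.nbrIdx v M (v 0)).card + (G.nbrIdx v M (v M)).card ≤ ℓ := by
  by_cases hnc : ∀ i ∈ G.nbrIdx v M (v 0), ∀ j ∈ G.nbrIdx v M (v M), i ≤ j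
  · exact card_add_card_le_of_noncrossing hℓ hA hG hC hv (by omega) hnc
  obtain ⟨i, hi, j, hj, hji, hmin⟩ := exists_tightest_crossing hnc
  have hlt := hv.lt_of_crossing (by omega) hC hi hj hji
  set X := G.nbrIdx v M (v 0) with hX
  set W := G.nbrIdx v M (v M) with hW
  have hXo : ∀ n ∈ X, n % 2 = 1 := fun n hn => odd_of_mem hA hv hn
  have hWo : ∀ n ∈ W, (n + M) % 2 = 1 := fun n hn => parity_of_mem hA hv hn
  have hXM : ∀ n ∈ X, n ≤ M := fun n hn => (mem_nbrIdx.1 hn).1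
  have hWM : ∀ n ∈ W, n < M := fun n hn => lt_of_mem hn
  have hiM := hXM i hi
  have hio := hXo i hi
  have hjo := hWo j hj
  -- A crossing with `i = j + 1` would close a cycle through all `M + 1 ≥ 2ℓ` vertices. Gaps are odd
  -- here, so the tightest one is at least `3`, and with it all others.
  have hgap : ∀ n ∈ X, ∀ n' ∈ W, n' < n → j + 3 ≤ i ∧ n' + 3 ≤ n := by
    intro n hn n' hn' h
    have := hmin n hn n' hn' h
    have := hXo n hn
    have := hWo n' hn'
    have : i ≠ j + 1 := by rintro rfl; omega
    omega
  have e1 : (X.image (· - 1)).card = X.card := by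
    refine Finset.card_image_of_injOn fun a ha b hb hab => ?_
    have := hXo a ha; have := hXo b hb
    omega
  have e1' : (W.image (· + 1)).card = W.card :=
    Finset.card_image_of_injective _ (add_left_injective 1)
  have e4 : ((X.image (· - 1)).erase (i - 1)).card = X.card - 1 := by
    rw [Finset.card_erase_of_mem (Finset.mem_image_of_mem _ hi), e1]
  have e4' : ((W.image (· + 1)).erase (j + 1)).card = W.card - 1 := by
    rw [Finset.card_erase_of_mem (Finset.mem_image_of_mem _ hj), e1']
  have d1 : Disjoint X ((W.image (· + 1)).erase (j + 1)) := by
    rw [Finset.disjoint_left]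
    intro n hn hn'
    obtain ⟨b, hb, rfl⟩ := Finset.mem_image.1 (Finset.mem_of_mem_erase hn')
    have := hgap _ hn b hb (by omega)
    omega
  have d2 : Disjoint W ((X.image (· - 1)).erase (i - 1)) := by
    rw [Finset.disjoint_left]
    intro n hn hn'
    obtain ⟨b, hb, rfl⟩ := Finset.mem_image.1 (Finset.mem_of_mem_erase hn')
    have := hXo b hb
    have := hgap b hb _ hn (by omega)
    omega
  have d3 : Disjoint (X ∪ (W.image (· + 1)).erase (j + 1))
      (W ∪ (X.image (· - 1)).erase (i - 1)) := by
    have ho : ∀ n ∈ X ∪ (W.image (· + 1)).erase (j + 1), n % 2 = 1 := by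
      intro n hn
      rcases Finset.mem_union.1 hn with h | h
      · exact hXo n h
      · obtain ⟨b, hb, rfl⟩ := Finset.mem_image.1 (Finset.mem_of_mem_erase h)
        have := hWo b hb
        omega
    have he : ∀ n ∈ W ∪ (X.image (· - 1)).erase (i - 1), n % 2 = 0 := by
      intro n hn
      rcases Finset.mem_union.1 hn with h | h
      · have := hWo n h
        omega
      · obtain ⟨b, hb, rfl⟩ := Finset.mem_image.1 (Finset.mem_of_mem_erase h)
        have := hXo b hb
        omega
    rw [Finset.disjoint_left]
    intro n hn hn'
    have := ho n hn
    have := he n hn'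
    omega
  have hsub : (X ∪ (W.image (· + 1)).erase (j + 1)) ∪ (W ∪ (X.image (· - 1)).erase (i - 1)) ⊆
      Finset.Icc 0 j ∪ Finset.Icc i M := by
    -- Tightness leaves no neighbour of either end strictly between `j` and `i`.
    have hXn : ∀ n ∈ X, n ≤ j ∨ i ≤ n := by
      intro n hn
      by_contra h
      have := hmin n hn j hj (by omega)
      omega
    have hWn : ∀ n ∈ W, n ≤ j ∨ i ≤ n := by
      intro n hn
      by_contra h
      have := hmin i hi n hn (by omega)
      omega
    intro n hn
    simp only [Finset.mem_union, Finset.mem_erase, Finset.mem_image, Finset.mem_Icc] at hn ⊢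
    rcases hn with (h | ⟨hne, b, hb, rfl⟩) | (h | ⟨hne, b, hb, rfl⟩)
    · have := hXn n h; have := hXM n h; omega
    · have := hWn b hb; have := hWM b hb; omega
    · have := hWn n h; have := hWM n h; omega
    · have := hXn b hb; have := hXM b hb; omega
  have hc := Finset.card_le_card hsub
  rw [Finset.card_union_of_disjoint d3, Finset.card_union_of_disjoint d1,
    Finset.card_union_of_disjoint d2, e4, e4'] at hc
  have hc' := Finset.card_union_le (Finset.Icc 0 j) (Finset.Icc i M)
  rw [Nat.card_Icc, Nat.card_Icc] at hc'
  omega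

/-- A long path with ends in the same class, whose last vertex is adjacent to no vertex that
closes up a cycle with the rest. -/
theorem not_mem_of_even {ℓ : ℕ} (hℓ : 2 ≤ ℓ) (hC : G.NoCycleGE (2 * ℓ)) (hv : G.IPath v M)
    (hM : 2 * ℓ ≤ M) : M - 1 ∉ G.nbrIdx v M (v 0) := by
  intro h
  have h1 := (hv.pathOn (Nat.zero_le (M - 1)) (by omega)).card_lt (by omega) hC (mem_nbrIdx.1 h).2
  rw [hv.card_image (fun n hn => by rw [Finset.mem_Icc] at hn ⊢; omega), Nat.card_Icc] at h1
  omega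

/-- Counting along a tightest crossing of a path with ends in the same class. -/
theorem card_add_card_le_of_tightest_crossing (hA : G.IsClass A) (hv : G.IPath v M)
    (hM : 1 ≤ M) (heven : M % 2 = 0) {i j : ℕ} (hi : i ∈ G.nbrIdx v M (v 0))
    (hj : j ∈ G.nbrIdx v M (v M)) (hji : j + 4 ≤ i)
    (hmin : ∀ i' ∈ G.nbrIdx v M (v 0), ∀ j' ∈ G.nbrIdx v M (v M), j' < i' → i - j ≤ i' - j') :
    2 * ((G.nbrIdx v M (v 0)).card + (G.nbrIdx v M (v M)).card) ≤ j + 1 + (M + 1 - i) + 4 ∧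
    (M - 1 ∉ G.nbrIdx v M (v 0) → (G.nbrIdx v M (v M)).card = 2 →
      2 * ((G.nbrIdx v M (v 0)).card + (G.nbrIdx v M (v M)).card) ≤ j + 1 + (M + 1 - i) + 2) := by
  set X := G.nbrIdx v M (v 0) with hX
  set W := G.nbrIdx v M (v M) with hW
  have hMW : M - 1 ∈ W := by
    refine mem_nbrIdx.2 ⟨by omega, ?_⟩
    have := hv.adj (M - 1) (by omega)
    rw [show M - 1 + 1 = M by omega] at this
    exact this.symm
  have hXo : ∀ n ∈ X, n % 2 = 1 := fun n hn => odd_of_mem hA hv hn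
  have hWo : ∀ n ∈ W, (n + M) % 2 = 1 := fun n hn => parity_of_mem hA hv hn
  have hXM : ∀ n ∈ X, n ≤ M := fun n hn => (mem_nbrIdx.1 hn).1
  have hWM : ∀ n ∈ W, n < M := fun n hn => lt_of_mem hn
  have hiM := hXM i hi
  have hio := hXo i hi
  have hjo := hWo j hj
  have hgap : ∀ n ∈ X, ∀ n' ∈ W, n' < n → n' + 4 ≤ n := by
    intro n hn n' hn' h
    have := hmin n hn n' hn' h
    omega
  have e1 : (X.image (fun n => (n - 1) / 2)).card = X.card := by
    refine Finset.card_image_of_injOn fun a ha b hb hab => ?_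
    have := hXo a ha; have := hXo b hb
    omega
  have e1' : (W.image (fun n => (n + 1) / 2)).card = W.card := by
    refine Finset.card_image_of_injOn fun a ha b hb hab => ?_
    have := hWo a ha; have := hWo b hb
    omega
  -- All neighbours now have odd index. Predecessors of neighbours of `v 0` and successors of
  -- neighbours of `v M` have even index, recorded by its half; the ones inside the gap, `i - 1` and
  -- `j + 1`, are dropped. A common value would be a crossing of gap `2`.
  set X' := (X.image (fun n => (n - 1) / 2)).erase ((i - 1) / 2) with hX'
  set W' := (W.image (fun n => (n + 1) / 2)).erase ((j + 1) / 2) with hW'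
  have e4 : X'.card = X.card - 1 := by
    rw [hX', Finset.card_erase_of_mem (Finset.mem_image_of_mem _ hi), e1]
  have e4' : W'.card = W.card - 1 := by
    rw [hW', Finset.card_erase_of_mem (Finset.mem_image_of_mem _ hj), e1']
  have d1 : Disjoint X' W' := by
    rw [Finset.disjoint_left]
    intro n hn hn'
    obtain ⟨b, hb, h1⟩ := Finset.mem_image.1 (Finset.mem_of_mem_erase hn')
    obtain ⟨a, ha, h2⟩ := Finset.mem_image.1 (Finset.mem_of_mem_erase hn)
    have := hXo a ha
    have := hWo b hb
    have := hgap a ha b hb (by omega)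
    omega
  have hXn : ∀ n ∈ X, n ≤ j ∨ i ≤ n := by
    intro n hn
    by_contra h
    have := hmin n hn j hj (by omega)
    omega
  have hWn : ∀ n ∈ W, n ≤ j ∨ i ≤ n := by
    intro n hn
    by_contra h
    have := hmin i hi n hn (by omega)
    omega
  set T := Finset.Icc 0 ((j - 1) / 2) ∪ Finset.Icc ((i + 1) / 2) (M / 2) with hT
  have hsub : X' ∪ W' ⊆ T := by
    intro n hn
    simp only [hX', hW', hT, Finset.mem_union, Finset.mem_erase, Finset.mem_image,
      Finset.mem_Icc] at hn ⊢
    rcases hn with ⟨hne, b, hb, rfl⟩ | ⟨hne, b, hb, rfl⟩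
    · have := hXn b hb; have := hXM b hb; have := hXo b hb; omega
    · have := hWn b hb; have := hWM b hb; have := hWo b hb; omega
  have hcT : T.card ≤ (j - 1) / 2 + 1 + (M / 2 + 1 - (i + 1) / 2) := by
    refine (Finset.card_union_le _ _).trans ?_
    rw [Nat.card_Icc, Nat.card_Icc]
    omega
  have hc := Finset.card_le_card hsub
  rw [Finset.card_union_of_disjoint d1, e4, e4'] at hc
  have hWpos : 1 ≤ W.card := Finset.card_pos.2 ⟨_, hMW⟩
  have hXpos : 1 ≤ X.card := Finset.card_pos.2 ⟨_, hi⟩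
  refine ⟨by omega, fun hM1 h2 => ?_⟩
  have hjM : j ≠ M - 1 := by omega
  have hWeq : W = {j, M - 1} := by
    symm
    refine Finset.eq_of_subset_of_card_le ?_ ?_
    · intro n hn
      simp only [Finset.mem_insert, Finset.mem_singleton] at hn
      rcases hn with rfl | rfl
      · exact hj
      · exact hMW
    · rw [h2, Finset.card_pair hjM]
  have hi1 : i ≠ M - 1 := fun h => hM1 (h ▸ hi)
  -- The even index `M - 2` on the crossing cycle is not counted: its successor `M - 1` is no
  -- neighbour of `v 0`, and as `W = {j, M - 1}` it could only be the dropped `j + 1`. This gains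
  -- one.
  have hnot : (M - 2) / 2 ∉ X' ∪ W' := by
    intro hn
    simp only [hX', hW', Finset.mem_union, Finset.mem_erase, Finset.mem_image] at hn
    rcases hn with ⟨hne, b, hb, hbe⟩ | ⟨hne, b, hb, hbe⟩
    · have h1 := hXo b hb
      exact hM1 ((show b = M - 1 by omega) ▸ hb)
    · rw [hWeq, Finset.mem_insert, Finset.mem_singleton] at hb
      rcases hb with rfl | rfl <;> omega
  have hmem : (M - 2) / 2 ∈ T := by
    simp only [hT, Finset.mem_union, Finset.mem_Icc]
    omega
  have hc2 := Finset.card_le_card (Finset.insert_subset hmem hsub)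
  rw [Finset.card_insert_of_notMem hnot, Finset.card_union_of_disjoint d1, e4, e4'] at hc2
  omega

/-- A long path with ends in the same class. -/
theorem card_add_card_le_of_even {ℓ : ℕ} (hℓ : 2 ≤ ℓ) (hA : G.IsClass A)
    (hG : G.IsTwoConnected) (hC : G.NoCycleGE (2 * ℓ)) (hv : G.IPath v M) (hM : 2 * ℓ ≤ M)
    (heven : M % 2 = 0) :
    (G.nbrIdx v M (v 0)).card + (G.nbrIdx v M (v M)).card ≤ ℓ + 1 ∧
    ((G.nbrIdx v M (v M)).card = 2 →
      (G.nbrIdx v M (v 0)).card + (G.nbrIdx v M (v M)).card ≤ ℓ) := by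
  by_cases hnc : ∀ i ∈ G.nbrIdx v M (v 0), ∀ j ∈ G.nbrIdx v M (v M), i ≤ j
  · have := card_add_card_le_of_noncrossing hℓ hA hG hC hv (by omega) hnc
    exact ⟨by omega, fun _ => this⟩
  have hM1 := not_mem_of_even hℓ hC hv hM
  obtain ⟨i, hi, j, hj, hji, hmin⟩ := exists_tightest_crossing hnc
  have hlt := hv.lt_of_crossing (by omega) hC hi hj hji
  have := odd_of_mem hA hv hi
  have := parity_of_mem hA hv hj
  have := (mem_nbrIdx.1 hi).1
  -- A gap of `2` would give a cycle on `M ≥ 2ℓ` vertices, so by parity `i - j ≥ 4`. The cycle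
  -- itself is even, hence has at most `2ℓ - 2` vertices.
  obtain ⟨h1, h2⟩ := card_add_card_le_of_tightest_crossing hA hv (by omega) heven hi hj (by omega)
    hmin
  exact ⟨by omega, fun h => by have := h2 hM1 h; omega⟩

end IPath
end SimpleGraph

/-! ### Three parallel paths, for `ℓ = 5` -/

namespace SimpleGraph

variable {V : Type*} [DecidableEq V] {G : SimpleGraph V} {A B : Finset V} {ℓ : ℕ}

/-- A cycle running through one of three parallel paths and crossing from the second of them to
the third. -/
theorem card_add_lt_of_theta {k : ℕ} (hk : 3 ≤ k) (hA : G.IsClass A) (hC : G.NoCycleGE k)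
    (hk2 : Even k) {s t u w : V} {S R T Q : Finset V} (hS : G.PathOn s t S) (hR : G.PathOn s u R)
    (hT : G.PathOn w t T) (hQ : G.PathOn u w Q) (hS3 : 3 ≤ S.card)
    (h1 : ∀ z ∈ S, z ∈ T → z = t) (h2 : ∀ z ∈ R, z ∈ Q → z = u) (h3 : ∀ z ∈ S, z ∈ R → z = s)
    (h4 : ∀ z ∈ S, z ∉ Q) (h5 : ∀ z ∈ T, z ∉ R) (h6 : ∀ z ∈ T, z ∈ Q → z = w) :
    S.card + R.card + T.card + Q.card + 2 ≤ k + 4 := by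
  have i1 : S ∩ T ⊆ {t} := fun z hz => by
    rw [Finset.mem_inter] at hz; simpa using h1 z hz.1 hz.2
  have i2 : R ∩ Q ⊆ {u} := fun z hz => by
    rw [Finset.mem_inter] at hz; simpa using h2 z hz.1 hz.2
  have p1 := hS.glue hT.symm i1
  have p2 := hR.glue hQ i2
  have i3 : (S ∪ T) ∩ (R ∪ Q) ⊆ {s, w} := by
    intro z hz
    simp only [Finset.mem_inter, Finset.mem_union, Finset.mem_insert,
      Finset.mem_singleton] at hz ⊢
    rcases hz with ⟨ha | ha, hb | hb⟩
    · exact Or.inl (h3 z ha hb)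
    · exact absurd hb (h4 z ha)
    · exact absurd hb (h5 z ha)
    · exact Or.inr (h6 z ha hb)
  obtain ⟨a, ha, hp⟩ := p1.exists_adj_pathOn p2 i3
    (hS3.trans (Finset.card_le_card Finset.subset_union_left))
  -- The four paths are the consecutive arcs of the cycle and overlap in four vertices at most;
  -- since `k` is even, the cycle has at most `k - 2` vertices.
  have hlt := hp.card_lt hk hC ha
  obtain ⟨c, hc⟩ := hp.even_card hA ha
  obtain ⟨d, hd⟩ := hk2
  have c1 := Finset.card_union_add_card_inter S T
  have c2 := Finset.card_union_add_card_inter R Q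
  have c3 := Finset.card_union_add_card_inter (S ∪ T) (R ∪ Q)
  have j1 := Finset.card_le_card i1
  have j2 := Finset.card_le_card i2
  have j3 := (Finset.card_le_card i3).trans Finset.card_le_two
  rw [Finset.card_singleton] at j1 j2
  omega

/-- The bridge `Q` cuts `S₁` and `S₂` into two pieces each. Two cycles use `S₃`, `Q` and
complementary pieces. Adding their bounds `12` for the sums of arc sizes gives `10 + 6 + 6 + 2|Q| ≤
24`, so `|Q| ≤ 1`, although `Q` has two distinct ends. -/
theorem false_of_theta_bridge (hA : G.IsClass A) (hC : G.NoCycleGE 10) {s t u w : V}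
    {S₁ S₂ S₃ Q : Finset V} (h1 : G.PathOn s t S₁) (h2 : G.PathOn s t S₂)
    (h3 : G.PathOn s t S₃) (h12 : S₁ ∩ S₂ ⊆ {s, t}) (h13 : S₁ ∩ S₃ ⊆ {s, t})
    (h23 : S₂ ∩ S₃ ⊆ {s, t}) (c1 : S₁.card = 5) (c2 : S₂.card = 5) (c3 : S₃.card = 5)
    (hQ : G.PathOn u w Q) (hu : u ∈ S₁) (hw : w ∈ S₂) (hsQ : s ∉ Q) (htQ : t ∉ Q)
    (q1 : ∀ z ∈ Q, z ∈ S₁ → z = u) (q2 : ∀ z ∈ Q, z ∈ S₂ → z = w) (q3 : ∀ z ∈ Q, z ∉ S₃)  :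
    False := by
  obtain ⟨R, R', hR, hR', hRR, hRi⟩ := h1.split hu
  obtain ⟨T, T', hT, hT', hTT, hTi⟩ := h2.split hw
  have hus : u ≠ s := fun h => hsQ (h ▸ hQ.left_mem)
  have hut : u ≠ t := fun h => htQ (h ▸ hQ.left_mem)
  have hws : w ≠ s := fun h => hsQ (h ▸ hQ.right_mem)
  have hwt : w ≠ t := fun h => htQ (h ▸ hQ.right_mem)
  have hR1 : ∀ z ∈ R, z ∈ S₁ := fun z hz => hRR ▸ Finset.mem_union_left _ hz
  have hR1' : ∀ z ∈ R', z ∈ S₁ := fun z hz => hRR ▸ Finset.mem_union_right _ hz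
  have hT1 : ∀ z ∈ T, z ∈ S₂ := fun z hz => hTT ▸ Finset.mem_union_left _ hz
  have hT1' : ∀ z ∈ T', z ∈ S₂ := fun z hz => hTT ▸ Finset.mem_union_right _ hz
  have ri : ∀ z, z ∈ R → z ∈ R' → z = u := fun z hz hz' => by
    have : z ∈ R ∩ R' := Finset.mem_inter.2 ⟨hz, hz'⟩
    rwa [hRi, Finset.mem_singleton] at this
  have ti : ∀ z, z ∈ T → z ∈ T' → z = w := fun z hz hz' => by
    have : z ∈ T ∩ T' := Finset.mem_inter.2 ⟨hz, hz'⟩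
    rwa [hTi, Finset.mem_singleton] at this
  have i12 : ∀ z, z ∈ S₁ → z ∈ S₂ → z = s ∨ z = t := fun z hz hz' => by
    simpa using h12 (Finset.mem_inter.2 ⟨hz, hz'⟩)
  have i13 : ∀ z, z ∈ S₁ → z ∈ S₃ → z = s ∨ z = t := fun z hz hz' => by
    simpa using h13 (Finset.mem_inter.2 ⟨hz, hz'⟩)
  have i23 : ∀ z, z ∈ S₂ → z ∈ S₃ → z = s ∨ z = t := fun z hz hz' => by
    simpa using h23 (Finset.mem_inter.2 ⟨hz, hz'⟩)
  have b1 := card_add_lt_of_theta (by omega) hA hC (by decide) h3 hR hT' hQ (by omega)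
    (fun z hz hz' => (i23 z (hT1' z hz') hz).resolve_left fun h =>
      hws (ti s hT.left_mem (h ▸ hz')).symm)
    (fun z hz hz' => q1 z hz' (hR1 z hz))
    (fun z hz hz' => (i13 z (hR1 z hz') hz).resolve_right fun h =>
      hut (ri t (h ▸ hz') hR'.right_mem).symm)
    (fun z hz hz' => q3 z hz' hz)
    (fun z hz hz' => by
      rcases i12 z (hR1 z hz') (hT1' z hz) with rfl | rfl
      · exact hws (ti _ hT.left_mem hz).symm
      · exact hut (ri _ hz' hR'.right_mem).symm)
    (fun z hz hz' => q2 z hz' (hT1' z hz))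
  have b2 := card_add_lt_of_theta (by omega) hA hC (by decide) h3.symm hR'.symm hT.symm hQ
    (by omega)
    (fun z hz hz' => (i23 z (hT1 z hz') hz).resolve_right fun h =>
      hwt (ti t (h ▸ hz') hT'.right_mem).symm)
    (fun z hz hz' => q1 z hz' (hR1' z hz))
    (fun z hz hz' => (i13 z (hR1' z hz') hz).resolve_left fun h =>
      hus (ri s hR.left_mem (h ▸ hz')).symm)
    (fun z hz hz' => q3 z hz' hz)
    (fun z hz hz' => by
      rcases i12 z (hR1' z hz') (hT1 z hz) with rfl | rfl
      · exact hus (ri _ hR.left_mem hz').symm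
      · exact hwt (ti _ hz hT'.right_mem).symm)
    (fun z hz hz' => q2 z hz' (hT1 z hz))
  have k1 := Finset.card_union_add_card_inter R R'
  have k2 := Finset.card_union_add_card_inter T T'
  rw [hRR, hRi, Finset.card_singleton] at k1
  rw [hTT, hTi, Finset.card_singleton] at k2
  have huw : u ≠ w := by
    rintro rfl
    rcases i12 u hu hw with h | h
    · exact hus h
    · exact hut h
  have k3 : 2 ≤ Q.card := by
    rw [← Finset.card_pair huw]
    refine Finset.card_le_card fun z hz => ?_
    rw [Finset.mem_insert, Finset.mem_singleton] at hz
    rcases hz with rfl | rfl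
    · exact hQ.left_mem
    · exact hQ.right_mem
  omega

/-- Three long parallel paths between two vertices which do not separate the graph. -/
theorem false_of_theta (hA : G.IsClass A) (hC : G.NoCycleGE 10) {s t : V}
    {S₁ S₂ S₃ : Finset V} (h1 : G.PathOn s t S₁) (h2 : G.PathOn s t S₂)
    (h3 : G.PathOn s t S₃) (h12 : S₁ ∩ S₂ ⊆ {s, t}) (h13 : S₁ ∩ S₃ ⊆ {s, t})
    (h23 : S₂ ∩ S₃ ⊆ {s, t}) (c12 : 10 ≤ S₁.card + S₂.card) (c3 : 5 ≤ S₃.card)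
    (hconn : ∀ u w, u ≠ s → u ≠ t → w ≠ s → w ≠ t →
      ∃ p : G.Walk u w, ∀ z ∈ p.support, z ∉ ({s, t} : Set V)) : False := by
  have key : ∀ {S T : Finset V}, G.PathOn s t S → G.PathOn s t T → S ∩ T ⊆ {s, t} →
      3 ≤ S.card → S.card + T.card ≤ 11 := by
    intro S T hS hT hi h3
    obtain ⟨u, hu, hp⟩ := hS.exists_adj_pathOn hT hi h3
    have := hp.card_lt (by omega) hC hu
    have := Finset.card_union_add_card_inter S T
    have := (Finset.card_le_card hi).trans Finset.card_le_two
    omega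
  have k13 := key h3 h1 (by rwa [Finset.inter_comm]) (by omega)
  have k23 := key h3 h2 (by rwa [Finset.inter_comm]) (by omega)
  have k12 := key h1 h2 h12 (by omega)
  -- All three sizes have the same parity. With the pairwise bound `11` this leaves only five
  -- vertices on each path.
  have m1 := h1.mem_iff hA
  have m2 := h2.mem_iff hA
  have m3 := h3.mem_iff hA
  rw [m1, Nat.odd_iff, Nat.odd_iff] at m2 m3
  have e1 : S₁.card = 5 := by omega
  have e2 : S₂.card = 5 := by omega
  have e3 : S₃.card = 5 := by omega
  have hex : ∀ {S : Finset V}, S.card = 5 → ∃ u ∈ S, u ≠ s ∧ u ≠ t := by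
    intro S hS
    obtain ⟨u, hu, hu'⟩ : ∃ u ∈ S, u ∉ ({s, t} : Finset V) := by
      by_contra hcon
      push Not at hcon
      have := (Finset.card_le_card hcon).trans Finset.card_le_two
      omega
    exact ⟨u, hu, by simpa using hu'⟩
  obtain ⟨u, hu, hus, hut⟩ := hex e1
  obtain ⟨w, hw, hws, hwt⟩ := hex e2
  obtain ⟨p, hp⟩ := hconn u w hus hut hws hwt
  -- A connection avoiding `s` and `t` leaves the first path and stops at whichever of the other two
  -- it meets; their roles are symmetric.
  obtain ⟨u', ⟨hu', hus', hut'⟩, w', ⟨hw', hws', hwt'⟩, Q, hQ, hZ, hU, hT⟩ :=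
    exists_pathOn_of_walk (U := {z | z ∈ S₁ ∧ z ≠ s ∧ z ≠ t})
      (T := {z | (z ∈ S₂ ∨ z ∈ S₃) ∧ z ≠ s ∧ z ≠ t}) p ⟨hu, hus, hut⟩ ⟨Or.inl hw, hws, hwt⟩ hp
  have hsQ : s ∉ Q := fun h => hZ s h (by simp)
  have htQ : t ∉ Q := fun h => hZ t h (by simp)
  have hne : ∀ z ∈ Q, z ≠ s ∧ z ≠ t := fun z hz =>
    ⟨fun h => hsQ (h ▸ hz), fun h => htQ (h ▸ hz)⟩
  have q1 : ∀ z ∈ Q, z ∈ S₁ → z = u' := fun z hz h => hU z hz ⟨h, hne z hz⟩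
  have q2 : ∀ z ∈ Q, z ∈ S₂ → z = w' := fun z hz h => hT z hz ⟨Or.inl h, hne z hz⟩
  have q3 : ∀ z ∈ Q, z ∈ S₃ → z = w' := fun z hz h => hT z hz ⟨Or.inr h, hne z hz⟩
  have hw23 : w' ∈ S₂ → w' ∉ S₃ := fun h h' => by
    have := h23 (Finset.mem_inter.2 ⟨h, h'⟩)
    rw [Finset.mem_insert, Finset.mem_singleton] at this
    exact this.elim hws' hwt'
  rcases hw' with hw' | hw'
  · exact false_of_theta_bridge hA hC h1 h2 h3 h12 h13 h23 e1 e2 e3 hQ hu' hw' hsQ htQ q1 q2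
      fun z hz h => hw23 hw' (q3 z hz h ▸ h)
  · exact false_of_theta_bridge hA hC h1 h3 h2 h13 h12 (by rwa [Finset.inter_comm]) e1 e3 e2 hQ
      hu' hw' hsQ htQ q1 q3 fun z hz h => hw23 (q2 z hz h ▸ h) hw'

/-- A path with ends in the same class whose ends have at least three neighbours each on it. -/
theorem IPath.false_of_three {v : ℕ → V} {M : ℕ} (hA : G.IsClass A) (hG : G.IsTwoConnected)
    (hC : G.NoCycleGE 10) (hv : G.IPath v M) (hM : 10 ≤ M) (heven : M % 2 = 0)
    (h0 : 3 ≤ (G.nbrIdx v M (v 0)).card) (h1 : 3 ≤ (G.nbrIdx v M (v M)).card)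
    (hconn : ∀ s t, (s ∈ A ↔ v 0 ∉ A) → (t ∈ A ↔ v 0 ∉ A) →
      ∀ u w, u ≠ s → u ≠ t → w ≠ s → w ≠ t →
      ∃ p : G.Walk u w, ∀ z ∈ p.support, z ∉ ({s, t} : Set V)) : False := by
  by_cases hnc : ∀ i ∈ G.nbrIdx v M (v 0), ∀ j ∈ G.nbrIdx v M (v M), i ≤ j
  · have := card_add_card_le_of_noncrossing (ℓ := 5) (by omega) hA hG hC hv (by omega) hnc
    omega
  obtain ⟨i, hi, j, hj, hji, hmin⟩ := exists_tightest_crossing hnc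
  have hlt := hv.lt_of_crossing (by omega) hC hi hj hji
  have hio := odd_of_mem hA hv hi
  have hjo := parity_of_mem hA hv hj
  have hiM := (mem_nbrIdx.1 hi).1
  have hjM := lt_of_mem hj
  -- Three neighbours at each end force the crossing cycle to have at least eight vertices. The
  -- outer two paths from `v j` to `v i` then have at least ten vertices in all, and `i - j ≥ 4`
  -- gives five on the middle one.
  have hc := (card_add_card_le_of_tightest_crossing hA hv (by omega) heven hi hj (by omega)
    hmin).1
  -- the three parallel paths
  have hai := (mem_nbrIdx.1 hi).2
  have haj := (mem_nbrIdx.1 hj).2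
  have hinj : ∀ a ≤ M, ∀ b ≤ M, v a = v b → a = b := hv.inj
  have mem_im : ∀ {a b : ℕ} {z : V}, z ∈ (Finset.Icc a b).image v → ∃ n, a ≤ n ∧ n ≤ b ∧
      z = v n := by
    intro a b z hz
    obtain ⟨n, hn, rfl⟩ := Finset.mem_image.1 hz
    rw [Finset.mem_Icc] at hn
    exact ⟨n, hn.1, hn.2, rfl⟩
  have notmem : ∀ {a b n : ℕ}, b ≤ M → n ≤ M → (n < a ∨ b < n) →
      v n ∉ (Finset.Icc a b).image v := by
    intro a b n hb hn hor hz
    obtain ⟨m, hm1, hm2, he⟩ := mem_im hz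
    have := hinj _ hn _ (by omega) he
    omega
  have p1 := ((hv.pathOn (Nat.zero_le j) (by omega)).symm.concat hai
    (notmem (by omega) hiM (by omega)))
  have p2 := (hv.pathOn hiM le_rfl).symm.cons haj.symm (notmem le_rfl (by omega) (by omega))
  have p3 := hv.pathOn hji.le hiM
  have cI : ∀ {a b : ℕ}, b ≤ M → ((Finset.Icc a b).image v).card = b + 1 - a := by
    intro a b hb
    rw [hv.card_image (fun n hn => by rw [Finset.mem_Icc] at hn ⊢; omega), Nat.card_Icc]
  have vji : v j ≠ v i := fun h => by have := hinj _ (by omega) _ hiM h; omega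
  refine false_of_theta hA hC p1 p2 p3 ?_ ?_ ?_ ?_ ?_
    (hconn _ _ ?_ ?_)
  · intro z hz
    rw [Finset.mem_inter, Finset.mem_insert, Finset.mem_insert] at hz
    obtain ⟨h1 | h1, h2 | h2⟩ := hz
    · simp [h1]
    · simp [h1]
    · simp [h2]
    · obtain ⟨n, hn1, hn2, rfl⟩ := mem_im h1
      exact absurd h2 (notmem le_rfl (by omega) (by omega))
  · intro z hz
    rw [Finset.mem_inter, Finset.mem_insert] at hz
    obtain ⟨rfl | h1, h2⟩ := hz
    · simp
    · obtain ⟨n, hn1, hn2, rfl⟩ := mem_im h1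
      by_cases hnj : n = j
      · simp [hnj]
      · exact absurd h2 (notmem hiM (by omega) (by omega))
  · intro z hz
    rw [Finset.mem_inter, Finset.mem_insert] at hz
    obtain ⟨rfl | h1, h2⟩ := hz
    · simp
    · obtain ⟨n, hn1, hn2, rfl⟩ := mem_im h1
      by_cases hni : n = i
      · simp [hni]
      · exact absurd h2 (notmem hiM (by omega) (by omega))
  · rw [Finset.card_insert_of_notMem (notmem (by omega) hiM (by omega)),
      Finset.card_insert_of_notMem (notmem le_rfl (by omega) (by omega)), cI (by omega),
      cI le_rfl]
    omega
  · rw [cI hiM]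
    omega
  · have := hv.mem_iff hA (i := j) (by omega)
    have h2 : ¬ Even j := by rw [Nat.not_even_iff_odd, Nat.odd_iff]; omega
    tauto
  · have := hv.mem_iff hA hiM
    have h2 : ¬ Even i := by rw [Nat.not_even_iff_odd, Nat.odd_iff]; omega
    tauto

end SimpleGraph

/-! ### Saturated paths in edge-maximal graphs -/

namespace SimpleGraph

variable {V : Type*}

open Classical in
/-- The number of neighbours of `v` in `S`. -/
noncomputable def degIn (G : SimpleGraph V) (S : Finset V) (v : V) : ℕ := (S.filter (G.Adj v)).card

variable [DecidableEq V] {G : SimpleGraph V} {A B : Finset V} {ℓ : ℕ}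

omit [DecidableEq V] in
theorem degIn_mono {S T : Finset V} (h : S ⊆ T) (v : V) : G.degIn S v ≤ G.degIn T v := by
  classical exact Finset.card_le_card (Finset.filter_subset_filter _ h)

omit [DecidableEq V] in
theorem degIn_le_card (S : Finset V) (v : V) : G.degIn S v ≤ S.card := by
  classical exact Finset.card_filter_le _ _

omit [DecidableEq V] in
/-- If all neighbours of `v` in `S` lie in `T`, then it has at most as many in `T`. -/
theorem degIn_le_of_forall {S T : Finset V} {v : V} (h : ∀ z ∈ S, G.Adj v z → z ∈ T) :
    G.degIn S v ≤ G.degIn T v := by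
  classical
  refine Finset.card_le_card fun z hz => ?_
  rw [Finset.mem_filter] at hz ⊢
  exact ⟨h z hz.1 hz.2, hz.2⟩

omit [DecidableEq V] in
/-- If `v` is adjacent to all of `T ⊆ S`, then it has at least `T.card` neighbours in `S`. -/
theorem card_le_degIn {S T : Finset V} {v : V} (hTS : T ⊆ S) (h : ∀ z ∈ T, G.Adj v z) :
    T.card ≤ G.degIn S v := by
  classical
  refine Finset.card_le_card fun z hz => ?_
  rw [Finset.mem_filter]
  exact ⟨hTS hz, h z hz⟩

/-- The path `v 0, …, v M` leads from `S` to `T`, and cannot be prolonged at its first vertex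
inside `S`, nor at its last vertex inside `T`. -/
structure Saturated (G : SimpleGraph V) (S T : Finset V) (v : ℕ → V) (M : ℕ) : Prop where
  path : G.IPath v M
  left : v 0 ∈ S
  right : v M ∈ T
  left_sat : ∀ z ∈ S, G.Adj (v 0) z → ∃ i ≤ M, z = v i
  right_sat : ∀ z ∈ T, G.Adj (v M) z → ∃ i ≤ M, z = v i

theorem degIn_le_card_nbrIdx {S : Finset V} {v : ℕ → V} {M : ℕ} {u : V}
    (h : ∀ z ∈ S, G.Adj u z → ∃ i ≤ M, z = v i) : G.degIn S u ≤ (G.nbrIdx v M u).card := by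
  classical
  refine le_trans (Finset.card_le_card fun z hz => ?_)
    (Finset.card_image_le (s := G.nbrIdx v M u) (f := v))
  rw [Finset.mem_filter] at hz
  obtain ⟨i, hi, rfl⟩ := h z hz.1 hz.2
  exact Finset.mem_image_of_mem _ (mem_nbrIdx.2 ⟨hi, hz.2⟩)

/-- Among all paths from `S` to `T`, take one with most vertices: a missed neighbour in `S` of its
first vertex, or in `T` of its last, would prolong it to another such path. -/
theorem exists_saturated [Fintype V] {S T : Finset V} {x y : V} {s : Finset V} (hx : x ∈ S)
    (hy : y ∈ T) (hs : G.PathOn x y s) : ∃ v M, G.Saturated S T v M ∧ s.card ≤ M + 1 := by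
  classical
  obtain ⟨t, ht, hmax⟩ := ((Finset.univ : Finset (Finset V)).filter fun t =>
    ∃ x ∈ S, ∃ y ∈ T, G.PathOn x y t).exists_max_image Finset.card
      ⟨s, by simpa using ⟨x, hx, y, hy, hs⟩⟩
  simp only [Finset.mem_filter, Finset.mem_univ, true_and] at ht hmax
  obtain ⟨x', hx', y', hy', ht⟩ := ht
  obtain ⟨v, M, hv, rfl, rfl, hc, htv⟩ := ht.exists_iPath
  have key : ∀ z, z ∈ t → ∃ i ≤ M, z = v i := by
    intro z hz
    rw [htv] at hz
    obtain ⟨i, hi, rfl⟩ := Finset.mem_image.1 hz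
    exact ⟨i, (Finset.mem_Icc.1 hi).2, rfl⟩
  refine ⟨v, M, ⟨hv, hx', hy', fun z hz ha => ?_, fun z hz ha => ?_⟩,
    hc ▸ hmax s ⟨x, hx, y, hy, hs⟩⟩
  · by_contra hcon
    have hzt : z ∉ t := fun h => hcon (key z h)
    have := hmax _ ⟨z, hz, _, hy', ht.cons ha.symm hzt⟩
    rw [Finset.card_insert_of_notMem hzt] at this
    omega
  · by_contra hcon
    have hzt : z ∉ t := fun h => hcon (key z h)
    have := hmax _ ⟨_, hx', z, hz, ht.concat ha hzt⟩
    rw [Finset.card_insert_of_notMem hzt] at this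
    omega

/-- `G` is a `2`-connected bipartite graph with classes `A` and `B`, without cycles of length at
least `2 * ℓ`, and adding any edge between the classes produces such a cycle. -/
structure Extremal (G : SimpleGraph V) (A B : Finset V) (ℓ : ℕ) : Prop where
  compl : ∀ x, x ∈ B ↔ x ∉ A
  isClass : G.IsClass A
  two : G.IsTwoConnected
  noCycle : G.NoCycleGE (2 * ℓ)
  maximal : ∀ x ∈ A, ∀ y ∈ B, ¬ G.Adj x y → ∃ s, G.PathOn x y s ∧ 2 * ℓ ≤ s.card
  four_le : 4 ≤ ℓ
  le_left : ℓ ≤ A.card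
  le_right : ℓ ≤ B.card

namespace Extremal

omit [DecidableEq V] in
theorem _root_.SimpleGraph.IsClass.compl (h : G.IsClass A) (hc : ∀ x, x ∈ B ↔ x ∉ A) :
    G.IsClass B := by
  intro x y ha
  have := h x y ha
  rw [hc, hc]
  tauto

theorem symm (h : G.Extremal A B ℓ) : G.Extremal B A ℓ where
  compl x := by have := h.compl x; tauto
  isClass := h.isClass.compl h.compl
  two := h.two
  noCycle := h.noCycle
  maximal x hx y hy ha := by
    obtain ⟨s, hs, hc⟩ := h.maximal y hy x hx fun h => ha h.symm
    exact ⟨s, hs.symm, hc⟩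
  four_le := h.four_le
  le_left := h.le_right
  le_right := h.le_left

section
variable {S T : Finset V} {v : ℕ → V} {M : ℕ}

theorem parity (h : G.Extremal A B ℓ) (hv : G.IPath v M) (hA : v 0 ∈ A ↔ v M ∈ A) :
    M % 2 = 0 := by
  have := hv.mem_iff h.isClass le_rfl
  rw [← Nat.even_iff]
  tauto

/-- By saturation the neighbours counted in `S` and `T` all lie on the path, so the end-degree bound
for odd `M` applies. -/
theorem degIn_add_degIn_le (h : G.Extremal A B ℓ) (hs : G.Saturated S T v M)
    (hM : 2 * ℓ ≤ M + 1) (hA : v 0 ∈ A ↔ v M ∉ A) :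
    G.degIn S (v 0) + G.degIn T (v M) ≤ ℓ := by
  have h4 := h.four_le
  have h1 := degIn_le_card_nbrIdx hs.left_sat
  have h2 := degIn_le_card_nbrIdx hs.right_sat
  have h3 := hs.path.mem_iff h.isClass le_rfl
  have hodd : M % 2 = 1 := by
    rw [← Nat.odd_iff, ← Nat.not_even_iff_odd]
    tauto
  have := hs.path.card_add_card_le_of_odd (by omega) h.isClass h.two h.noCycle hM hodd
  omega

theorem degIn_add_degIn_le_succ (h : G.Extremal A B ℓ) (hs : G.Saturated S T v M)
    (hM : 2 * ℓ ≤ M + 1) (hA : v 0 ∈ A ↔ v M ∈ A) :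
    G.degIn S (v 0) + G.degIn T (v M) ≤ ℓ + 1 := by
  have h4 := h.four_le
  have h1 := degIn_le_card_nbrIdx hs.left_sat
  have h2 := degIn_le_card_nbrIdx hs.right_sat
  have hev := h.parity hs.path hA
  have := (hs.path.card_add_card_le_of_even (by omega) h.isClass h.two h.noCycle (by omega)
    hev).1
  omega

/-- If `v M` has exactly two neighbours on the path, the improved bound `ℓ` applies; if it has at
least three, the bound `ℓ + 1` suffices. -/
theorem degIn_add_two_le (h : G.Extremal A B ℓ) (hs : G.Saturated S T v M)
    (hM : 2 * ℓ ≤ M + 1) (hA : v 0 ∈ A ↔ v M ∈ A) (h2T : 2 ≤ G.degIn T (v M)) :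
    G.degIn S (v 0) + 2 ≤ ℓ := by
  have h4 := h.four_le
  have h1 := degIn_le_card_nbrIdx hs.left_sat
  have h2 := degIn_le_card_nbrIdx hs.right_sat
  have hev := h.parity hs.path hA
  obtain ⟨h3, h4⟩ := hs.path.card_add_card_le_of_even (by omega) h.isClass h.two h.noCycle
    (by omega) hev
  by_cases h5 : (G.nbrIdx v M (v M)).card = 2
  · have := h4 h5
    omega
  · omega

/-- The vertex `v (M - 1)` is a neighbour of `v M` but not of `v 0`, since otherwise a cycle on `M ≥
2ℓ` vertices would close. By `hsub` it is not in `T`, so `v M` has a neighbour on the path beyond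
those counted in `T`, which saves one. -/
theorem degIn_add_degIn_le_of_subset (h : G.Extremal A B ℓ) (hs : G.Saturated S T v M)
    (hM : 2 * ℓ ≤ M + 1) (hA : v 0 ∈ A ↔ v M ∈ A)
    (hsub : ∀ z ∈ T, G.Adj (v M) z → G.Adj (v 0) z) :
    G.degIn S (v 0) + G.degIn T (v M) ≤ ℓ := by
  classical
  have h4 := h.four_le
  have h1 := degIn_le_card_nbrIdx hs.left_sat
  have hev := h.parity hs.path hA
  have h3 := (hs.path.card_add_card_le_of_even (by omega) h.isClass h.two h.noCycle (by omega)
    hev).1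
  have hM1 := hs.path.not_mem_of_even (ℓ := ℓ) (by omega) h.noCycle (by omega)
  have hadj : G.Adj (v M) (v (M - 1)) := by
    have := hs.path.adj (M - 1) (by omega)
    rw [show M - 1 + 1 = M by omega] at this
    exact this.symm
  have hMT : v (M - 1) ∉ T := fun hT =>
    hM1 (mem_nbrIdx.2 ⟨by omega, hsub _ hT hadj⟩)
  have h5 : G.degIn (insert (v (M - 1)) T) (v M) = G.degIn T (v M) + 1 := by
    rw [degIn, Finset.filter_insert, if_pos hadj, Finset.card_insert_of_notMem]
    · rfl
    · simp [hMT]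
  have h6 : G.degIn (insert (v (M - 1)) T) (v M) ≤ (G.nbrIdx v M (v M)).card := by
    refine degIn_le_card_nbrIdx fun z hz ha => ?_
    rcases Finset.mem_insert.1 hz with rfl | hz
    · exact ⟨M - 1, by omega, rfl⟩
    · exact hs.right_sat z hz ha
  omega

theorem false_of_three (h : G.Extremal A B 5) (hs : G.Saturated S T v M)
    (hM : 10 ≤ M + 1) (hA : v 0 ∈ A ↔ v M ∈ A) (h1 : 3 ≤ G.degIn S (v 0))
    (h2 : 3 ≤ G.degIn T (v M))
    (hconn : ∀ s t, (s ∈ A ↔ v 0 ∉ A) → (t ∈ A ↔ v 0 ∉ A) →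
      ∀ u w, u ≠ s → u ≠ t → w ≠ s → w ≠ t →
      ∃ p : G.Walk u w, ∀ z ∈ p.support, z ∉ ({s, t} : Set V)) : False := by
  have hev := h.parity hs.path hA
  exact hs.path.false_of_three h.isClass h.two h.noCycle (by omega) hev
    (h1.trans (degIn_le_card_nbrIdx hs.left_sat)) (h2.trans (degIn_le_card_nbrIdx hs.right_sat))
    hconn

variable [Fintype V]

/-- If no long saturated path leads from `S` to `T`, then every vertex of `S` is adjacent to all
vertices of `T` in the other class. -/
theorem adj_of_not_saturated (h : G.Extremal A B ℓ)
    (hST : ∀ v M, G.Saturated S T v M → 2 * ℓ ≤ M + 1 → False) :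
    ∀ x ∈ S, ∀ y ∈ T, (x ∈ A ↔ y ∉ A) → G.Adj x y := by
  intro x hx y hy hxy
  by_contra hna
  obtain ⟨s, hs, hc⟩ : ∃ s, G.PathOn x y s ∧ 2 * ℓ ≤ s.card := by
    by_cases hxA : x ∈ A
    · exact h.maximal x hxA y ((h.compl y).2 (hxy.1 hxA)) hna
    · obtain ⟨s, hs, hc⟩ := h.maximal y (by tauto) x ((h.compl x).2 hxA) fun h => hna h.symm
      exact ⟨s, hs.symm, hc⟩
  obtain ⟨v, M, hv, hM⟩ := exists_saturated hx hy hs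
  exact hST v M hv (hc.trans hM)

/-- A non-adjacent pair would give a long saturated path from `S` to `T`, whose ends have smaller
degree sum than assumed. This is how degree conditions become completeness throughout. -/
theorem adj_of_degIn (h : G.Extremal A B ℓ)
    (hopp : ∀ x ∈ S, ∀ y ∈ T, (x ∈ A ↔ y ∉ A) → ℓ + 1 ≤ G.degIn S x + G.degIn T y)
    (hsame : ∀ x ∈ S, ∀ y ∈ T, (x ∈ A ↔ y ∈ A) → ℓ + 2 ≤ G.degIn S x + G.degIn T y) :
    ∀ x ∈ S, ∀ y ∈ T, (x ∈ A ↔ y ∉ A) → G.Adj x y := by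
  refine h.adj_of_not_saturated fun v M hv hM => ?_
  by_cases hA : v 0 ∈ A ↔ v M ∈ A
  · have := h.degIn_add_degIn_le_succ hv hM hA
    have := hsame _ hv.left _ hv.right hA
    omega
  · have hA' : v 0 ∈ A ↔ v M ∉ A := by tauto
    have := h.degIn_add_degIn_le hv hM hA'
    have := hopp _ hv.left _ hv.right hA'
    omega

end

/-- Every vertex of a `2`-connected graph with more than two vertices has two neighbours. -/
theorem _root_.SimpleGraph.IsTwoConnected.two_le_degIn [Fintype V] (h : G.IsTwoConnected)
    (hV : 3 ≤ Fintype.card V) (v : V) : 2 ≤ G.degIn Finset.univ v := by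
  classical
  by_contra hlt
  obtain ⟨u, hu⟩ : ∃ u, ∀ z, G.Adj v z → z = u := by
    have h1 : (Finset.univ.filter (G.Adj v)).card ≤ 1 := by
      have : (Finset.univ.filter (G.Adj v)).card < 2 := by
        unfold degIn at hlt
        convert not_le.1 hlt
      omega
    rw [Finset.card_le_one] at h1
    by_cases h2 : ∃ u, G.Adj v u
    · obtain ⟨u, hu⟩ := h2
      exact ⟨u, fun z hz => h1 z (by simpa using hz) u (by simpa using hu)⟩
    · push Not at h2
      exact ⟨v, fun z hz => absurd hz (h2 z)⟩
  obtain ⟨w, hw⟩ : ∃ w, w ∉ ({v, u} : Finset V) := by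
    by_contra hcon
    push Not at hcon
    have h1 : (Finset.univ : Finset V) ⊆ {v, u} := fun z _ => hcon z
    have := (Finset.card_le_card h1).trans Finset.card_le_two
    rw [Finset.card_univ] at this
    omega
  simp only [Finset.mem_insert, Finset.mem_singleton, not_or] at hw
  have huv : u ≠ v := by
    rintro rfl
    obtain ⟨p⟩ := h.1.preconnected u w
    cases p with
    | nil => exact hw.1 rfl
    | cons ha _ => exact G.loopless.irrefl _ (hu _ ha ▸ ha)
  obtain ⟨p, hp⟩ := h.exists_walk (u := v) (w := w) (z := u) huv.symm hw.2
  cases p with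
  | nil => exact hw.1 rfl
  | cons ha q =>
    have := hu _ ha
    subst this
    exact hp _ (by simp) rfl

end Extremal
end SimpleGraph

/-! ### Edge counts, dismantling by degree, and cores -/

namespace SimpleGraph

variable {V : Type*} [DecidableEq V] {G : SimpleGraph V} {A B : Finset V}

/-- Twice the number of edges inside `S`. -/
noncomputable def degSum (G : SimpleGraph V) (S : Finset V) : ℕ := ∑ v ∈ S, G.degIn S v

omit [DecidableEq V] in
theorem degSum_univ [Fintype V] [DecidableRel G.Adj] :
    G.degSum Finset.univ = 2 * G.edgeFinset.card := by
  classical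
  rw [← G.sum_degrees_eq_twice_card_edges, degSum]
  refine Finset.sum_congr rfl fun v _ => ?_
  rw [← card_neighborFinset_eq_degree, neighborFinset_eq_filter, degIn]
  congr

omit [DecidableEq V] in
theorem degIn_eq_sum (S : Finset V) (v : V) [DecidableRel G.Adj] :
    G.degIn S v = ∑ u ∈ S, if G.Adj v u then 1 else 0 := by
  rw [← Finset.card_filter, degIn]
  congr

theorem degIn_insert {S : Finset V} {u v : V} (hv : v ∉ S) [DecidableRel G.Adj] :
    G.degIn (insert v S) u = G.degIn S u + if G.Adj u v then 1 else 0 := by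
  rw [degIn_eq_sum, degIn_eq_sum, Finset.sum_insert hv, add_comm]

theorem degIn_erase (S : Finset V) (v : V) : G.degIn (S.erase v) v = G.degIn S v := by
  classical
  unfold degIn
  congr 1
  ext u
  simp only [Finset.mem_filter, Finset.mem_erase]
  refine ⟨fun h => ⟨h.1.2, h.2⟩, fun h => ⟨⟨h.2.ne', h.1⟩, h.2⟩⟩

theorem degSum_erase {S : Finset V} {v : V} (hv : v ∈ S) :
    G.degSum S = G.degSum (S.erase v) + 2 * G.degIn S v := by
  classical
  have h1 : v ∉ S.erase v := Finset.notMem_erase v S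
  have h2 : G.degSum (insert v (S.erase v)) =
      G.degSum (S.erase v) + 2 * G.degIn (insert v (S.erase v)) v := by
    have h3 : G.degIn (insert v (S.erase v)) v = G.degIn (S.erase v) v := by
      rw [Finset.insert_erase hv, degIn_erase]
    have h4 : ∑ u ∈ S.erase v, (if G.Adj u v then 1 else 0) = G.degIn (S.erase v) v := by
      rw [degIn_eq_sum]
      simp only [G.adj_comm]
    rw [degSum, Finset.sum_insert h1, Finset.sum_congr rfl fun u _ => degIn_insert h1,
      Finset.sum_add_distrib, h4, h3, degSum]
    omega
  rwa [Finset.insert_erase hv] at h2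

omit [DecidableEq V] in
theorem degIn_lt_of_not_adj {S T : Finset V} {v u : V} (h : ∀ z ∈ S, G.Adj v z → z ∈ T)
    (hu : u ∈ T) (ha : ¬ G.Adj v u) : G.degIn S v < T.card := by
  classical
  refine Finset.card_lt_card ⟨fun z hz => ?_, fun hsub => ?_⟩
  · rw [Finset.mem_filter] at hz
    exact h z hz.1 hz.2
  · exact ha (Finset.mem_filter.1 (hsub hu)).2

/-- The set of vertices splits into `A` and `B`, and all edges run between them. -/
structure IsSplit (G : SimpleGraph V) (A B : Finset V) : Prop where
  compl : ∀ x, x ∈ B ↔ x ∉ A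
  isClass : G.IsClass A

namespace IsSplit

omit [DecidableEq V] in
theorem symm (h : G.IsSplit A B) : G.IsSplit B A where
  compl x := by have := h.compl x; tauto
  isClass := h.isClass.compl h.compl

theorem mem_inter (h : G.IsSplit A B) {S : Finset V} {v z : V} (hv : v ∈ A) (hz : z ∈ S)
    (ha : G.Adj v z) : z ∈ S ∩ B :=
  Finset.mem_inter.2 ⟨hz, (h.compl z).2 ((h.isClass v z ha).1 hv)⟩

theorem degIn_inter (h : G.IsSplit A B) {S : Finset V} {v : V} (hv : v ∈ A) :
    G.degIn S v = G.degIn (S ∩ B) v :=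
  le_antisymm (degIn_le_of_forall fun _ hz ha => h.mem_inter hv hz ha)
    (degIn_mono Finset.inter_subset_left v)

theorem degIn_le (h : G.IsSplit A B) {S : Finset V} {v : V} (hv : v ∈ A) :
    G.degIn S v ≤ (S ∩ B).card := by
  rw [h.degIn_inter hv]
  exact degIn_le_card _ _

theorem sum_eq (h : G.IsSplit A B) (S : Finset V) (f : V → ℕ) :
    ∑ v ∈ S, f v = ∑ v ∈ S ∩ A, f v + ∑ v ∈ S ∩ B, f v := by
  rw [← Finset.sum_filter_add_sum_filter_not S (· ∈ A)]
  congr 2; ext x; simp [h.compl]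

theorem exists_mem_and_exists_notMem (h : G.IsSplit A B) {T : Finset V} (hne : T.Nonempty)
    (hT : ∀ v ∈ T, 0 < G.degIn T v) : (∃ v ∈ T, v ∈ A) ∧ ∃ v ∈ T, v ∉ A := by
  obtain ⟨v, hv⟩ := hne
  by_cases hA : v ∈ A
  · refine ⟨⟨v, hv, hA⟩, ?_⟩
    obtain ⟨w, hw⟩ := Finset.card_pos.1 ((hT v hv).trans_le (h.degIn_le hA))
    rw [Finset.mem_inter, h.compl] at hw
    exact ⟨w, hw.1, hw.2⟩
  · refine ⟨?_, ⟨v, hv, hA⟩⟩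
    obtain ⟨w, hw⟩ := Finset.card_pos.1 ((hT v hv).trans_le (h.symm.degIn_le ((h.compl v).2 hA)))
    rw [Finset.mem_inter] at hw
    exact ⟨w, hw.1, hw.2⟩

theorem degSum_le_mul (h : G.IsSplit A B) (S : Finset V) :
    G.degSum S ≤ 2 * ((S ∩ A).card * (S ∩ B).card) := by
  rw [degSum, h.sum_eq]
  have h1 : ∑ v ∈ S ∩ A, G.degIn S v ≤ (S ∩ A).card * (S ∩ B).card := by
    rw [← smul_eq_mul]
    exact Finset.sum_le_card_nsmul _ _ _ fun v hv => h.degIn_le (Finset.mem_inter.1 hv).2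
  have h2 : ∑ v ∈ S ∩ B, G.degIn S v ≤ (S ∩ B).card * (S ∩ A).card := by
    rw [← smul_eq_mul]
    exact Finset.sum_le_card_nsmul _ _ _ fun v hv => h.symm.degIn_le (Finset.mem_inter.1 hv).2
  rw [mul_comm] at h2
  omega

theorem adj_of_degSum_eq (h : G.IsSplit A B) {S : Finset V}
    (hS : 2 * ((S ∩ A).card * (S ∩ B).card) ≤ G.degSum S) {x y : V} (hx : x ∈ S ∩ A)
    (hy : y ∈ S ∩ B) : G.Adj x y := by
  by_contra ha
  have h1 : ∑ v ∈ S ∩ A, G.degIn S v < (S ∩ A).card * (S ∩ B).card := by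
    rw [← smul_eq_mul, ← Finset.sum_const]
    refine Finset.sum_lt_sum (fun v hv => h.degIn_le (Finset.mem_inter.1 hv).2) ⟨x, hx, ?_⟩
    exact degIn_lt_of_not_adj
      (fun z hz ha => h.mem_inter (Finset.mem_inter.1 hx).2 hz ha) hy ha
  have h2 : ∑ v ∈ S ∩ B, G.degIn S v ≤ (S ∩ B).card * (S ∩ A).card := by
    rw [← smul_eq_mul]
    exact Finset.sum_le_card_nsmul _ _ _ fun v hv => h.symm.degIn_le (Finset.mem_inter.1 hv).2
  rw [mul_comm] at h2
  rw [degSum, h.sum_eq] at hS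
  omega

end IsSplit

/-- The threshold function with value `p` on `A` and `q` outside `A`. -/
def thr (A : Finset V) (p q : ℕ) (v : V) : ℕ := if v ∈ A then p else q

theorem thr_of_mem {p q : ℕ} {v : V} (h : v ∈ A) : thr A p q v = p := if_pos h

theorem thr_of_not_mem {p q : ℕ} {v : V} (h : v ∉ A) : thr A p q v = q := if_neg h

theorem IsSplit.thr_eq (h : G.IsSplit A B) (p q : ℕ) : thr B q p = thr A p q := by
  funext v
  by_cases hv : v ∈ A
  · rw [thr_of_mem hv, thr_of_not_mem (fun hB => (h.compl v).1 hB hv)]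
  · rw [thr_of_not_mem hv, thr_of_mem ((h.compl v).2 hv)]

/-- Every nonempty subset of `S` has a vertex with at most `c v` neighbours in it. -/
def Degenerate (G : SimpleGraph V) (c : V → ℕ) (S : Finset V) : Prop :=
  ∀ T ⊆ S, T.Nonempty → ∃ v ∈ T, G.degIn T v ≤ c v

omit [DecidableEq V] in
theorem Degenerate.mono {c : V → ℕ} {S T : Finset V} (h : G.Degenerate c S) (hT : T ⊆ S) :
    G.Degenerate c T := fun U hU hne => h U (hU.trans hT) hne

theorem erase_inter_card_of_mem {S : Finset V} {v : V} (hv : v ∈ S) (hA : v ∈ A) :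
    (S.erase v ∩ A).card + 1 = (S ∩ A).card := by
  rw [Finset.erase_inter, Finset.card_erase_add_one (Finset.mem_inter.2 ⟨hv, hA⟩)]

theorem erase_inter_of_not_mem {S : Finset V} {v : V} (hA : v ∉ A) :
    S.erase v ∩ A = S ∩ A := by
  rw [Finset.erase_inter, Finset.erase_eq_of_notMem]
  exact fun h => hA (Finset.mem_inter.1 h).2

/-- Each removed vertex costs at most its threshold. The removal is stopped when `q` vertices of `A`
or `p` of `B` are left, where the claim is just the count for a complete bipartite graph. -/
theorem Degenerate.degSum_le {p q : ℕ} (hs : G.IsSplit A B) {S : Finset V}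
    (h : G.Degenerate (thr A p q) S) (hA : q ≤ (S ∩ A).card) (hB : p ≤ (S ∩ B).card) :
    G.degSum S + 2 * (p * q) ≤ 2 * (p * (S ∩ A).card + q * (S ∩ B).card) := by
  induction S using Finset.strongInduction with
  | H S ih =>
  rcases S.eq_empty_or_nonempty with rfl | hne
  · simp at hA hB
    subst hA hB
    simp [degSum]
  · obtain ⟨v, hv, hd⟩ := h S le_rfl hne
    have hmul := hs.degSum_le_mul S
    have he := degSum_erase (G := G) hv
    have ih' := ih _ (Finset.erase_ssubset hv) (h.mono (Finset.erase_subset v S))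
    by_cases hvA : v ∈ A
    · have hvB : v ∉ B := fun hB => (hs.compl v).1 hB hvA
      rw [thr_of_mem hvA] at hd
      have h1 := erase_inter_card_of_mem hv hvA
      rw [erase_inter_of_not_mem hvB] at ih'
      rcases hA.eq_or_lt with hq | hq
      · rw [← hq] at hmul ⊢
        nlinarith
      · have := ih' (by omega) hB
        rw [← h1]
        nlinarith
    · have hvB : v ∈ B := (hs.compl v).2 hvA
      rw [thr_of_not_mem hvA] at hd
      have h1 := erase_inter_card_of_mem hv hvB
      rw [erase_inter_of_not_mem hvA] at ih'
      rcases hB.eq_or_lt with hq | hq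
      · rw [← hq] at hmul ⊢
        nlinarith
      · have := ih' hA (by omega)
        rw [← h1]
        nlinarith

/-- Removing the vertices of small degree outside `K` one by one. -/
theorem exists_peeled (c : V → ℕ) {K S : Finset V} (hK : K ⊆ S) :
    ∃ D ⊆ S, K ⊆ D ∧ (∀ v ∈ D, v ∉ K → c v < G.degIn D v) ∧
      G.degSum S ≤ G.degSum D + 2 * ∑ v ∈ S \ D, c v := by
  induction S using Finset.strongInduction with
  | H S ih =>
  by_cases h : ∀ v ∈ S, v ∉ K → c v < G.degIn S v
  · exact ⟨S, le_rfl, hK, h, by simp⟩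
  · push Not at h
    obtain ⟨v, hv, hvK, hc⟩ := h
    obtain ⟨D, hDS, hKD, hD, hsum⟩ := ih _ (Finset.erase_ssubset hv)
      (fun z hz => Finset.mem_erase.2 ⟨fun he => hvK (he ▸ hz), hK hz⟩)
    refine ⟨D, hDS.trans (Finset.erase_subset v S), hKD, hD, ?_⟩
    have hvD : v ∉ D := fun hv => (Finset.mem_erase.1 (hDS hv)).1 rfl
    have h1 : S \ D = insert v (S.erase v \ D) := by
      ext z
      simp only [Finset.mem_sdiff, Finset.mem_insert, Finset.mem_erase]
      by_cases hz : z = v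
      · subst hz; simp [hv, hvD]
      · simp [hz]
    rw [h1, Finset.sum_insert (by simp), degSum_erase hv]
    omega

/-- A largest set whose vertices all exceed their thresholds inside it absorbs every outside vertex
that exceeds its own. -/
theorem exists_core [Fintype V] {c : V → ℕ} (h : ¬ G.Degenerate c Finset.univ) :
    ∃ H : Finset V, H.Nonempty ∧ (∀ v ∈ H, c v < G.degIn H v) ∧
      (∀ v, c v < G.degIn H v → v ∈ H) ∧
      ∀ T, H ⊆ T → (∀ v ∈ T, c v < G.degIn T v) → T = H := by
  classical
  unfold Degenerate at h
  push Not at h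
  obtain ⟨T, -, hT, hTc⟩ := h
  obtain ⟨H, hH, hmax⟩ := ((Finset.univ : Finset (Finset V)).filter fun H =>
    ∀ v ∈ H, c v < G.degIn H v).exists_max_image Finset.card ⟨T, by simpa using hTc⟩
  simp only [Finset.mem_filter, Finset.mem_univ, true_and] at hH hmax
  refine ⟨H, ?_, hH, fun v hv => ?_, fun T hHT hT =>
    (Finset.eq_of_subset_of_card_le hHT (hmax T hT)).symm⟩
  · rw [← Finset.card_pos]
    exact (Finset.card_pos.2 hT).trans_le (hmax T hTc)
  · by_contra hvH
    have := hmax (insert v H) fun u hu => by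
      have h1 := degIn_mono (G := G) (Finset.subset_insert v H) u
      rcases Finset.mem_insert.1 hu with rfl | hu
      · omega
      · exact (hH u hu).trans_le h1
    rw [Finset.card_insert_of_notMem hvH] at this
    omega

end SimpleGraph

/-! ### Large bicliques -/

namespace SimpleGraph

variable {V : Type*} [DecidableEq V] {G : SimpleGraph V} {A B : Finset V} {ℓ : ℕ}

/-- If `X` and `Y` have the same size and are completely joined, then any `x ∈ X` and `y ∈ Y` are
the ends of a path through all of `X ∪ Y`. -/
theorem exists_pathOn_union {X Y : Finset V} (hd : Disjoint X Y)
    (h : ∀ x ∈ X, ∀ y ∈ Y, G.Adj x y) (hc : X.card = Y.card) {x y : V} (hx : x ∈ X)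
    (hy : y ∈ Y) : G.PathOn x y (X ∪ Y) := by
  induction X using Finset.strongInduction generalizing Y x with
  | H X ih =>
  by_cases h1 : X.card = 1
  · obtain ⟨x', rfl⟩ := Finset.card_eq_one.1 h1
    obtain ⟨y', rfl⟩ := Finset.card_eq_one.1 (hc ▸ h1)
    obtain rfl := Finset.mem_singleton.1 hx
    obtain rfl := Finset.mem_singleton.1 hy
    exact (PathOn.refl x).join (h _ hx _ hy) (PathOn.refl y) hd
  · have h2 : 1 < X.card := by
      have := Finset.card_pos.2 ⟨x, hx⟩
      omega
    obtain ⟨x', hx', hne⟩ := Finset.exists_mem_ne h2 x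
    obtain ⟨y', hy', hne'⟩ := Finset.exists_mem_ne (hc ▸ h2) y
    have h3 := ih (X.erase x) (Finset.erase_ssubset hx) (Y := Y.erase y') (x := x')
      (hd.mono (Finset.erase_subset _ _) (Finset.erase_subset _ _))
      (fun a ha b hb => h a (Finset.mem_of_mem_erase ha) b (Finset.mem_of_mem_erase hb))
      (by rw [Finset.card_erase_of_mem hx, Finset.card_erase_of_mem hy', hc])
      (Finset.mem_erase.2 ⟨hne, hx'⟩) (Finset.mem_erase.2 ⟨hne'.symm, hy⟩)
    have h4 := (h3.cons (h x' hx' y' hy').symm (by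
      simp only [Finset.mem_union, Finset.mem_erase, not_or, not_and]
      exact ⟨fun _ h => Finset.disjoint_left.1 hd h hy', fun h => absurd rfl h⟩)).cons
      (h x hx y' hy') (by
      simp only [Finset.mem_insert, Finset.mem_union, Finset.mem_erase, not_or, not_and]
      exact ⟨(h x hx y' hy').ne, fun h => absurd rfl h,
        fun _ h => Finset.disjoint_left.1 hd hx h⟩)
    convert h4 using 1
    ext z
    simp only [Finset.mem_insert, Finset.mem_union, Finset.mem_erase]
    by_cases h5 : z = x <;> by_cases h6 : z = y' <;> simp_all

/-- If `X` has one vertex more than `Y` and they are completely joined, then any two vertices of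
`X` are the ends of a path through all of `X ∪ Y`. -/
theorem exists_pathOn_union_succ {X Y : Finset V} (hd : Disjoint X Y)
    (h : ∀ x ∈ X, ∀ y ∈ Y, G.Adj x y) (hc : X.card = Y.card + 1) {x x' : V} (hx : x ∈ X)
    (hx' : x' ∈ X) (hne : x ≠ x') : G.PathOn x x' (X ∪ Y) := by
  have h1 : 1 < X.card := Finset.one_lt_card.2 ⟨x, hx, x', hx', hne⟩
  obtain ⟨y, hy⟩ : Y.Nonempty := Finset.card_pos.1 (by omega)
  have h2 := exists_pathOn_union (X := X.erase x') (Y := Y) (x := x) (y := y)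
    (hd.mono_left (Finset.erase_subset _ _))
    (fun a ha b hb => h a (Finset.mem_of_mem_erase ha) b hb)
    (by rw [Finset.card_erase_of_mem hx']; omega) (Finset.mem_erase.2 ⟨hne, hx⟩) hy
  have h3 := h2.concat (h x' hx' y hy).symm (by
    simp only [Finset.mem_union, Finset.mem_erase, not_or, not_and]
    exact ⟨fun h => absurd rfl h, fun h => Finset.disjoint_left.1 hd hx' h⟩)
  convert h3 using 1
  ext z
  simp only [Finset.mem_insert, Finset.mem_union, Finset.mem_erase]
  by_cases h5 : z = x' <;> simp_all

/-- A maximal complete bipartite subgraph, on the vertex set `K`. -/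
structure IsBiclique (G : SimpleGraph V) (A B K : Finset V) : Prop where
  adj : ∀ x ∈ K ∩ A, ∀ y ∈ K ∩ B, G.Adj x y
  mem_left : ∀ v ∈ A, (∀ y ∈ K ∩ B, G.Adj v y) → v ∈ K
  mem_right : ∀ v ∈ B, (∀ x ∈ K ∩ A, G.Adj v x) → v ∈ K

theorem IsBiclique.symm {K : Finset V} (h : G.IsBiclique A B K) : G.IsBiclique B A K where
  adj x hx y hy := (h.adj y hy x hx).symm
  mem_left := h.mem_right
  mem_right := h.mem_left

theorem IsBiclique.le_degIn {K : Finset V} (h : G.IsBiclique A B K) {v : V} (hv : v ∈ K)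
    (hA : v ∈ A) : (K ∩ B).card ≤ G.degIn K v :=
  card_le_degIn Finset.inter_subset_left fun z hz => h.adj v (Finset.mem_inter.2 ⟨hv, hA⟩) z hz

/-- The set `A` contains `k` vertices which are adjacent to all of `B`. -/
def HasFull (G : SimpleGraph V) (A B : Finset V) (k : ℕ) : Prop :=
  ∃ X ⊆ A, X.card = k ∧ ∀ x ∈ X, ∀ y ∈ B, G.Adj x y

namespace Extremal

theorem isSplit (h : G.Extremal A B ℓ) : G.IsSplit A B := ⟨h.compl, h.isClass⟩

variable [Fintype V] {K : Finset V}

theorem two_le_degIn (h : G.Extremal A B ℓ) (v : V) : 2 ≤ G.degIn Finset.univ v := by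
  refine h.two.two_le_degIn ?_ v
  have h1 := h.four_le
  have h2 := h.le_left
  have := Finset.card_le_univ A
  omega

omit [Fintype V] in
theorem disjoint_inter (h : G.Extremal A B ℓ) (K : Finset V) : Disjoint (K ∩ A) (K ∩ B) := by
  rw [Finset.disjoint_left]
  intro x hx hx'
  exact (h.compl x).1 (Finset.mem_inter.1 hx').2 (Finset.mem_inter.1 hx).2

-- A biclique with `ℓ` vertices on each side has a cycle of length `2ℓ`.
omit [Fintype V] in
theorem isBiclique_card_lt (h : G.Extremal A B ℓ) (hK : G.IsBiclique A B K)
    (hle : (K ∩ A).card ≤ (K ∩ B).card) : (K ∩ A).card < ℓ := by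
  by_contra hlt
  push Not at hlt
  have h4 := h.four_le
  obtain ⟨X, hX, hXc⟩ := Finset.exists_subset_card_eq hlt
  obtain ⟨Y, hY, hYc⟩ := Finset.exists_subset_card_eq (hlt.trans hle)
  obtain ⟨x, hx⟩ : X.Nonempty := Finset.card_pos.1 (by omega)
  obtain ⟨y, hy⟩ : Y.Nonempty := Finset.card_pos.1 (by omega)
  have hd := (h.disjoint_inter K).mono hX hY
  have h1 := exists_pathOn_union hd (fun x hx y hy => hK.adj x (hX hx) y (hY hy))
    (hXc.trans hYc.symm) hx hy
  have := h1.card_lt (by omega) h.noCycle (hK.adj x (hX hx) y (hY hy))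
  rw [Finset.card_union_of_disjoint hd] at this
  omega

/-- With `ℓ - 1` vertices on the smaller side, every vertex of `K` has inner degree at least `ℓ -
1`, and every vertex of `G` has degree at least two. That is too much for a long path from `K` to
anywhere, so `K` is joined to the whole opposite class and by maximality swallows `A`, which has at
least `ℓ` vertices. -/
theorem isBiclique_card_add_two_le (h : G.Extremal A B ℓ) (hK : G.IsBiclique A B K)
    (hle : (K ∩ A).card ≤ (K ∩ B).card) : (K ∩ A).card + 2 ≤ ℓ := by
  have h1 := h.isBiclique_card_lt hK hle
  by_contra hlt
  have hp : (K ∩ A).card + 1 = ℓ := by omega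
  have hdeg : ∀ v ∈ K, ℓ ≤ G.degIn K v + 1 := by
    intro v hv
    by_cases hA : v ∈ A
    · have := hK.le_degIn hv hA
      omega
    · have := hK.symm.le_degIn hv ((h.compl v).2 hA)
      omega
  have hadj := h.adj_of_not_saturated (S := K) (T := Finset.univ) fun v M hv hM => by
    have h2 := h.two_le_degIn (v M)
    have h3 := hdeg _ hv.left
    by_cases hA : v 0 ∈ A ↔ v M ∈ A
    · have := h.degIn_add_two_le hv hM hA h2
      omega
    · have := h.degIn_add_degIn_le hv hM (by tauto)
      omega
  have hAK : A ⊆ K := fun v hv => hK.mem_left v hv fun y hy =>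
    (hadj y (Finset.mem_inter.1 hy).1 v (Finset.mem_univ v) (by
      have := (h.compl y).1 (Finset.mem_inter.1 hy).2
      tauto)).symm
  rw [Finset.inter_eq_right.2 hAK] at h1
  have := h.le_left
  omega

/-- If the vertices of `D ⊇ K` outside `K` have large degree in `D`, then `D = K`. -/
theorem subset_of_degIn (h : G.Extremal A B ℓ) (hK : G.IsBiclique A B K) {D : Finset V}
    (hopp : ∀ x ∈ K, ∀ y ∈ D, (x ∈ A ↔ y ∉ A) → ℓ + 1 ≤ G.degIn K x + G.degIn D y)
    (hsame : ∀ x ∈ K, ∀ y ∈ D, (x ∈ A ↔ y ∈ A) → ℓ + 2 ≤ G.degIn K x + G.degIn D y) :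
    D ⊆ K := by
  have hadj := h.adj_of_degIn hopp hsame
  intro v hv
  by_cases hA : v ∈ A
  · refine hK.mem_left v hA fun y hy => (hadj y (Finset.mem_inter.1 hy).1 v hv ?_).symm
    have := (h.compl y).1 (Finset.mem_inter.1 hy).2
    tauto
  · refine hK.mem_right v ((h.compl v).2 hA) fun y hy =>
      (hadj y (Finset.mem_inter.1 hy).1 v hv ?_).symm
    have := (Finset.mem_inter.1 hy).2
    tauto

theorem sum_thr_compl (h : G.Extremal A B ℓ) (K : Finset V) (p q : ℕ) :
    ∑ v ∈ Finset.univ \ K, thr A p q v =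
      p * (A.card - (K ∩ A).card) + q * (B.card - (K ∩ B).card) := by
  rw [h.isSplit.sum_eq, Finset.sum_congr rfl fun v hv => thr_of_mem (Finset.mem_inter.1 hv).2,
    Finset.sum_congr rfl fun v hv =>
      thr_of_not_mem ((h.compl v).1 (Finset.mem_inter.1 hv).2)]
  have h1 : ∀ C : Finset V, ((Finset.univ \ K) ∩ C).card = C.card - (K ∩ C).card := by
    intro C
    rw [← Finset.card_sdiff]
    congr 1
    ext x
    simp [and_comm]
  simp only [Finset.sum_const, h1, smul_eq_mul]
  ring

/-- The thresholds `m` on `A` and `m + 1` on `B` are the smallest for which the degree sums still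
force the peeled set to be `K`; the lower value on `A` is afforded by `p < q`. -/
theorem degSum_le_of_card_lt (h : G.Extremal A B ℓ) (hK : G.IsBiclique A B K) {p q m : ℕ}
    (hp : (K ∩ A).card = p) (hq : (K ∩ B).card = q) (hpq : p < q) (hm : p + m = ℓ)
    (hmp : m + 2 ≤ p) : G.degSum Finset.univ ≤
      2 * (p * q + m * (A.card - p) + (m + 1) * (B.card - q)) := by
  obtain ⟨D, -, hKD, hD, hsum⟩ := exists_peeled (G := G) (thr A m (m + 1)) (Finset.subset_univ K)
  have hKA : ∀ v ∈ K, v ∈ A → q ≤ G.degIn K v := fun v hv hA => hq ▸ hK.le_degIn hv hA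
  have hKB : ∀ v ∈ K, v ∉ A → p ≤ G.degIn K v := fun v hv hA =>
    hp ▸ hK.symm.le_degIn hv ((h.compl v).2 hA)
  have hDA : ∀ v ∈ D, v ∈ A → m < G.degIn D v := fun v hv hA => by
    by_cases hvK : v ∈ K
    · have := hKA v hvK hA
      have := degIn_mono (G := G) hKD v
      omega
    · have := hD v hv hvK
      rwa [thr_of_mem hA] at this
  have hDB : ∀ v ∈ D, v ∉ A → m + 1 < G.degIn D v := fun v hv hA => by
    by_cases hvK : v ∈ K
    · have := hKB v hvK hA
      have := degIn_mono (G := G) hKD v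
      omega
    · have := hD v hv hvK
      rwa [thr_of_not_mem hA] at this
  obtain rfl : D = K := by
    refine Finset.Subset.antisymm (h.subset_of_degIn hK ?_ ?_) hKD
    · intro x hx y hy hxy
      by_cases hA : x ∈ A
      · have := hKA x hx hA
        have := hDB y hy (by tauto)
        omega
      · have := hKB x hx hA
        have := hDA y hy (by tauto)
        omega
    · intro x hx y hy hxy
      by_cases hA : x ∈ A
      · have := hKA x hx hA
        have := hDA y hy (by tauto)
        omega
      · have := hKB x hx hA
        have := hDB y hy (by tauto)
        omega
  have h1 := h.isSplit.degSum_le_mul D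
  rw [h.sum_thr_compl, hp, hq] at hsum
  rw [hp, hq] at h1
  linarith

/-- With more than `m` neighbours in `K`, `w` would be joined to the whole opposite side. The
critical case is a path ending at `w` in the class of its start: the biclique makes all neighbours
of `w` in `K` neighbours of the start too, so `degIn_add_degIn_le_of_subset` gains the missing one.
-/
theorem degIn_le_of_card_eq (h : G.Extremal A B ℓ) (hK : G.IsBiclique A B K) {p m : ℕ}
    (hp : (K ∩ A).card = p) (hq : (K ∩ B).card = p) (hm : p + m = ℓ)
    (hmp : m + 2 ≤ p) {w : V} (hw : w ∉ K) : G.degIn K w ≤ m := by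
  by_contra hlt
  push Not at hlt
  have hdeg : ∀ v ∈ K, p ≤ G.degIn K v := fun v hv => by
    by_cases hA : v ∈ A
    · exact hq ▸ hK.le_degIn hv hA
    · exact hp ▸ hK.symm.le_degIn hv ((h.compl v).2 hA)
  have hsub : K ⊆ insert w K := Finset.subset_insert w K
  have hadj := h.adj_of_not_saturated (S := K) (T := insert w K) fun v M hv hM => by
    have h1 := hdeg _ hv.left
    have h2 := degIn_mono (G := G) hsub (v M)
    by_cases hA : v 0 ∈ A ↔ v M ∈ A
    · rcases Finset.mem_insert.1 hv.right with h3 | h3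
      · rw [← h3] at hlt
        have := h.degIn_add_degIn_le_of_subset hv hM hA fun z hz ha => by
          have hz' : z ∈ K := by
            rcases Finset.mem_insert.1 hz with rfl | hz
            · exact absurd (h3 ▸ ha) (G.loopless.irrefl _)
            · exact hz
          have h4 := h.isClass _ _ ha
          by_cases hvA : v M ∈ A
          · exact hK.adj _ (Finset.mem_inter.2 ⟨hv.left, hA.2 hvA⟩) z
              (Finset.mem_inter.2 ⟨hz', (h.compl z).2 (h4.1 hvA)⟩)
          · exact (hK.adj z (Finset.mem_inter.2 ⟨hz', by tauto⟩) _
              (Finset.mem_inter.2 ⟨hv.left, (h.compl _).2 (by tauto)⟩)).symm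
        omega
      · have h4 := hdeg _ h3
        have := h.degIn_add_degIn_le_succ hv hM hA
        omega
    · have := h.degIn_add_degIn_le hv hM (by tauto)
      rcases Finset.mem_insert.1 hv.right with h3 | h3
      · rw [← h3] at hlt
        omega
      · have h4 := hdeg _ h3
        omega
  by_cases hA : w ∈ A
  · refine hw (hK.mem_left w hA fun y hy => (hadj y (Finset.mem_inter.1 hy).1 w
      (Finset.mem_insert_self _ _) ?_).symm)
    have := (h.compl y).1 (Finset.mem_inter.1 hy).2
    tauto
  · refine hw (hK.mem_right w ((h.compl w).2 hA) fun y hy =>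
      (hadj y (Finset.mem_inter.1 hy).1 w (Finset.mem_insert_self _ _) ?_).symm)
    have := (Finset.mem_inter.1 hy).2
    tauto

/-- Peeling with threshold `m + 1` on both sides reduces everything to `K`, and the last vertex
removed has at most `m` neighbours in `K`, whence the strict inequality. -/
theorem degSum_lt_of_card_eq (h : G.Extremal A B ℓ) (hK : G.IsBiclique A B K) {p m : ℕ}
    (hp : (K ∩ A).card = p) (hq : (K ∩ B).card = p) (hm : p + m = ℓ) (hm2 : 2 ≤ m)
    (hmp : m + 2 ≤ p) : G.degSum Finset.univ <
      2 * (p * p + (m + 1) * (A.card - p) + (m + 1) * (B.card - p)) := by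
  have hdeg : ∀ v ∈ K, p ≤ G.degIn K v := fun v hv => by
    by_cases hA : v ∈ A
    · exact hq ▸ hK.le_degIn hv hA
    · exact hp ▸ hK.symm.le_degIn hv ((h.compl v).2 hA)
  have key : ∀ D : Finset V, K ⊂ D →
      G.degSum D < G.degSum K + 2 * ∑ v ∈ D \ K, thr A (m + 1) (m + 1) v := by
    intro D
    induction D using Finset.strongInduction with
    | H D ih =>
    intro hKD
    obtain ⟨w, hw, hwK, hwm⟩ : ∃ w ∈ D, w ∉ K ∧ G.degIn D w ≤ m + 1 := by
      by_contra hcon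
      push Not at hcon
      have hD : ∀ v ∈ D, m + 2 ≤ G.degIn D v := fun v hv => by
        by_cases hvK : v ∈ K
        · exact (hmp.trans (hdeg v hvK)).trans (degIn_mono hKD.1 v)
        · exact hcon v hv hvK
      refine hKD.2 (h.subset_of_degIn hK ?_ ?_) <;>
      · intro x hx y hy _
        have := hdeg x hx
        have := hD y hy
        omega
    have h1 := degSum_erase (G := G) hw
    have h2 : D \ K = insert w (D.erase w \ K) := by
      ext z
      simp only [Finset.mem_sdiff, Finset.mem_insert, Finset.mem_erase]
      by_cases hz : z = w
      · subst hz; simp [hw, hwK]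
      · simp [hz]
    rw [h2, Finset.sum_insert (by simp)]
    have h3 : thr A (m + 1) (m + 1) w = m + 1 := by simp [thr]
    have hKe : K ⊆ D.erase w := fun z hz =>
      Finset.mem_erase.2 ⟨fun he => hwK (he ▸ hz), hKD.1 hz⟩
    by_cases h4 : K = D.erase w
    · have h5 := h.degIn_le_of_card_eq hK hp hq hm hmp hwK
      rw [h4, degIn_erase] at h5
      rw [h4] at *
      omega
    · have := ih _ (Finset.erase_ssubset hw) (Finset.ssubset_iff_subset_ne.2 ⟨hKe, h4⟩)
      omega
  have h1 := key Finset.univ (Finset.ssubset_iff_subset_ne.2 ⟨Finset.subset_univ K, by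
    rintro rfl
    rw [Finset.univ_inter] at hp
    have := h.le_left
    omega⟩)
  have h2 := h.isSplit.degSum_le_mul K
  rw [h.sum_thr_compl, hp, hq] at h1
  rw [hp, hq] at h2
  linarith

/-- The edge bound in the presence of a large maximal biclique, smaller on the side of `A`. -/
theorem degSum_le_of_isBiclique (h : G.Extremal A B ℓ) (hK : G.IsBiclique A B K)
    (hle : (K ∩ A).card ≤ (K ∩ B).card) (hlarge : ℓ + 2 ≤ 2 * (K ∩ A).card) {k : ℕ}
    (hk : ℓ = k + 2) :
    (A.card ≤ B.card → G.degSum Finset.univ + 4 * k ≤ 2 * (2 * A.card + k * B.card) ∧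
      (G.degSum Finset.univ + 4 * k = 2 * (2 * A.card + k * B.card) → G.HasFull A B k)) ∧
    (B.card < A.card → G.degSum Finset.univ + 4 * k < 2 * (2 * B.card + k * A.card)) := by
  have h2 := h.isBiclique_card_add_two_le hK hle
  have hi := h.le_left
  have hj := h.le_right
  obtain ⟨p, hp⟩ : ∃ p, (K ∩ A).card = p := ⟨_, rfl⟩
  obtain ⟨q, hq⟩ : ∃ q, (K ∩ B).card = q := ⟨_, rfl⟩
  have hqB : q ≤ B.card := hq ▸ Finset.card_le_card Finset.inter_subset_right
  rw [hp] at h2 hlarge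
  rw [hp, hq] at hle
  -- Here `m` measures how far `p` is below its maximum `ℓ - 2`, and `n` is the slack in `ℓ + 2 ≤
  -- 2p`.
  obtain ⟨m, hm⟩ : ∃ m, ℓ = p + (m + 2) := ⟨ℓ - p - 2, by omega⟩
  obtain ⟨n, hn⟩ : ∃ n, p = m + 4 + n := ⟨p - m - 4, by omega⟩
  obtain ⟨i, hi'⟩ : ∃ i, A.card = p + i := ⟨A.card - p, by omega⟩
  obtain ⟨j, hj'⟩ : ∃ j, B.card = q + j := ⟨B.card - q, by omega⟩
  obtain rfl : k = 2 * m + 4 + n := by omega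
  rcases hle.eq_or_lt with he | hlt
  · subst he
    have := h.degSum_lt_of_card_eq hK hp hq hm.symm (by omega) (by omega)
    rw [hi', hj', Nat.add_sub_cancel_left, Nat.add_sub_cancel_left] at this
    rw [hi', hj']
    subst hn
    constructor
    · intro hij
      have hij' : i ≤ j := by omega
      have hj2 : m + 2 ≤ j := by omega
      have : G.degSum Finset.univ + 4 * (2 * m + 4 + n) <
          2 * (2 * (m + 4 + n + i) + (2 * m + 4 + n) * (m + 4 + n + j)) := by
        nlinarith [Nat.mul_le_mul_left n hj2, Nat.mul_le_mul_left (m + 1) hij']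
      exact ⟨this.le, fun he => by omega⟩
    · intro hij
      have hij' : j ≤ i := by omega
      have hj2 : m + 2 ≤ i := by omega
      nlinarith [Nat.mul_le_mul_left n hj2, Nat.mul_le_mul_left (m + 1) hij']
  · have := h.degSum_le_of_card_lt hK hp hq hlt hm.symm (by omega)
    rw [hi', hj', Nat.add_sub_cancel_left, Nat.add_sub_cancel_left] at this
    rw [hi', hj']
    constructor
    · intro hij
      obtain ⟨d, hd⟩ : ∃ d, q + j = p + i + d := ⟨q + j - p - i, by omega⟩
      -- The surplus terms are kept: equality makes `m(m + n + 2)` and `(n + 1)j` vanish, that is,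
      -- `p = ℓ - 2` and `K` contains `B`.
      have hF : G.degSum Finset.univ + 4 * (2 * m + 4 + n) + 2 * (m * d) + 2 * ((n + 1) * j) +
          2 * (m * (m + n + 2)) ≤ 2 * (2 * (p + i) + (2 * m + 4 + n) * (q + j)) := by
        obtain rfl : i = q + j - p - d := by omega
        zify [show p ≤ q + j by omega, show d ≤ q + j - p by omega] at this hn ⊢
        rw [hn] at this ⊢
        linarith
      refine ⟨by omega, fun he => ?_⟩
      have hm0 : m = 0 := by
        by_contra hm0
        have : 0 < m * (m + n + 2) := Nat.mul_pos (by omega) (by omega)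
        omega
      have hj0 : j = 0 := by
        by_contra hj0
        have : 0 < (n + 1) * j := Nat.mul_pos (by omega) (by omega)
        omega
      refine ⟨K ∩ A, Finset.inter_subset_right, by omega, fun x hx y hy => hK.adj x hx y ?_⟩
      rwa [Finset.eq_of_subset_of_card_le (Finset.inter_subset_right : K ∩ B ⊆ B) (by omega)]
    · intro hij
      obtain ⟨d, hd⟩ : ∃ d, p + i = q + j + d + 1 := ⟨p + i - (q + j) - 1, by omega⟩
      obtain rfl : i = q + j + d + 1 - p := by omega
      zify [show p ≤ q + j + d + 1 by omega] at this hn ⊢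
      rw [hn] at this ⊢
      have h1 : (0 : ℤ) ≤ m * d := by positivity
      have h2 : (0 : ℤ) ≤ n * d := by positivity
      have h3 : (0 : ℤ) ≤ n * j := by positivity
      have h4 : (0 : ℤ) ≤ m * n := by positivity
      have h5 : (0 : ℤ) ≤ m * m := by positivity
      nlinarith

/-- If neither pair of thresholds lets `G` be dismantled, the two cores form one biclique. -/
theorem exists_isBiclique (h : G.Extremal A B ℓ) {s t : ℕ} (hst : s + t = ℓ) (hs : s ≤ t)
    (ht : t ≤ s + 1) (h1 : ¬ G.Degenerate (thr A s t) Finset.univ)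
    (h2 : ¬ G.Degenerate (thr A t s) Finset.univ) :
    ∃ K, G.IsBiclique A B K ∧ t < (K ∩ A).card ∧ t < (K ∩ B).card := by
  obtain ⟨H, hHne, hH, hHm, -⟩ := exists_core h1
  obtain ⟨K, hKne, hK, hKm, -⟩ := exists_core h2
  have hHA : ∀ v ∈ H, v ∈ A → s < G.degIn H v := fun v hv hA => by
    have := hH v hv; rwa [thr_of_mem hA] at this
  have hHB : ∀ v ∈ H, v ∉ A → t < G.degIn H v := fun v hv hA => by
    have := hH v hv; rwa [thr_of_not_mem hA] at this
  have hKA : ∀ v ∈ K, v ∈ A → t < G.degIn K v := fun v hv hA => by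
    have := hK v hv; rwa [thr_of_mem hA] at this
  have hKB : ∀ v ∈ K, v ∉ A → s < G.degIn K v := fun v hv hA => by
    have := hK v hv; rwa [thr_of_not_mem hA] at this
  -- For opposite classes the least sum is `2(s + 1)`, which is at least `ℓ + 1` because `t ≤ s +
  -- 1`. For equal classes it is always `(s + 1) + (t + 1) = ℓ + 2`.
  have hadj := h.adj_of_degIn (S := H) (T := K)
    (fun x hx y hy hxy => by
      by_cases hA : x ∈ A
      · have := hHA x hx hA
        have := hKB y hy (by tauto)
        omega
      · have := hHB x hx hA
        have := hKA y hy (by tauto)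
        omega)
    (fun x hx y hy hxy => by
      by_cases hA : x ∈ A
      · have := hHA x hx hA
        have := hKA y hy (by tauto)
        omega
      · have := hHB x hx hA
        have := hKB y hy (by tauto)
        omega)
  have hle : ∀ {T : Finset V} {v : V}, v ∈ A → G.degIn T v ≤ (T ∩ B).card :=
    fun hv => h.isSplit.degIn_le hv
  have hle' : ∀ {T : Finset V} {v : V}, v ∉ A → G.degIn T v ≤ (T ∩ A).card :=
    fun hv => h.symm.isSplit.degIn_le ((h.compl _).2 hv)
  obtain ⟨⟨a₁, ha₁, ha₁A⟩, b₁, hb₁, hb₁A⟩ :=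
    h.isSplit.exists_mem_and_exists_notMem hHne fun v hv => by have := hH v hv; omega
  obtain ⟨⟨a₂, ha₂, ha₂A⟩, b₂, hb₂, hb₂A⟩ :=
    h.isSplit.exists_mem_and_exists_notMem hKne fun v hv => by have := hK v hv; omega
  have c1 := (hHA _ ha₁ ha₁A).trans_le (hle ha₁A)
  have c2 := (hHB _ hb₁ hb₁A).trans_le (hle' hb₁A)
  have c3 := (hKA _ ha₂ ha₂A).trans_le (hle ha₂A)
  have c4 := (hKB _ hb₂ hb₂A).trans_le (hle' hb₂A)
  have hfull : ∀ {T : Finset V} {v : V}, v ∈ A → (∀ y ∈ T ∩ B, G.Adj v y) →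
      (T ∩ B).card ≤ G.degIn T v := fun _ h => card_le_degIn Finset.inter_subset_left h
  have hfull' : ∀ {T : Finset V} {v : V}, v ∉ A → (∀ y ∈ T ∩ A, G.Adj v y) →
      (T ∩ A).card ≤ G.degIn T v := fun _ h => card_le_degIn Finset.inter_subset_left h
  -- A vertex of one core is joined to the whole opposite side of the other, which exceeds its
  -- threshold there, so the other core absorbs it.
  have hHK : H = K := by
    ext v
    by_cases hA : v ∈ A
    · constructor
      · intro hv
        refine hKm v ?_
        rw [thr_of_mem hA]
        refine c3.trans_le (hfull hA fun y hy => ?_)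
        rw [Finset.mem_inter, h.compl] at hy
        exact hadj v hv y hy.1 (by tauto)
      · intro hv
        refine hHm v ?_
        rw [thr_of_mem hA]
        refine c1.trans_le (hfull hA fun y hy => ?_)
        rw [Finset.mem_inter, h.compl] at hy
        exact (hadj y hy.1 v hv (by tauto)).symm
    · constructor
      · intro hv
        refine hKm v ?_
        rw [thr_of_not_mem hA]
        refine c4.trans_le (hfull' hA fun y hy => ?_)
        rw [Finset.mem_inter] at hy
        exact hadj v hv y hy.1 (by tauto)
      · intro hv
        refine hHm v ?_
        rw [thr_of_not_mem hA]
        refine c2.trans_le (hfull' hA fun y hy => ?_)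
        rw [Finset.mem_inter] at hy
        exact (hadj y hy.1 v hv (by tauto)).symm
  subst hHK
  refine ⟨H, ⟨fun x hx y hy => ?_, fun v hv hvy => hHm v ?_, fun v hv hvx => hKm v ?_⟩, c2, c3⟩
  · rw [Finset.mem_inter] at hx hy
    have := (h.compl y).1 hy.2
    exact hadj x hx.1 y hy.1 (by tauto)
  · rw [thr_of_mem hv]
    exact c1.trans_le (hfull hv hvy)
  · have hv' := (h.compl v).1 hv
    rw [thr_of_not_mem hv']
    exact c4.trans_le (hfull' hv' hvx)

end Extremal
end SimpleGraph

/-! ### Equality for `ℓ = 4` -/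

namespace SimpleGraph

variable {V : Type*} [DecidableEq V] {G : SimpleGraph V} {A B : Finset V}

/-- The adjacencies alternate between the classes, so distinctness needs to be assumed only among
the `aᵢ` and among the `bᵢ`. -/
theorem IsClass.false_of_eight (hA : G.IsClass A) (hC : G.NoCycleGE 8)
    {a₁ a₂ a₃ a₄ b₁ b₂ b₃ b₄ : V} (ha : a₁ ∈ A) (hna : [a₁, a₂, a₃, a₄].Nodup)
    (hnb : [b₁, b₂, b₃, b₄].Nodup) (h₁ : G.Adj a₁ b₁) (h₂ : G.Adj a₂ b₁) (h₃ : G.Adj a₂ b₂)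
    (h₄ : G.Adj a₃ b₂) (h₅ : G.Adj a₃ b₃) (h₆ : G.Adj a₄ b₃) (h₇ : G.Adj a₄ b₄)
    (h₈ : G.Adj a₁ b₄) : False := by
  have hb₁ := (hA _ _ h₁).1 ha
  have ha₂ := (hA _ _ h₂).2 hb₁
  have hb₂ := (hA _ _ h₃).1 ha₂
  have ha₃ := (hA _ _ h₄).2 hb₂
  have hb₃ := (hA _ _ h₅).1 ha₃
  have ha₄ := (hA _ _ h₆).2 hb₃
  have hb₄ := (hA _ _ h₇).1 ha₄
  have hne : ∀ {x y : V}, x ∈ A → y ∉ A → x ≠ y ∧ y ≠ x := by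
    rintro x y hx hy
    exact ⟨fun h => hy (h ▸ hx), fun h => hy (h ▸ hx)⟩
  simp only [List.nodup_cons, List.mem_cons, List.not_mem_nil, or_false, not_or, List.nodup_nil,
    and_true, not_false_eq_true] at hna hnb
  obtain ⟨⟨n12, n13, n14⟩, ⟨n23, n24⟩, n34⟩ := hna
  obtain ⟨⟨m12, m13, m14⟩, ⟨m23, m24⟩, m34⟩ := hnb
  have e11 := hne ha hb₁
  have e12 := hne ha hb₂
  have e13 := hne ha hb₃
  have e14 := hne ha hb₄
  have e21 := hne ha₂ hb₁
  have e22 := hne ha₂ hb₂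
  have e23 := hne ha₂ hb₃
  have e24 := hne ha₂ hb₄
  have e31 := hne ha₃ hb₁
  have e32 := hne ha₃ hb₂
  have e33 := hne ha₃ hb₃
  have e34 := hne ha₃ hb₄
  have e41 := hne ha₄ hb₁
  have e42 := hne ha₄ hb₂
  have e43 := hne ha₄ hb₃
  have e44 := hne ha₄ hb₄
  have hp : G.PathOn a₁ b₄ {a₁, b₁, a₂, b₂, a₃, b₃, a₄, b₄} := by
    refine .cons h₁ (.cons h₂.symm (.cons h₃ (.cons h₄.symm (.cons h₅ (.cons h₆.symm
      (.cons h₇ (.refl b₄) ?_) ?_) ?_) ?_) ?_) ?_) ?_ <;>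
    · simp only [Finset.mem_insert, Finset.mem_singleton, not_or]
      tauto
  have hcard : ({a₁, b₁, a₂, b₂, a₃, b₃, a₄, b₄} : Finset V).card = 8 := by
    iterate 7 rw [Finset.card_insert_of_notMem (by
      simp only [Finset.mem_insert, Finset.mem_singleton, not_or]
      tauto)]
    rw [Finset.card_singleton]
  have := hp.card_lt (by omega) hC h₈
  omega

omit [DecidableEq V] in
theorem nodup_four {a b c d : V} (h₁ : a ≠ b) (h₂ : a ≠ c) (h₃ : a ≠ d) (h₄ : b ≠ c)
    (h₅ : b ≠ d) (h₆ : c ≠ d) : [a, b, c, d].Nodup := by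
  simp [*]

/-- Even without the edges `y y'` and `z z'`, any two of `y', z', c, d` are ends of a path through
all three of `x, y, z` on seven vertices; `v` closes it to an eight-cycle. The six pairs are treated
one by one. -/
theorem IsClass.false_of_two_missing (hA : G.IsClass A) (hC : G.NoCycleGE 8)
    {v x y z y' z' c d p q : V} (hv : v ∈ A) (vx : v ≠ x) (vy : v ≠ y) (vz : v ≠ z) (hxy : x ≠ y)
    (hxz : x ≠ z) (hyz : y ≠ z) (hyz' : y' ≠ z') (yc' : y' ≠ c) (yd' : y' ≠ d) (zc' : z' ≠ c)
    (zd' : z' ≠ d) (hcd : c ≠ d) (xy : G.Adj x y') (xz : G.Adj x z') (xc : G.Adj x c)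
    (xd : G.Adj x d) (yz : G.Adj y z') (yc : G.Adj y c) (yd : G.Adj y d) (zy : G.Adj z y')
    (zc : G.Adj z c) (zd : G.Adj z d) (hpq : p ≠ q) (hvp : G.Adj v p) (hvq : G.Adj v q)
    (hp : p = y' ∨ p = z' ∨ p = c ∨ p = d) (hq : q = y' ∨ q = z' ∨ q = c ∨ q = d) : False := by
  have n1 : [v, z, x, y].Nodup := nodup_four vz vx vy hxz.symm hyz.symm hxy
  have n2 : [v, z, y, x].Nodup := nodup_four vz vy vx hyz.symm hxz.symm hxy.symm
  have n3 : [v, y, z, x].Nodup := nodup_four vy vz vx hyz hxy.symm hxz.symm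
  have c1 : G.Adj v y' → G.Adj v z' → False := fun h1 h2 =>
    hA.false_of_eight hC hv n1 (nodup_four yc' yd' hyz' hcd zc'.symm zd'.symm)
      h1 zy zc xc xd yd yz h2
  have c2 : G.Adj v c → G.Adj v d → False := fun h1 h2 =>
    hA.false_of_eight hC hv n1 (nodup_four yc'.symm zc'.symm hcd hyz' yd' zd')
      h1 zc zy xy xz yz yd h2
  have c3 : G.Adj v y' → G.Adj v c → False := fun h1 h2 =>
    hA.false_of_eight hC hv n2 (nodup_four yd' hyz' yc' zd'.symm hcd.symm zc')
      h1 zy zd yd yz xz xc h2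
  have c4 : G.Adj v y' → G.Adj v d → False := fun h1 h2 =>
    hA.false_of_eight hC hv n2 (nodup_four yc' hyz' yd' zc'.symm hcd zd')
      h1 zy zc yc yz xz xd h2
  have c5 : G.Adj v z' → G.Adj v c → False := fun h1 h2 =>
    hA.false_of_eight hC hv n3 (nodup_four zd' hyz'.symm zc' yd'.symm hcd.symm yc')
      h1 yz yd zd zy xy xc h2
  have c6 : G.Adj v z' → G.Adj v d → False := fun h1 h2 =>
    hA.false_of_eight hC hv n3 (nodup_four zc' hyz'.symm zd' yc'.symm hcd yd')
      h1 yz yc zc zy xy xd h2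
  rcases hp with h | h | h | h <;> rcases hq with h' | h' | h' | h' <;> rw [h] at hvp <;>
    rw [h'] at hvq <;>
    first
    | exact hpq (h.trans h'.symm)
    | exact c1 hvp hvq
    | exact c1 hvq hvp
    | exact c2 hvp hvq
    | exact c2 hvq hvp
    | exact c3 hvp hvq
    | exact c3 hvq hvp
    | exact c4 hvp hvq
    | exact c4 hvq hvp
    | exact c5 hvp hvq
    | exact c5 hvq hvp
    | exact c6 hvp hvq
    | exact c6 hvq hvp

/-- Two vertices of `S ∩ A` are adjacent to all of `S ∩ B`, and vice versa. -/
def HasTwoFull (G : SimpleGraph V) (A B S : Finset V) : Prop :=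
  ∃ x₀ ∈ S ∩ A, ∃ x₁ ∈ S ∩ A, ∃ y₀ ∈ S ∩ B, ∃ y₁ ∈ S ∩ B, x₀ ≠ x₁ ∧ y₀ ≠ y₁ ∧
    (∀ y ∈ S ∩ B, G.Adj x₀ y ∧ G.Adj x₁ y) ∧ ∀ x ∈ S ∩ A, G.Adj x y₀ ∧ G.Adj x y₁

theorem HasTwoFull.symm {S : Finset V} (h : G.HasTwoFull A B S) : G.HasTwoFull B A S := by
  obtain ⟨x₀, hx₀, x₁, hx₁, y₀, hy₀, y₁, hy₁, hx, hy, h1, h2⟩ := h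
  exact ⟨y₀, hy₀, y₁, hy₁, x₀, hx₀, x₁, hx₁, hy, hx, fun x hx => ⟨(h2 x hx).1.symm,
    (h2 x hx).2.symm⟩, fun y hy => ⟨(h1 y hy).1.symm, (h1 y hy).2.symm⟩⟩

theorem exists_pair_of_degIn {S : Finset V} {v : V} (h : G.degIn S v = 2) :
    ∃ p ∈ S, ∃ q ∈ S, p ≠ q ∧ G.Adj v p ∧ G.Adj v q := by
  classical
  unfold degIn at h
  obtain ⟨p, q, hne, he⟩ := Finset.card_eq_two.1 h
  have hp : p ∈ S.filter (G.Adj v) := by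
    convert (by simp : p ∈ ({p, q} : Finset V))
  have hq : q ∈ S.filter (G.Adj v) := by
    convert (by simp : q ∈ ({p, q} : Finset V))
  rw [Finset.mem_filter] at hp hq
  exact ⟨p, hp.1, q, hq.1, hne, hp.2, hq.2⟩

theorem exists_mem_not_mem_of_card_lt {S T : Finset V} (h : T.card < S.card) :
    ∃ x ∈ S, x ∉ T := by
  by_contra hcon
  push Not at hcon
  have := Finset.card_le_card hcon
  omega

namespace IsSplit

theorem erase_inter {S : Finset V} {v : V} (hs : G.IsSplit A B) (hA : v ∈ A) :
    S.erase v ∩ B = S ∩ B :=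
  erase_inter_of_not_mem fun hB => (hs.compl v).1 hB hA

/-- A restored vertex of degree two must be attached exactly to the two full vertices of the other
class, since any other neighbour closes an eight-cycle. The same four vertices thus remain full. -/
theorem hasTwoFull_of_erase (hs : G.IsSplit A B) (hC : G.NoCycleGE 8) {S : Finset V} {v : V}
    (hvS : v ∈ S) (hvA : v ∈ A) (hd : G.degIn S v = 2) (hi : 4 ≤ (S ∩ A).card)
    (hj : 4 ≤ (S ∩ B).card) (h : G.HasTwoFull A B (S.erase v)) : G.HasTwoFull A B S := by
  obtain ⟨x₀, hx₀, x₁, hx₁, y₀, hy₀, y₁, hy₁, hx, hy, h1, h2⟩ := h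
  rw [hs.erase_inter hvA] at hy₀ hy₁ h1
  have hc := erase_inter_card_of_mem hvS hvA
  obtain ⟨p, hp, q, hq, hpq, hvp, hvq⟩ := exists_pair_of_degIn hd
  replace hp := hs.mem_inter hvA hp hvp
  replace hq := hs.mem_inter hvA hq hvq
  obtain ⟨x₂, hx₂, hx₂'⟩ := exists_mem_not_mem_of_card_lt (S := S.erase v ∩ A) (T := {x₀, x₁})
    (Finset.card_le_two.trans_lt (by omega))
  have hxv : ∀ {x : V}, x ∈ S.erase v ∩ A → v ≠ x := fun hx he =>
    Finset.notMem_erase v S (he ▸ (Finset.mem_inter.1 hx).1)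
  have v0 := hxv hx₀
  have v1 := hxv hx₁
  have v2 := hxv hx₂
  simp only [Finset.mem_insert, Finset.mem_singleton, not_or] at hx₂'
  -- a neighbour of `v` outside `{y₀, y₁}` closes a cycle of length `8`
  have key : ∀ {p q y₀ y₁ : V}, p ∈ S ∩ B → q ∈ S ∩ B → y₀ ∈ S ∩ B → y₁ ∈ S ∩ B → p ≠ q →
      y₀ ≠ y₁ → G.Adj v p → G.Adj v q → (∀ x ∈ S.erase v ∩ A, G.Adj x y₀ ∧ G.Adj x y₁) →
      p ≠ y₀ → p ≠ y₁ → q ≠ y₁ → False := by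
    intro p q y₀ y₁ hp hq hy₀ hy₁ hpq hy hvp hvq h2 p0 p1 q1
    by_cases hq0 : q = y₀
    · subst hq0
      obtain ⟨y₃, hy₃, hy₃'⟩ := exists_mem_not_mem_of_card_lt (S := S ∩ B) (T := {p, q, y₁})
        (Finset.card_le_three.trans_lt (by omega))
      simp only [Finset.mem_insert, Finset.mem_singleton, not_or] at hy₃'
      refine hs.isClass.false_of_eight hC (a₁ := v) (b₁ := p) (a₂ := x₀) (b₂ := y₃) (a₃ := x₁)
        (b₃ := y₁) (a₄ := x₂) (b₄ := q) hvA ?_ ?_ hvp (h1 p hp).1 (h1 _ hy₃).1 (h1 _ hy₃).2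
        (h1 _ hy₁).2 (h2 _ hx₂).2 (h2 _ hx₂).1 hvq
      · simp; tauto
      · simp; tauto
    · refine hs.isClass.false_of_eight hC (a₁ := v) (b₁ := p) (a₂ := x₀) (b₂ := y₀) (a₃ := x₂)
        (b₃ := y₁) (a₄ := x₁) (b₄ := q) hvA ?_ ?_ hvp (h1 p hp).1 (h1 _ hy₀).1 (h2 _ hx₂).1
        (h2 _ hx₂).2 (h1 _ hy₁).2 (h1 _ hq).2 hvq
      · simp; tauto
      · simp; tauto
  have h2' : ∀ x ∈ S.erase v ∩ A, G.Adj x y₁ ∧ G.Adj x y₀ := fun x hx => (h2 x hx).symm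
  have hv : G.Adj v y₀ ∧ G.Adj v y₁ := by
    have k1 := fun a b c => key hp hq hy₀ hy₁ hpq hy hvp hvq h2 a b c
    have k2 := fun a b c => key hp hq hy₁ hy₀ hpq hy.symm hvp hvq h2' a b c
    have k3 := fun a b c => key hq hp hy₀ hy₁ hpq.symm hy hvq hvp h2 a b c
    have k4 := fun a b c => key hq hp hy₁ hy₀ hpq.symm hy.symm hvq hvp h2' a b c
    by_cases p0 : p = y₀
    · subst p0
      by_cases q1 : q = y₁
      · subst q1; exact ⟨hvp, hvq⟩
      · exact (k3 hpq.symm q1 hy).elim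
    · by_cases p1 : p = y₁
      · subst p1
        by_cases q0 : q = y₀
        · subst q0; exact ⟨hvq, hvp⟩
        · exact (k4 hpq.symm q0 hy.symm).elim
      · by_cases q1 : q = y₁
        · exact (k2 p1 p0 fun h => hy (h.symm.trans q1)).elim
        · exact (k1 p0 p1 q1).elim
  have hsub : S.erase v ∩ A ⊆ S ∩ A :=
    Finset.inter_subset_inter (Finset.erase_subset v S) le_rfl
  refine ⟨x₀, hsub hx₀, x₁, hsub hx₁, y₀, hy₀, y₁, hy₁, hx, hy, h1, fun x hxS => ?_⟩
  by_cases hxv : x = v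
  · exact hxv ▸ hv
  · rw [Finset.mem_inter] at hxS
    exact h2 x (Finset.mem_inter.2 ⟨Finset.mem_erase.2 ⟨hxv, hxS.1⟩, hxS.2⟩)

theorem adj_of_degIn_eq (hs : G.IsSplit A B) {S : Finset V} {x y : V} (hx : x ∈ A)
    (h : (S ∩ B).card ≤ G.degIn S x) (hy : y ∈ S ∩ B) : G.Adj x y := by
  by_contra ha
  have := degIn_lt_of_not_adj (fun z hz ha => hs.mem_inter hx hz ha) hy ha
  omega

theorem exists_missing (hs : G.IsSplit A B) {S : Finset V} {x : V} (hx : x ∈ A)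
    (h : G.degIn S x + 1 = (S ∩ B).card) :
    ∃ y ∈ S ∩ B, ∀ z ∈ S ∩ B, z ≠ y → G.Adj x z := by
  classical
  rw [hs.degIn_inter hx] at h
  have h1 := Finset.card_filter_add_card_filter_not (s := S ∩ B) (G.Adj x)
  have h2 : G.degIn (S ∩ B) x = ((S ∩ B).filter (G.Adj x)).card := by
    unfold degIn
    congr
  obtain ⟨y, hy⟩ := Finset.card_eq_one.1 (show ((S ∩ B).filter (¬ G.Adj x ·)).card = 1 by omega)
  have hy' : y ∈ (S ∩ B).filter (¬ G.Adj x ·) := by simp [hy]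
  refine ⟨y, (Finset.mem_filter.1 hy').1, fun z hz hne => ?_⟩
  by_contra ha
  have : z ∈ (S ∩ B).filter (¬ G.Adj x ·) := Finset.mem_filter.2 ⟨hz, ha⟩
  rw [hy] at this
  exact hne (Finset.mem_singleton.1 this)

theorem degSum_eq_two_mul (hs : G.IsSplit A B) (S : Finset V) :
    G.degSum S = 2 * ∑ x ∈ S ∩ A, G.degIn S x := by
  classical
  have h1 : ∑ x ∈ S ∩ A, G.degIn S x = ∑ y ∈ S ∩ B, G.degIn S y := by
    have := Finset.sum_card_bipartiteAbove_eq_sum_card_bipartiteBelow (s := S ∩ A) (t := S ∩ B)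
      G.Adj
    convert this using 2 with x hx y hy
    · rw [hs.degIn_inter (Finset.mem_inter.1 hx).2]
      unfold degIn Finset.bipartiteAbove
      congr
    · rw [hs.symm.degIn_inter (Finset.mem_inter.1 hy).2]
      unfold degIn Finset.bipartiteBelow
      simp only [G.adj_comm]
  rw [degSum, hs.sum_eq, ← h1]
  ring

/-- The degrees of `y` and `z` are `4, 2` or `3, 3`. In the first case `x`, `y` and the two
neighbours of `z` are full before `v` is restored. In the second, a common missing neighbour would
leave a biclique with three vertices on each side, against degeneracy, and different ones contradict
`IsClass.false_of_two_missing`. -/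
theorem hasTwoFull_of_three (hs : G.IsSplit A B) (hC : G.NoCycleGE 8) {S : Finset V} {v : V}
    (hvS : v ∈ S) (hvA : v ∈ A) (hdeg : G.Degenerate (fun _ => 2) S)
    (hd : G.degIn S v = 2) (hj : (S ∩ B).card = 4) {x y z : V}
    (hS : S.erase v ∩ A = {x, y, z}) (hxy : x ≠ y) (hxz : x ≠ z) (hyz : y ≠ z)
    (hx : G.degIn S x = 4) (hsum : G.degIn S y + G.degIn S z = 6)
    (hle : G.degIn S z ≤ G.degIn S y) : G.HasTwoFull A B S := by
  have hi : 4 ≤ (S ∩ A).card := by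
    rw [← erase_inter_card_of_mem hvS hvA, hS, Finset.card_insert_of_notMem (by simp [hxy, hxz]),
      Finset.card_pair hyz]
  have hmem : ∀ {w : V}, w = x ∨ w = y ∨ w = z → w ∈ S.erase v ∩ A := by
    intro w hw
    rw [hS]
    simpa using hw
  have hxm := hmem (Or.inl (rfl : x = x))
  have hym := hmem (Or.inr (Or.inl (rfl : y = y)))
  have hzm := hmem (Or.inr (Or.inr (rfl : z = z)))
  have hA : ∀ {w : V}, w ∈ S.erase v ∩ A → w ∈ A := fun hw => (Finset.mem_inter.1 hw).2
  have hSm : ∀ {w : V}, w ∈ S.erase v ∩ A → w ∈ S := fun hw =>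
    Finset.mem_of_mem_erase (Finset.mem_inter.1 hw).1
  have hxv : ∀ {x : V}, x ∈ S.erase v ∩ A → v ≠ x := fun hx he =>
    Finset.notMem_erase v S (he ▸ (Finset.mem_inter.1 hx).1)
  have vx := hxv hxm
  have vy := hxv hym
  have vz := hxv hzm
  have hxB := fun w hw => hs.adj_of_degIn_eq (S := S) (y := w) (hA hxm) (by omega) hw
  have hyle := hs.degIn_le (S := S) (hA hym)
  rcases (show G.degIn S y = 4 ∨ G.degIn S y = 3 by omega) with hy | hy
  · have hyB := fun w hw => hs.adj_of_degIn_eq (S := S) (y := w) (hA hym) (by omega) hw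
    obtain ⟨p, hp, q, hq, hpq, hzp, hzq⟩ := exists_pair_of_degIn
      (show G.degIn S z = 2 by omega)
    replace hp := hs.mem_inter (hA hzm) hp hzp
    replace hq := hs.mem_inter (hA hzm) hq hzq
    refine hs.hasTwoFull_of_erase hC hvS hvA hd hi (by omega) ⟨x, hxm, y, hym, ?_⟩
    rw [hs.erase_inter hvA]
    refine ⟨p, hp, q, hq, hxy, hpq, fun w hw => ⟨hxB w hw, hyB w hw⟩, fun w hw => ?_⟩
    rw [hS] at hw
    simp only [Finset.mem_insert, Finset.mem_singleton] at hw
    rcases hw with rfl | rfl | rfl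
    · exact ⟨hxB p hp, hxB q hq⟩
    · exact ⟨hyB p hp, hyB q hq⟩
    · exact ⟨hzp, hzq⟩
  · obtain ⟨y', hy', hyB⟩ := hs.exists_missing (S := S) (hA hym) (by omega)
    obtain ⟨z', hz', hzB⟩ := hs.exists_missing (S := S) (hA hzm) (by omega)
    exfalso
    by_cases hyz' : y' = z'
    · subst hyz'
      have hT : ((S ∩ B).erase y').card = 3 := by
        rw [Finset.card_erase_of_mem hy', hj]
      have hU : (S.erase v ∩ A).card = 3 := by
        rw [hS, Finset.card_insert_of_notMem (by simp [hxy, hxz]), Finset.card_pair hyz]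
      have hadj : ∀ a ∈ S.erase v ∩ A, ∀ b ∈ (S ∩ B).erase y', G.Adj a b := by
        intro a ha b hb
        rw [Finset.mem_erase] at hb
        rw [hS] at ha
        simp only [Finset.mem_insert, Finset.mem_singleton] at ha
        rcases ha with rfl | rfl | rfl
        · exact hxB b hb.2
        · exact hyB b hb.2 hb.1
        · exact hzB b hb.2 hb.1
      obtain ⟨w, hw, hwd⟩ := hdeg (S.erase v ∩ A ∪ (S ∩ B).erase y')
        (Finset.union_subset (fun w hw => hSm hw)
          ((Finset.erase_subset _ _).trans Finset.inter_subset_left))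
        ⟨x, Finset.mem_union_left _ hxm⟩
      change _ ≤ 2 at hwd
      rcases Finset.mem_union.1 hw with hw | hw
      · have := card_le_degIn (G := G) (Finset.subset_union_right :
          (S ∩ B).erase y' ⊆ S.erase v ∩ A ∪ (S ∩ B).erase y') (hadj w hw)
        omega
      · have := card_le_degIn (G := G) (Finset.subset_union_left :
          S.erase v ∩ A ⊆ S.erase v ∩ A ∪ (S ∩ B).erase y') fun a ha => (hadj a ha w hw).symm
        omega
    · have hsub : ({y', z'} : Finset V) ⊆ S ∩ B := by
        intro w hw
        simp only [Finset.mem_insert, Finset.mem_singleton] at hw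
        rcases hw with rfl | rfl <;> assumption
      have hc : ((S ∩ B) \ {y', z'}).card = 2 := by
        rw [Finset.card_sdiff_of_subset hsub, Finset.card_pair hyz', hj]
      obtain ⟨c, d, hcd, he⟩ := Finset.card_eq_two.1 hc
      have hB : ∀ w, w ∈ S ∩ B ↔ w = y' ∨ w = z' ∨ w = c ∨ w = d := by
        intro w
        rw [← Finset.union_sdiff_of_subset hsub, he]
        simp only [Finset.mem_union, Finset.mem_insert, Finset.mem_singleton]
        tauto
      have hc' : c ∈ (S ∩ B) \ {y', z'} := by simp [he]
      have hd' : d ∈ (S ∩ B) \ {y', z'} := by simp [he]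
      simp only [Finset.mem_sdiff, Finset.mem_insert, Finset.mem_singleton, not_or] at hc' hd'
      obtain ⟨hcB, cy, cz⟩ := hc'
      obtain ⟨hdB, dy, dz⟩ := hd'
      have yz := hyB z' hz' (Ne.symm hyz')
      have yc := hyB c hcB cy
      have yd := hyB d hdB dy
      have zy := hzB y' hy' hyz'
      have zc := hzB c hcB cz
      have zd := hzB d hdB dz
      have xy := hxB y' hy'
      have xz := hxB z' hz'
      have xc := hxB c hcB
      have xd := hxB d hdB
      obtain ⟨p, hp, q, hq, hpq, hvp, hvq⟩ := exists_pair_of_degIn hd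
      exact hs.isClass.false_of_two_missing hC hvA vx vy vz hxy hxz hyz hyz' (Ne.symm cy)
        (Ne.symm dy) (Ne.symm cz) (Ne.symm dz) hcd (hxB y' hy') (hxB z' hz') (hxB c hcB)
        (hxB d hdB) (hyB z' hz' (Ne.symm hyz')) (hyB c hcB cy) (hyB d hdB dy)
        (hzB y' hy' hyz') (hzB c hcB cz) (hzB d hdB dz) hpq hvp hvq
        ((hB p).1 (hs.mem_inter hvA hp hvp)) ((hB q).1 (hs.mem_inter hvA hq hvq))

/-- There are at least twelve edges, and at most ten remain without `v`. So `v` has degree two, and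
the other three degrees, each at most four, add up to ten: one is four and the others sum to six. -/
theorem hasTwoFull_of_four (hs : G.IsSplit A B) (hC : G.NoCycleGE 8) {S : Finset V} {v : V}
    (hvS : v ∈ S) (hvA : v ∈ A) (hdeg : G.Degenerate (fun _ => 2) S)
    (hd : G.degIn S v ≤ 2) (hi : (S ∩ A).card = 4) (hj : (S ∩ B).card = 4)
    (htight : 24 ≤ G.degSum S) : G.HasTwoFull A B S := by
  have hc := erase_inter_card_of_mem hvS hvA
  have hthr : (fun _ => 2 : V → ℕ) = thr A 2 2 := by funext; simp [thr]
  have h1 := (hdeg.mono (Finset.erase_subset v S))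
  rw [hthr] at h1
  have h2 := h1.degSum_le hs (by omega) (by rw [hs.erase_inter hvA]; omega)
  rw [hs.erase_inter hvA] at h2
  have h3 := degSum_erase (G := G) hvS
  have hd2 : G.degIn S v = 2 := by omega
  have h4 := hs.degSum_eq_two_mul S
  have h5 : S ∩ A = insert v (S.erase v ∩ A) := by
    rw [← Finset.insert_inter_of_mem hvA, Finset.insert_erase hvS]
  rw [h5, Finset.sum_insert (by simp)] at h4
  obtain ⟨x, y, z, hxy, hxz, hyz, hS⟩ := Finset.card_eq_three.1
    (show (S.erase v ∩ A).card = 3 by omega)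
  rw [hS, Finset.sum_insert (by simp [hxy, hxz]), Finset.sum_pair hyz] at h4
  have hle : ∀ w ∈ S.erase v ∩ A, G.degIn S w ≤ 4 := fun w hw =>
    hj ▸ hs.degIn_le (Finset.mem_inter.1 hw).2
  have hx := hle x (by simp [hS])
  have hy := hle y (by simp [hS])
  have hz := hle z (by simp [hS])
  have p1 : ({x, y, z} : Finset V) = {x, z, y} := by ext; simp; tauto
  have p2 : ({x, y, z} : Finset V) = {y, x, z} := by ext; simp; tauto
  have p3 : ({x, y, z} : Finset V) = {y, z, x} := by ext; simp; tauto
  have p4 : ({x, y, z} : Finset V) = {z, x, y} := by ext; simp; tauto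
  have p5 : ({x, y, z} : Finset V) = {z, y, x} := by ext; simp; tauto
  rcases (show G.degIn S x = 4 ∨ G.degIn S y = 4 ∨ G.degIn S z = 4 by omega) with h | h | h
  · rcases le_total (G.degIn S z) (G.degIn S y) with h' | h'
    · exact hs.hasTwoFull_of_three hC hvS hvA hdeg hd2 hj hS hxy hxz hyz h (by omega) h'
    · exact hs.hasTwoFull_of_three hC hvS hvA hdeg hd2 hj (hS.trans p1) hxz hxy hyz.symm h
        (by omega) h'
  · rcases le_total (G.degIn S z) (G.degIn S x) with h' | h'
    · exact hs.hasTwoFull_of_three hC hvS hvA hdeg hd2 hj (hS.trans p2) hxy.symm hyz hxz h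
        (by omega) h'
    · exact hs.hasTwoFull_of_three hC hvS hvA hdeg hd2 hj (hS.trans p3) hyz hxy.symm hxz.symm h
        (by omega) h'
  · rcases le_total (G.degIn S y) (G.degIn S x) with h' | h'
    · exact hs.hasTwoFull_of_three hC hvS hvA hdeg hd2 hj (hS.trans p4) hxz.symm hyz.symm hxy h
        (by omega) h'
    · exact hs.hasTwoFull_of_three hC hvS hvA hdeg hd2 hj (hS.trans p5) hyz.symm hxz.symm
        hxy.symm h (by omega) h'

/-- A graph without cycles of length at least `8` which can be dismantled by removing vertices of
degree two, and has as many edges as this allows, has two full vertices in each class. -/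
theorem hasTwoFull (hs : G.IsSplit A B) (hC : G.NoCycleGE 8) {S : Finset V}
    (hdeg : G.Degenerate (fun _ => 2) S) (hi : 4 ≤ (S ∩ A).card) (hj : 4 ≤ (S ∩ B).card)
    (htight : 4 * ((S ∩ A).card + (S ∩ B).card) ≤ G.degSum S + 8) : G.HasTwoFull A B S := by
  induction S using Finset.strongInduction with
  | H S ih =>
  -- Removing a vertex from a class with at least five vertices preserves tightness, and tightness
  -- makes its degree exactly two.
  have step : ∀ {A B : Finset V}, G.IsSplit A B → 5 ≤ (S ∩ A).card → 4 ≤ (S ∩ B).card →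
      4 * ((S ∩ A).card + (S ∩ B).card) ≤ G.degSum S + 8 →
      (∀ T ⊂ S, 4 ≤ (T ∩ A).card → 4 ≤ (T ∩ B).card →
        4 * ((T ∩ A).card + (T ∩ B).card) ≤ G.degSum T + 8 → G.HasTwoFull A B T) →
      ∀ v ∈ S, v ∈ A → G.degIn S v ≤ 2 → G.HasTwoFull A B S := by
    intro A B hs hi hj ht ih v hvS hvA hv
    have hc := erase_inter_card_of_mem hvS hvA
    have hthr : (fun _ => 2 : V → ℕ) = thr A 2 2 := by funext; simp [thr]
    have h1 := (hdeg.mono (Finset.erase_subset v S))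
    rw [hthr] at h1
    have h2 := h1.degSum_le hs (by omega) (by rw [hs.erase_inter hvA]; omega)
    have h3 := degSum_erase (G := G) hvS
    have h4 := ih _ (Finset.erase_ssubset hvS) (by omega)
    rw [hs.erase_inter hvA] at h2 h4
    exact hs.hasTwoFull_of_erase hC hvS hvA (by omega) (by omega) hj (h4 hj (by omega))
  have stepA := step hs
  have stepB := step hs.symm
  have ihA : ∀ T ⊂ S, 4 ≤ (T ∩ A).card → 4 ≤ (T ∩ B).card →
      4 * ((T ∩ A).card + (T ∩ B).card) ≤ G.degSum T + 8 → G.HasTwoFull A B T :=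
    fun T hT h1 h2 h3 => ih T hT (hdeg.mono hT.1) h1 h2 h3
  have ihB : ∀ T ⊂ S, 4 ≤ (T ∩ B).card → 4 ≤ (T ∩ A).card →
      4 * ((T ∩ B).card + (T ∩ A).card) ≤ G.degSum T + 8 → G.HasTwoFull B A T :=
    fun T hT h1 h2 h3 => (ihA T hT h2 h1 (by omega)).symm
  have htight' : 4 * ((S ∩ B).card + (S ∩ A).card) ≤ G.degSum S + 8 := by omega
  -- Otherwise there would be at least `3|S ∩ B|` edges, while degeneracy allows only `2|S ∩ B| +
  -- 4`. Thus the removed vertex can be taken from the larger class.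
  have large : ∀ {A B : Finset V}, G.IsSplit A B → (S ∩ A).card = 4 → 5 ≤ (S ∩ B).card →
      ∃ v ∈ S, v ∈ B ∧ G.degIn S v ≤ 2 := by
    intro A B hs hi hj
    by_contra hcon
    push Not at hcon
    have h1 := hs.symm.degSum_eq_two_mul S
    have h2 : (S ∩ B).card * 3 ≤ ∑ y ∈ S ∩ B, G.degIn S y := by
      rw [← smul_eq_mul]
      exact Finset.card_nsmul_le_sum _ _ _ fun y hy =>
        hcon y (Finset.mem_inter.1 hy).1 (Finset.mem_inter.1 hy).2
    have hthr : (fun _ => 2 : V → ℕ) = thr A 2 2 := by funext; simp [thr]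
    have h3 := hdeg
    rw [hthr] at h3
    have := h3.degSum_le hs (by omega) (by omega)
    omega
  obtain ⟨v, hvS, hv⟩ := hdeg S le_rfl (Finset.card_pos.1 (by
    have := Finset.card_le_card (Finset.inter_subset_left : S ∩ A ⊆ S)
    omega))
  rcases hi.eq_or_lt with hi4 | hi5 <;> rcases hj.eq_or_lt with hj4 | hj5
  · by_cases hvA : v ∈ A
    · exact hs.hasTwoFull_of_four hC hvS hvA hdeg hv hi4.symm hj4.symm (by omega)
    · exact (hs.symm.hasTwoFull_of_four hC hvS ((hs.compl v).2 hvA) hdeg hv hj4.symm hi4.symm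
        (by omega)).symm
  · obtain ⟨w, hw, hwB, hwd⟩ := large hs hi4.symm hj5
    exact (stepB hj5 hi htight' ihB w hw hwB hwd).symm
  · obtain ⟨w, hw, hwA, hwd⟩ := large hs.symm hj4.symm hi5
    exact stepA hi5 hj htight ihA w hw hwA hwd
  · by_cases hvA : v ∈ A
    · exact stepA hi5 hj htight ihA v hvS hvA hv
    · exact (stepB hj5 hi htight' ihB v hvS ((hs.compl v).2 hvA) hv).symm

end IsSplit
end SimpleGraph

/-! ### Equality for `ℓ = 5` -/

namespace SimpleGraph

variable {V : Type*} [DecidableEq V] {G : SimpleGraph V} {A B : Finset V}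

/-- If `G` can be dismantled with thresholds `2` and `3`, and has as many edges as this allows,
then it cannot be separated by two vertices of `A`. -/
theorem Degenerate.exists_walk (hs : G.IsSplit A B) {S : Finset V}
    (hdeg : G.Degenerate (thr A 2 3) S) (hi : 3 ≤ (S ∩ A).card) (hj : 2 ≤ (S ∩ B).card)
    (htight : 2 * (2 * (S ∩ A).card + 3 * (S ∩ B).card) ≤ G.degSum S + 12) {s t : V}
    (hsA : s ∈ A) (htA : t ∈ A) {u w : V} (hu : u ∈ S) (hw : w ∈ S) (hus : u ≠ s) (hut : u ≠ t)
    (hws : w ≠ s) (hwt : w ≠ t) :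
    ∃ p : G.Walk u w, ∀ z ∈ p.support, z ∉ ({s, t} : Set V) := by
  have hadj : ∀ {x y : V}, x ≠ s → x ≠ t → y ≠ s → y ≠ t → G.Adj x y →
      ∃ p : G.Walk x y, ∀ z ∈ p.support, z ∉ ({s, t} : Set V) := by
    intro x y h1 h2 h3 h4 ha
    refine ⟨Walk.cons ha Walk.nil, fun z hz => ?_⟩
    simp only [Walk.support_cons, Walk.support_nil, List.mem_cons, List.not_mem_nil,
      or_false] at hz
    rcases hz with rfl | rfl <;> simp [*]
  have htrans : ∀ {x y z : V}, (∃ p : G.Walk x y, ∀ z ∈ p.support, z ∉ ({s, t} : Set V)) →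
      (∃ p : G.Walk y z, ∀ z ∈ p.support, z ∉ ({s, t} : Set V)) →
      ∃ p : G.Walk x z, ∀ z ∈ p.support, z ∉ ({s, t} : Set V) := by
    rintro x y z ⟨p, hp⟩ ⟨q, hq⟩
    refine ⟨p.append q, fun a ha => ?_⟩
    rcases Walk.mem_support_append_iff .. |>.1 ha with ha | ha
    · exact hp a ha
    · exact hq a ha
  have hsymm : ∀ {x y : V}, (∃ p : G.Walk x y, ∀ z ∈ p.support, z ∉ ({s, t} : Set V)) →
      ∃ p : G.Walk y x, ∀ z ∈ p.support, z ∉ ({s, t} : Set V) := by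
    rintro x y ⟨p, hp⟩
    exact ⟨p.reverse, fun a ha => hp a (by simpa using ha)⟩
  have hBs : ∀ {y : V}, y ∈ B → y ≠ s ∧ y ≠ t := fun hy =>
    ⟨fun h => (hs.compl _).1 hy (h ▸ hsA), fun h => (hs.compl _).1 hy (h ▸ htA)⟩
  induction S using Finset.strongInduction generalizing u w with
  | H S ih =>
  by_cases hcomp : 2 * ((S ∩ A).card * (S ∩ B).card) ≤ G.degSum S
  · have hfull := fun {x y} => hs.adj_of_degSum_eq hcomp (x := x) (y := y)
    obtain ⟨γ, hγ, hγ'⟩ := exists_mem_not_mem_of_card_lt (S := S ∩ A) (T := {s, t})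
      (Finset.card_le_two.trans_lt hi)
    simp only [Finset.mem_insert, Finset.mem_singleton, not_or] at hγ'
    obtain ⟨b, hb⟩ := Finset.card_pos.1 (show 0 < (S ∩ B).card by omega)
    have hB : ∀ y ∈ S ∩ B, ∃ p : G.Walk y γ, ∀ z ∈ p.support, z ∉ ({s, t} : Set V) :=
      fun y hy => by
        have h1 := hBs (Finset.mem_inter.1 hy).2
        exact hadj h1.1 h1.2 hγ'.1 hγ'.2 (hfull hγ hy).symm
    have hall : ∀ x ∈ S, x ≠ s → x ≠ t →
        ∃ p : G.Walk x γ, ∀ z ∈ p.support, z ∉ ({s, t} : Set V) := by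
      intro x hx h1 h2
      by_cases hxA : x ∈ A
      · have h3 := hBs (Finset.mem_inter.1 hb).2
        exact htrans (hadj h1 h2 h3.1 h3.2 (hfull (Finset.mem_inter.2 ⟨hx, hxA⟩) hb)) (hB b hb)
      · exact hB x (Finset.mem_inter.2 ⟨hx, (hs.compl x).2 hxA⟩)
    exact htrans (hall u hu hus hut) (hsymm (hall w hw hws hwt))
  -- With three vertices of `A` or two of `B`, a tight edge count is that of a complete bipartite
  -- graph.
  · have hi' : 3 < (S ∩ A).card := by
      refine hi.lt_of_ne fun h => hcomp ?_
      rw [← h] at htight ⊢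
      omega
    have hj' : 2 < (S ∩ B).card := by
      refine hj.lt_of_ne fun h => hcomp ?_
      rw [← h] at htight ⊢
      omega
    obtain ⟨v, hv, hvd⟩ := hdeg S le_rfl ⟨u, hu⟩
    have h1 := degSum_erase (G := G) hv
    have hdeg' := hdeg.mono (Finset.erase_subset v S)
    have hne : ∀ {z : V}, G.Adj v z → z ∈ S → z ∈ S.erase v := fun ha hz =>
      Finset.mem_erase.2 ⟨ha.ne', hz⟩
    -- Tightness makes the removed vertex meet its threshold exactly: two neighbours in `B`, which
    -- avoid `s` and `t` automatically, or three in `A`, one of which differs from both. Through it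
    -- the vertex stays connected to the rest.
    obtain ⟨⟨hi2, hj2, ht2⟩, z, hz, hzs, hzt, hvz⟩ : (3 ≤ (S.erase v ∩ A).card ∧
        2 ≤ (S.erase v ∩ B).card ∧ 2 * (2 * (S.erase v ∩ A).card + 3 * (S.erase v ∩ B).card) ≤
        G.degSum (S.erase v) + 12) ∧ ∃ z ∈ S.erase v, z ≠ s ∧ z ≠ t ∧ G.Adj v z := by
      have hb := hdeg'.degSum_le hs
      by_cases hvA : v ∈ A
      · rw [thr_of_mem hvA] at hvd
        have h2 := erase_inter_card_of_mem hv hvA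
        rw [hs.erase_inter hvA] at hb ⊢
        have hb := hb (by omega) hj
        refine ⟨⟨by omega, hj, by omega⟩, ?_⟩
        obtain ⟨z, hz, -, -, -, hvz, -⟩ := exists_pair_of_degIn (show G.degIn S v = 2 by omega)
        have hzB := hs.mem_inter hvA hz hvz
        have h3 := hBs (Finset.mem_inter.1 hzB).2
        exact ⟨z, hne hvz hz, h3.1, h3.2, hvz⟩
      · rw [thr_of_not_mem hvA] at hvd
        have hvB := (hs.compl v).2 hvA
        have h2 := erase_inter_card_of_mem hv hvB
        rw [hs.symm.erase_inter hvB] at hb ⊢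
        have hb := hb hi (by omega)
        refine ⟨⟨hi, by omega, by omega⟩, ?_⟩
        by_contra hcon
        push Not at hcon
        have h3 : G.degIn S v ≤ G.degIn {s, t} v := degIn_le_of_forall fun z hz ha => by
          by_contra hzst
          simp only [Finset.mem_insert, Finset.mem_singleton, not_or] at hzst
          exact hcon z (hne ha hz) hzst.1 hzst.2 ha
        have h4 := h3.trans ((degIn_le_card _ _).trans Finset.card_le_two)
        omega
    have hall : ∀ x ∈ S, x ≠ s → x ≠ t → ∃ y ∈ S.erase v, y ≠ s ∧ y ≠ t ∧
        ∃ p : G.Walk x y, ∀ z ∈ p.support, z ∉ ({s, t} : Set V) := by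
      intro x hx h2 h3
      by_cases hxv : x = v
      · subst hxv
        exact ⟨z, hz, hzs, hzt, hadj h2 h3 hzs hzt hvz⟩
      · exact ⟨x, Finset.mem_erase.2 ⟨hxv, hx⟩, h2, h3, Walk.nil, by simp [h2, h3]⟩
    obtain ⟨u', hu', h2, h3, hpu⟩ := hall u hu hus hut
    obtain ⟨w', hw', h4, h5, hpw⟩ := hall w hw hws hwt
    exact htrans (htrans hpu (ih _ (Finset.erase_ssubset hv) hdeg' hi2 hj2 ht2 hu' hw' h2 h3
      h4 h5)) (hsymm hpw)

namespace Extremal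

variable [Fintype V]

/-- Peeling outside `H` with threshold two stops at a set all of whose vertices have degree above
two, hence at `H` by maximality. -/
theorem degSum_le_of_core (h : G.Extremal A B 5) {H : Finset V}
    (hH : ∀ v ∈ H, 2 < G.degIn H v) (hmax : ∀ T, H ⊆ T → (∀ v ∈ T, 2 < G.degIn T v) → T = H) :
    G.degSum Finset.univ ≤ 2 * ((H ∩ A).card * (H ∩ B).card) +
      2 * (2 * (A.card - (H ∩ A).card) + 2 * (B.card - (H ∩ B).card)) := by
  obtain ⟨D, -, hHD, hD, hsum⟩ := exists_peeled (G := G) (thr A 2 2) (Finset.subset_univ H)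
  obtain rfl : D = H := hmax D hHD fun v hv => by
    by_cases hvH : v ∈ H
    · exact (hH v hvH).trans_le (degIn_mono hHD v)
    · simpa [thr] using hD v hv hvH
  rw [h.sum_thr_compl] at hsum
  have := h.isSplit.degSum_le_mul D
  omega

/-- The count is too large for thresholds `2, 2`, so there is a core `H` of minimum degree three. If
`G` is also dismantled by `3, 2`, tightness gives `|A| = |B|`, the theta argument works in both
classes, and `H` is a biclique with three vertices on each side, leaving too few edges. Otherwise
the core `K` for `3, 2` is completely joined to `H`, so both are one biclique with three vertices in
`A`, and the count forces it to contain `B`. -/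
theorem hasFull_of_five (h : G.Extremal A B 5) (hle : A.card ≤ B.card)
    (hdeg : G.Degenerate (thr A 2 3) Finset.univ)
    (htight : 2 * (2 * A.card + 3 * B.card) ≤ G.degSum Finset.univ + 12) :
    G.HasFull A B 3 := by
  have hi := h.le_left
  have hj := h.le_right
  have hs := h.isSplit
  have hconn : ∀ s t, s ∈ A → t ∈ A → ∀ u w, u ≠ s → u ≠ t → w ≠ s → w ≠ t →
      ∃ p : G.Walk u w, ∀ z ∈ p.support, z ∉ ({s, t} : Set V) :=
    fun s t hsA htA u w h1 h2 h3 h4 => hdeg.exists_walk hs (by rw [Finset.univ_inter]; omega)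
      (by rw [Finset.univ_inter]; omega) (by rwa [Finset.univ_inter, Finset.univ_inter]) hsA htA
      (Finset.mem_univ u) (Finset.mem_univ w) h1 h2 h3 h4
  have hn : ¬ G.Degenerate (thr A 2 2) Finset.univ := fun hd => by
    have := hd.degSum_le hs (by rw [Finset.univ_inter]; omega) (by rw [Finset.univ_inter]; omega)
    rw [Finset.univ_inter, Finset.univ_inter] at this
    omega
  obtain ⟨H, hHne, hH, hHm, hHmax⟩ := exists_core hn
  have hthr : thr A 2 2 = fun _ => 2 := by funext; simp [thr]
  simp only [hthr] at hH hHm hHmax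
  have hcount := h.degSum_le_of_core hH hHmax
  have hle1 : ∀ {T : Finset V} {v : V}, v ∈ A → G.degIn T v ≤ (T ∩ B).card :=
    fun hv => hs.degIn_le hv
  have hle2 : ∀ {T : Finset V} {v : V}, v ∉ A → G.degIn T v ≤ (T ∩ A).card :=
    fun hv => hs.symm.degIn_le ((h.compl _).2 hv)
  have hfull : ∀ {C T : Finset V} {v : V}, (∀ y ∈ T ∩ C, G.Adj v y) →
      (T ∩ C).card ≤ G.degIn T v := fun h => card_le_degIn Finset.inter_subset_left h
  obtain ⟨⟨a₁, ha₁, ha₁A⟩, b₁, hb₁, hb₁A⟩ :=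
    h.isSplit.exists_mem_and_exists_notMem hHne fun v hv => by have := hH v hv; omega
  have c1 := (hH _ ha₁).trans_le (hle1 ha₁A)
  have c2 := (hH _ hb₁).trans_le (hle2 hb₁A)
  have hbic : (∀ x ∈ H ∩ A, ∀ y ∈ H ∩ B, G.Adj x y) → G.IsBiclique A B H := fun hadj =>
    ⟨hadj, fun v _ hvy => hHm v (c1.trans_le (hfull hvy)),
      fun v _ hvx => hHm v (c2.trans_le (hfull hvx))⟩
  by_cases hdeg' : G.Degenerate (thr A 3 2) Finset.univ
  · exfalso
    have h1 := hdeg'.degSum_le hs (by rw [Finset.univ_inter]; omega)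
      (by rw [Finset.univ_inter]; omega)
    rw [Finset.univ_inter, Finset.univ_inter] at h1
    have hconn' : ∀ s t, s ∈ B → t ∈ B → ∀ u w, u ≠ s → u ≠ t → w ≠ s → w ≠ t →
        ∃ p : G.Walk u w, ∀ z ∈ p.support, z ∉ ({s, t} : Set V) := by
      have h2 := hdeg'
      rw [← hs.thr_eq] at h2
      exact fun s t hsA htA u w h3 h4 h5 h6 => h2.exists_walk hs.symm
        (by rw [Finset.univ_inter]; omega) (by rw [Finset.univ_inter]; omega)
        (by rw [Finset.univ_inter, Finset.univ_inter]; omega) hsA htA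
        (Finset.mem_univ u) (Finset.mem_univ w) h3 h4 h5 h6
    have hadj := h.adj_of_not_saturated (S := H) (T := H) fun v M hv hM => by
      have h2 := hH _ hv.left
      have h3 := hH _ hv.right
      by_cases hA : v 0 ∈ A ↔ v M ∈ A
      · refine h.false_of_three hv hM hA h2 h3 fun s t hsA htA => ?_
        by_cases h0 : v 0 ∈ A
        · exact hconn' s t ((h.compl s).2 fun h => hsA.1 h h0) ((h.compl t).2 fun h => htA.1 h h0)
        · exact hconn s t (hsA.2 h0) (htA.2 h0)
      · have := h.degIn_add_degIn_le hv hM (iff_not_comm.1 (not_iff.1 hA).symm)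
        omega
    have hK := hbic fun x hx y hy => by
      rw [Finset.mem_inter] at hx
      rw [Finset.mem_inter, h.compl] at hy
      exact hadj x hx.1 y hy.1 (iff_of_true hx.2 hy.2)
    have hq : (H ∩ B).card ≤ 3 := by
      by_contra hq
      obtain ⟨v, hv, hvd⟩ := hdeg' H (Finset.subset_univ H) hHne
      by_cases hvA : v ∈ A
      · rw [thr_of_mem hvA] at hvd
        have := hK.le_degIn hv hvA
        omega
      · rw [thr_of_not_mem hvA] at hvd
        have := hH v hv
        omega
    have hp : (H ∩ A).card ≤ 3 := by
      by_contra hp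
      obtain ⟨v, hv, hvd⟩ := hdeg H (Finset.subset_univ H) hHne
      by_cases hvA : v ∈ A
      · rw [thr_of_mem hvA] at hvd
        have := hH v hv
        omega
      · rw [thr_of_not_mem hvA] at hvd
        have := hK.symm.le_degIn hv ((h.compl v).2 hvA)
        omega
    rw [show (H ∩ A).card = 3 by omega, show (H ∩ B).card = 3 by omega] at hcount
    omega
  · obtain ⟨K, hKne, hK, hKm, -⟩ := exists_core hdeg'
    have hKA : ∀ v ∈ K, v ∈ A → 3 < G.degIn K v := fun v hv hA => by
      have := hK v hv; rwa [thr_of_mem hA] at this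
    have hKB : ∀ v ∈ K, v ∉ A → 2 < G.degIn K v := fun v hv hA => by
      have := hK v hv; rwa [thr_of_not_mem hA] at this
    obtain ⟨⟨a₂, ha₂, ha₂A⟩, b₂, hb₂, hb₂A⟩ :=
    h.isSplit.exists_mem_and_exists_notMem hKne fun v hv => by have := hK v hv; omega
    have c3 := (hKA _ ha₂ ha₂A).trans_le (hle1 ha₂A)
    have c4 := (hKB _ hb₂ hb₂A).trans_le (hle2 hb₂A)
    -- Degree sums alone fail only when both ends lie in `B`, with three neighbours guaranteed at
    -- each. There the theta argument applies, because no two vertices of `A` separate `G`.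
    have hadj := h.adj_of_not_saturated (S := K) (T := H) fun v M hv hM => by
      have h3 := hH _ hv.right
      by_cases h0 : v 0 ∈ A
      · have h2 := hKA _ hv.left h0
        by_cases hA : v 0 ∈ A ↔ v M ∈ A
        · have := h.degIn_add_degIn_le_succ hv hM hA
          omega
        · have := h.degIn_add_degIn_le hv hM (iff_not_comm.1 (not_iff.1 hA).symm)
          omega
      · have h2 := hKB _ hv.left h0
        by_cases hA : v 0 ∈ A ↔ v M ∈ A
        · exact h.false_of_three hv hM hA h2 h3 fun s t hsA htA =>
            hconn s t (hsA.2 h0) (htA.2 h0)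
        · have := h.degIn_add_degIn_le hv hM (iff_not_comm.1 (not_iff.1 hA).symm)
          omega
    have hHK : K = H := by
      ext v
      by_cases hA : v ∈ A
      · constructor
        · intro hv
          refine hHm v (c1.trans_le (hfull fun y hy => ?_))
          rw [Finset.mem_inter, h.compl] at hy
          exact hadj v hv y hy.1 (iff_of_true hA hy.2)
        · intro hv
          refine hKm v ?_
          rw [thr_of_mem hA]
          refine c3.trans_le (hfull fun y hy => ?_)
          rw [Finset.mem_inter, h.compl] at hy
          exact (hadj y hy.1 v hv (iff_of_false hy.2 (not_not.2 hA))).symm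
      · constructor
        · intro hv
          refine hHm v (c2.trans_le (hfull fun y hy => ?_))
          rw [Finset.mem_inter] at hy
          exact hadj v hv y hy.1 (iff_of_false hA (not_not.2 hy.2))
        · intro hv
          refine hKm v ?_
          rw [thr_of_not_mem hA]
          refine c4.trans_le (hfull fun y hy => ?_)
          rw [Finset.mem_inter] at hy
          exact (hadj y hy.1 v hv (iff_of_true hy.2 hA)).symm
    subst hHK
    have hKb := hbic fun x hx y hy => by
      rw [Finset.mem_inter] at hx
      rw [Finset.mem_inter, h.compl] at hy
      exact hadj x hx.1 y hy.1 (iff_of_true hx.2 hy.2)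
    have hp : (K ∩ A).card = 3 := by
      rcases le_total (K ∩ A).card (K ∩ B).card with h1 | h1
      · have := h.isBiclique_card_add_two_le hKb h1
        omega
      · have := h.symm.isBiclique_card_add_two_le hKb.symm h1
        omega
    rw [hp] at hcount
    have hqB : (K ∩ B).card ≤ B.card := Finset.card_le_card Finset.inter_subset_right
    refine ⟨K ∩ A, Finset.inter_subset_right, hp, fun x hx y hy => hKb.adj x hx y ?_⟩
    rwa [Finset.eq_of_subset_of_card_le (Finset.inter_subset_right : K ∩ B ⊆ B) (by omega)]

end Extremal
end SimpleGraph

/-! ### The edge bound and its equality cases -/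

namespace SimpleGraph

variable {V : Type*} [DecidableEq V] {G : SimpleGraph V} {A B : Finset V} {ℓ : ℕ}

namespace Extremal

variable [Fintype V]

/-- The bound `s|A| + t|B| - st` is below the claimed one by exactly `(s - 2)(t - 2 + |B| - |A|)`.
The term is kept because its vanishing decides equality. -/
theorem degSum_le_of_degenerate (h : G.Extremal A B ℓ) (hle : A.card ≤ B.card) {s t : ℕ}
    (hs : 2 ≤ s) (ht : 2 ≤ t) (hst : s + t = ℓ)
    (hdeg : G.Degenerate (thr A s t) Finset.univ) :
    G.degSum Finset.univ + 4 * (ℓ - 2) + 2 * ((s - 2) * (t - 2 + (B.card - A.card))) ≤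
      2 * (2 * A.card + (ℓ - 2) * B.card) := by
  have hi := h.le_left
  have h1 := hdeg.degSum_le h.isSplit (by rw [Finset.univ_inter]; omega)
    (by rw [Finset.univ_inter]; omega)
  rw [Finset.univ_inter, Finset.univ_inter] at h1
  obtain ⟨d, hd⟩ := Nat.exists_eq_add_of_le hle
  obtain ⟨s, rfl⟩ := Nat.exists_eq_add_of_le' hs
  obtain ⟨t, rfl⟩ := Nat.exists_eq_add_of_le' ht
  subst hst
  rw [hd] at h1 ⊢
  rw [show s + 2 + (t + 2) - 2 = s + t + 2 by omega, Nat.add_sub_cancel, Nat.add_sub_cancel,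
    Nat.add_sub_cancel_left]
  linarith

theorem hasFull_of_four (h : G.Extremal A B 4) (hdeg : G.Degenerate (thr A 2 2) Finset.univ)
    (htight : 4 * (A.card + B.card) ≤ G.degSum Finset.univ + 8) : G.HasFull A B 2 := by
  have hthr : thr A 2 2 = fun _ => 2 := by funext; simp [thr]
  rw [hthr] at hdeg
  have h1 := h.isSplit.hasTwoFull h.noCycle hdeg (by rw [Finset.univ_inter]; exact h.le_left)
    (by rw [Finset.univ_inter]; exact h.le_right)
    (by rwa [Finset.univ_inter, Finset.univ_inter])
  obtain ⟨x₀, hx₀, x₁, hx₁, -, -, -, -, hx, -, h1, -⟩ := h1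
  rw [Finset.univ_inter] at hx₀ hx₁ h1
  refine ⟨{x₀, x₁}, ?_, Finset.card_pair hx, fun x hx y hy => ?_⟩
  · simp [Finset.insert_subset_iff, hx₀, hx₁]
  · simp only [Finset.mem_insert, Finset.mem_singleton] at hx
    rcases hx with rfl | rfl
    · exact (h1 y hy).1
    · exact (h1 y hy).2

/-- The bound on the number of edges, and the structure of the graphs attaining it. -/
theorem degSum_le_and (h : G.Extremal A B ℓ) (hle : A.card ≤ B.card) :
    G.degSum Finset.univ + 4 * (ℓ - 2) ≤ 2 * (2 * A.card + (ℓ - 2) * B.card) ∧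
    (G.degSum Finset.univ + 4 * (ℓ - 2) = 2 * (2 * A.card + (ℓ - 2) * B.card) →
      G.HasFull A B (ℓ - 2) ∨ A.card = B.card ∧ G.HasFull B A (ℓ - 2)) := by
  have h4 := h.four_le
  obtain ⟨s, hs⟩ : ∃ s, s = ℓ / 2 := ⟨_, rfl⟩
  obtain ⟨t, hst⟩ : ∃ t, s + t = ℓ := ⟨ℓ - s, by omega⟩
  by_cases hd1 : G.Degenerate (thr A s t) Finset.univ
  · have h1 := h.degSum_le_of_degenerate hle (by omega) (by omega) hst hd1
    refine ⟨by omega, fun he => Or.inl ?_⟩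
    have h2 : (s - 2) * (t - 2 + (B.card - A.card)) = 0 := by omega
    -- If the second factor vanishes then `t = 2`, and `s ≤ t` again gives `s = 2`. So `ℓ` is `4` or
    -- `5`.
    have h3 : s = 2 := by
      rcases Nat.mul_eq_zero.1 h2 with h3 | h3 <;> omega
    obtain rfl | rfl : t = 2 ∨ t = 3 := by omega
    · obtain rfl : ℓ = 4 := by omega
      subst h3
      exact h.hasFull_of_four hd1 (by omega)
    · obtain rfl : ℓ = 5 := by omega
      subst h3
      exact h.hasFull_of_five hle hd1 (by omega)
  by_cases hd2 : G.Degenerate (thr A t s) Finset.univ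
  · have h1 := h.degSum_le_of_degenerate hle (by omega) (by omega) ((add_comm t s).trans hst) hd2
    refine ⟨by omega, fun he => Or.inr ?_⟩
    have h2 : (t - 2) * (s - 2 + (B.card - A.card)) = 0 := by omega
    -- Equal thresholds were covered above, so `t ≥ 3` and the second factor must vanish: `s = 2`,
    -- hence `ℓ = 5`, and the classes have equal size and may be exchanged.
    have hne : s ≠ t := fun h => hd1 (by rwa [← h] at hd2 ⊢)
    have h3 : s = 2 ∧ B.card = A.card := by
      rcases Nat.mul_eq_zero.1 h2 with h3 | h3 <;> omega
    obtain rfl : t = 3 := by omega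
    obtain rfl : ℓ = 5 := by omega
    obtain ⟨rfl, h3⟩ := h3
    rw [← h.isSplit.thr_eq] at hd2
    exact ⟨h3.symm, h.symm.hasFull_of_five h3.le hd2 (by omega)⟩
  · obtain ⟨K, hK, hp, hq⟩ := h.exists_isBiclique hst (by omega) (by omega) hd1 hd2
    rcases le_total (K ∩ A).card (K ∩ B).card with h1 | h1
    · have h2 := (h.degSum_le_of_isBiclique hK h1 (by omega) (k := ℓ - 2) (by omega)).1 hle
      exact ⟨h2.1, fun he => Or.inl (h2.2 he)⟩
    · have h2 := h.symm.degSum_le_of_isBiclique hK.symm h1 (by omega) (k := ℓ - 2) (by omega)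
      rcases hle.eq_or_lt with h3 | h3
      · have h4 := h2.1 h3.ge
        rw [h3] at h4 ⊢
        exact ⟨h4.1, fun he => Or.inr ⟨rfl, h4.2 he⟩⟩
      · have h4 := h2.2 h3
        exact ⟨h4.le, fun he => by omega⟩

end Extremal

/-! ### Recognizing the extremal graph -/

/-- In a graph with `k` full vertices in `A` and no cycle of length `2 * (k + 2)`, any two further
vertices of `A` of degree two have the same neighbours. -/
theorem IsSplit.adj_of_adj_of_full (hs : G.IsSplit A B) {k : ℕ} (hk : 2 ≤ k)
    (hC : G.NoCycleGE (2 * (k + 2))) (hB : k + 2 ≤ B.card) {X : Finset V} (hXA : X ⊆ A)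
    (hX : X.card = k) (hfull : ∀ x ∈ X, ∀ y ∈ B, G.Adj x y) {u w p q p' q' : V} (hu : u ∈ A)
    (hw : w ∈ A) (huX : u ∉ X) (hwX : w ∉ X) (huw : u ≠ w) (hpq : p ≠ q) (hpq' : p' ≠ q')
    (hup : G.Adj u p) (huq : G.Adj u q) (hwp : G.Adj w p') (hwq : G.Adj w q') :
    p = p' ∨ p = q' := by
  have hAB : ∀ {z y : V}, z ∈ A → y ∈ B → z ≠ y := by
    rintro z y hz hy rfl
    exact (hs.compl z).1 hy hz
  have hB' : ∀ {x y : V}, x ∈ A → G.Adj x y → y ∈ B := fun hx ha =>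
    (hs.compl _).2 ((hs.isClass _ _ ha).1 hx)
  have hdisj : Disjoint B X := by
    rw [Finset.disjoint_left]
    exact fun y hy hyX => hAB (hXA hyX) hy rfl
  -- two vertices of `B` are joined by a path through prescribed parts of `X` and `B`
  have hpath : ∀ {X' Z : Finset V} {y y' : V}, X' ⊆ X → y ∈ B → y' ∈ B → y ≠ y' → y ∉ Z →
      y' ∉ Z → X'.card + Z.card + 1 ≤ B.card → 1 ≤ X'.card →
      ∃ s, G.PathOn y y' s ∧ s ⊆ X' ∪ (B \ Z) ∧ s.card = 2 * X'.card + 1 := by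
    intro X' Z y y' hX' hy hy' hne hyZ hyZ' hc h1
    obtain ⟨Y, hyY, hYB, hYc⟩ := Finset.exists_subsuperset_card_eq
      (s := {y, y'}) (t := B \ Z) (n := X'.card + 1) (by
        intro z hz
        simp only [Finset.mem_insert, Finset.mem_singleton] at hz
        rw [Finset.mem_sdiff]
        rcases hz with rfl | rfl
        · exact ⟨hy, hyZ⟩
        · exact ⟨hy', hyZ'⟩) (Finset.card_le_two.trans (by omega)) (by
        have := Finset.le_card_sdiff Z B
        omega)
    have hYB' : Y ⊆ B := hYB.trans Finset.sdiff_subset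
    have hd : Disjoint Y X' := hdisj.mono hYB' hX'
    refine ⟨Y ∪ X', exists_pathOn_union_succ hd
      (fun y hy x hx => (hfull x (hX' hx) y (hYB' hy)).symm) hYc (hyY (by simp)) (hyY (by simp))
      hne, ?_, ?_⟩
    · rw [Finset.union_comm]
      exact Finset.union_subset_union le_rfl hYB
    · rw [Finset.card_union_of_disjoint hd]
      omega
  have hpB := hB' hu hup
  have hqB := hB' hu huq
  have hpB' := hB' hw hwp
  have hqB' := hB' hw hwq
  by_contra hcon
  push Not at hcon
  obtain ⟨pp, pq⟩ := hcon
  -- the case where `u` and `w` have exactly one common neighbour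
  have hcommon : ∀ {p q r : V}, p ∈ B → q ∈ B → r ∈ B → p ≠ q → q ≠ r → p ≠ r → G.Adj u p →
      G.Adj u q → G.Adj w q → G.Adj w r → False := by
    intro p q r hp hq hr hpq hqr hpr up uq wq wr
    -- A path from `p` to `r` through all of `X` has `2k + 1` vertices; `w`, `q`, `u` close it to a
    -- cycle of length `2(k + 2)`.
    obtain ⟨s, hs1, hs2, hs3⟩ := hpath (X' := X) (Z := {q}) le_rfl hp hr hpr (by simpa)
      (by simpa using hqr.symm) (by rw [Finset.card_singleton]; omega) (by omega)
    have hns : ∀ {z : V}, z ∈ A → z ∉ X → z ∉ s := fun hz hzX hzs => by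
      rcases Finset.mem_union.1 (hs2 hzs) with h | h
      · exact hzX h
      · exact hAB hz (Finset.mem_sdiff.1 h).1 rfl
    have hqs : q ∉ s := fun hqs => by
      rcases Finset.mem_union.1 (hs2 hqs) with h | h
      · exact hAB (hXA h) hq rfl
      · simp at h
    have hw1 := hs1.concat wr.symm (hns hw hwX)
    have hq1 : q ∉ insert w s := by
      rw [Finset.mem_insert, not_or]
      exact ⟨(hAB hw hq).symm, hqs⟩
    have hw2 := hw1.concat wq hq1
    have hu1 : u ∉ insert q (insert w s) := by
      rw [Finset.mem_insert, Finset.mem_insert, not_or, not_or]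
      exact ⟨hAB hu hq, huw, hns hu huX⟩
    have hw3 := hw2.concat uq.symm hu1
    have := hw3.card_lt (by omega) hC up.symm
    rw [Finset.card_insert_of_notMem hu1, Finset.card_insert_of_notMem hq1,
      Finset.card_insert_of_notMem (hns hw hwX)] at this
    omega
  by_cases h1 : q = p'
  · subst h1
    exact hcommon hpB hqB hqB' hpq hpq' pq hup huq hwp hwq
  by_cases h2 : q = q'
  · subst h2
    exact hcommon hpB hqB hpB' hpq hpq'.symm pp hup huq hwq hwp
  -- The pairs `p, q` and `p', q'` are now disjoint. One full vertex `x` is reserved to join `q` to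
  -- `p'`; a path from `q'` to `p` through the others has `2k - 1` vertices, and `u, q, x, p', w`
  -- make `2(k + 2)`.
  obtain ⟨x, hx⟩ := Finset.card_pos.1 (show 0 < X.card by omega)
  have hXc : (X.erase x).card = k - 1 := by rw [Finset.card_erase_of_mem hx, hX]
  obtain ⟨s, hs1, hs2, hs3⟩ := hpath (X' := X.erase x) (Z := {q, p'}) (Finset.erase_subset x X)
    hqB' hpB pq.symm (by simp [Ne.symm h2, hpq'.symm]) (by simp [hpq, pp])
    (by rw [Finset.card_pair h1]; omega) (by omega)
  have hns : ∀ {z : V}, z ∈ A → z ∉ X.erase x → z ∉ s := fun hz hzX hzs => by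
    rcases Finset.mem_union.1 (hs2 hzs) with h | h
    · exact hzX h
    · exact hAB hz (Finset.mem_sdiff.1 h).1 rfl
  have hns' : ∀ {z : V}, z ∈ B → z ∈ ({q, p'} : Finset V) → z ∉ s := fun hz hzq hzs => by
    rcases Finset.mem_union.1 (hs2 hzs) with h | h
    · exact hAB (hXA (Finset.mem_of_mem_erase h)) hz rfl
    · exact (Finset.mem_sdiff.1 h).2 hzq
  have hxA := hXA hx
  have n1 := hns hu fun h => huX (Finset.mem_of_mem_erase h)
  have n2 := hns hw fun h => hwX (Finset.mem_of_mem_erase h)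
  have n3 := hns hxA (Finset.notMem_erase x X)
  have n4 := hns' hqB (by simp)
  have n5 := hns' hpB' (by simp)
  have hux : u ≠ x := fun h => huX (h ▸ hx)
  have hwx : w ≠ x := fun h => hwX (h ▸ hx)
  have m1 : q ∉ insert u s := by
    rw [Finset.mem_insert, not_or]
    exact ⟨(hAB hu hqB).symm, n4⟩
  have m2 : x ∉ insert q (insert u s) := by
    simp only [Finset.mem_insert, not_or]
    exact ⟨hAB hxA hqB, hux.symm, n3⟩
  have m3 : p' ∉ insert x (insert q (insert u s)) := by
    simp only [Finset.mem_insert, not_or]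
    exact ⟨(hAB hxA hpB').symm, Ne.symm h1, (hAB hu hpB').symm, n5⟩
  have m4 : w ∉ insert p' (insert x (insert q (insert u s))) := by
    simp only [Finset.mem_insert, not_or]
    exact ⟨hAB hw hpB', hwx, hAB hw hqB, huw.symm, n2⟩
  have hP := ((((hs1.concat hup.symm n1).concat huq m1).concat (hfull x hx q hqB).symm m2).concat
    (hfull x hx p' hpB') m3).concat hwp.symm m4
  have := hP.card_lt (by omega) hC hwq.symm
  rw [Finset.card_insert_of_notMem m4, Finset.card_insert_of_notMem m3,
    Finset.card_insert_of_notMem m2, Finset.card_insert_of_notMem m1,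
    Finset.card_insert_of_notMem n1] at this
  omega

/-- There are vertices `y₀`, `y₁` of `B` to which the vertices of `A` outside a set `X` of `k` full
vertices are joined. -/
theorem IsSplit.exists_pair (hs : G.IsSplit A B) [Fintype V] {k : ℕ} (hk : 2 ≤ k)
    (hC : G.NoCycleGE (2 * (k + 2))) (hA : k + 2 ≤ A.card) (hB : k + 2 ≤ B.card)
    (hmin : ∀ v, 2 ≤ G.degIn Finset.univ v)
    (hsum : G.degSum Finset.univ + 4 * k ≤ 2 * (2 * A.card + k * B.card)) {X : Finset V}
    (hXA : X ⊆ A) (hX : X.card = k) (hfull : ∀ x ∈ X, ∀ y ∈ B, G.Adj x y) :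
    ∃ y₀ ∈ B, ∃ y₁ ∈ B, y₀ ≠ y₁ ∧ ∀ u ∈ A, u ∉ X → ∀ y, G.Adj u y ↔ y = y₀ ∨ y = y₁ := by
  -- The full vertices take `k|B|` edges, leaving on average at most two for each other vertex of
  -- `A`, while none has fewer than two.
  have hdeg : ∀ u ∈ A, u ∉ X → G.degIn Finset.univ u = 2 := by
    have h1 := hs.degSum_eq_two_mul Finset.univ
    rw [Finset.univ_inter, ← Finset.sum_sdiff hXA] at h1
    have h2 : k * B.card ≤ ∑ x ∈ X, G.degIn Finset.univ x := by
      rw [← hX, ← smul_eq_mul]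
      exact Finset.card_nsmul_le_sum _ _ _ fun x hx =>
        card_le_degIn (Finset.subset_univ B) (hfull x hx)
    have h3 : ∑ x ∈ A \ X, 2 = 2 * (A.card - k) := by
      rw [Finset.sum_const, Finset.card_sdiff_of_subset hXA, hX, smul_eq_mul, mul_comm]
    have h4 : ∑ x ∈ A \ X, 2 = ∑ x ∈ A \ X, G.degIn Finset.univ x :=
      le_antisymm (Finset.sum_le_sum fun x _ => hmin x) (by omega)
    have h5 := (Finset.sum_eq_sum_iff_of_le fun x _ => hmin x).1 h4
    exact fun u hu huX => (h5 u (Finset.mem_sdiff.2 ⟨hu, huX⟩)).symm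
  have hnbr : ∀ u ∈ A, u ∉ X → ∀ {p q : V}, p ≠ q → G.Adj u p → G.Adj u q → ∀ y, G.Adj u y →
      y = p ∨ y = q := by
    intro u hu huX p q hpq hp hq y hy
    by_contra hcon
    push Not at hcon
    have h1 := card_le_degIn (G := G) (v := u) (Finset.subset_univ {y, p, q}) (by
      intro z hz
      simp only [Finset.mem_insert, Finset.mem_singleton] at hz
      rcases hz with rfl | rfl | rfl <;> assumption)
    rw [Finset.card_insert_of_notMem (by simp [hcon]), Finset.card_pair hpq, hdeg u hu huX] at h1
    omega
  obtain ⟨u, hu, huX⟩ := exists_mem_not_mem_of_card_lt (S := A) (T := X) (by omega)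
  obtain ⟨p, -, q, -, hpq, hup, huq⟩ := exists_pair_of_degIn (hdeg u hu huX)
  refine ⟨p, (hs.compl p).2 ((hs.isClass _ _ hup).1 hu), q,
    (hs.compl q).2 ((hs.isClass _ _ huq).1 hu), hpq, fun w hw hwX y => ?_⟩
  by_cases huw : u = w
  · subst huw
    refine ⟨hnbr u hu huX hpq hup huq y, ?_⟩
    rintro (rfl | rfl) <;> assumption
  · obtain ⟨p', -, q', -, hpq', hwp, hwq⟩ := exists_pair_of_degIn (hdeg w hw hwX)
    have h1 := hs.adj_of_adj_of_full hk hC hB hXA hX hfull hu hw huX hwX huw hpq hpq' hup huq hwp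
      hwq
    have h2 := hs.adj_of_adj_of_full hk hC hB hXA hX hfull hu hw huX hwX huw hpq.symm hpq' huq hup
      hwp hwq
    have hwp' : G.Adj w p := by rcases h1 with rfl | rfl <;> assumption
    have hwq' : G.Adj w q := by rcases h2 with rfl | rfl <;> assumption
    refine ⟨hnbr w hw hwX hpq hwp' hwq' y, ?_⟩
    rintro (rfl | rfl) <;> assumption

omit [DecidableEq V] in
/-- A type with `n` elements can be enumerated so that a given subset comes first. -/
theorem exists_equiv_fin {α : Type*} [Fintype α] {n m : ℕ} (hn : Fintype.card α = n)
    (p : α → Prop) [DecidablePred p] (hp : Fintype.card {x // p x} = m) :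
    ∃ e : α ≃ Fin n, ∀ x, p x ↔ (e x : ℕ) < m := by
  classical
  have hmn : m ≤ n := hp ▸ hn ▸ Fintype.card_subtype_le p
  have h1 : Fintype.card {y : Fin n // (y : ℕ) < m} = m := by
    rw [Fintype.card_subtype]
    rw [Fin.card_filter_val_lt, min_eq_right hmn]
  have e₁ : {x // p x} ≃ {y : Fin n // (y : ℕ) < m} := Fintype.equivOfCardEq (by rw [hp, h1])
  have e₂ : {x // ¬ p x} ≃ {y : Fin n // ¬ (y : ℕ) < m} := Fintype.equivOfCardEq (by
    rw [Fintype.card_subtype_compl, Fintype.card_subtype_compl, hp, h1, hn, Fintype.card_fin])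
  refine ⟨(Equiv.sumCompl p).symm.trans ((Equiv.sumCongr e₁ e₂).trans (Equiv.sumCompl _)),
    fun x => ?_⟩
  by_cases hx : p x
  · simp only [Equiv.trans_apply, Equiv.sumCompl_symm_apply_of_pos hx, hx, true_iff]
    simpa using (e₁ ⟨x, hx⟩).2
  · simp only [Equiv.trans_apply, Equiv.sumCompl_symm_apply_of_neg hx, hx, false_iff]
    simpa using (e₂ ⟨x, hx⟩).2

theorem IsSplit.nonempty_iso (hs : G.IsSplit A B) [Fintype V] {k : ℕ} {X : Finset V}
    (hXA : X ⊆ A) (hX : X.card = k) (hfull : ∀ x ∈ X, ∀ y ∈ B, G.Adj x y) {y₀ y₁ : V}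
    (hy₀ : y₀ ∈ B) (hy₁ : y₁ ∈ B) (hne : y₀ ≠ y₁)
    (hout : ∀ u ∈ A, u ∉ X → ∀ y, G.Adj u y ↔ y = y₀ ∨ y = y₁) :
    Nonempty (G ≃g graphB2 A.card B.card (k + 2)) := by
  obtain ⟨e₁, he₁⟩ := exists_equiv_fin (α := {x // x ∈ A}) (n := A.card) (m := k)
    (Fintype.card_coe A) (fun x => (x : V) ∈ X) (by
      rw [Fintype.card_subtype, ← hX, ← Finset.card_map (Function.Embedding.subtype (· ∈ A))]
      congr 1
      ext x
      simp only [Finset.mem_map, Finset.mem_filter, Finset.mem_univ, true_and,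
        Function.Embedding.subtype_apply, Subtype.exists, exists_and_left, exists_prop,
        exists_eq_right_right]
      exact ⟨fun h => h.1, fun h => ⟨h, hXA h⟩⟩)
  obtain ⟨e₂, he₂⟩ := exists_equiv_fin (α := {x // ¬ x ∈ A}) (n := B.card) (m := 2)
    (by
      rw [Fintype.card_subtype]
      congr 1
      ext x
      simp [hs.compl]) (fun x => (x : V) = y₀ ∨ (x : V) = y₁) (by
      rw [Fintype.card_subtype, ← Finset.card_pair hne,
        ← Finset.card_map (Function.Embedding.subtype (¬ · ∈ A))]
      congr 1
      ext x
      simp only [Finset.mem_map, Finset.mem_filter, Finset.mem_univ, true_and,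
        Function.Embedding.subtype_apply, Subtype.exists, exists_and_left, exists_prop,
        exists_eq_right_right, Finset.mem_insert, Finset.mem_singleton]
      refine ⟨fun h => h.1, fun h => ⟨h, ?_⟩⟩
      rcases h with rfl | rfl
      · exact (hs.compl _).1 hy₀
      · exact (hs.compl _).1 hy₁)
  have key : ∀ (u : {x // x ∈ A}) (w : {x // ¬ x ∈ A}), G.Adj u w ↔
      (e₁ u : ℕ) < k ∨ (e₂ w : ℕ) < 2 := by
    intro u w
    rw [← he₁, ← he₂]
    by_cases hu : (u : V) ∈ X
    · simp only [hu, true_or, iff_true]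
      exact hfull u hu w ((hs.compl _).2 w.2)
    · simp only [hu, false_or]
      exact hout u u.2 hu w
  refine ⟨⟨(Equiv.sumCompl (· ∈ A)).symm.trans (Equiv.sumCongr e₁ e₂), ?_⟩⟩
  intro u w
  by_cases hu : u ∈ A <;> by_cases hw : w ∈ A
  · simp only [Equiv.trans_apply, Equiv.sumCompl_symm_apply_of_pos hu,
      Equiv.sumCompl_symm_apply_of_pos hw]
    exact iff_of_false (fun h => h) fun h => (hs.isClass _ _ h).1 hu hw
  · simp only [Equiv.trans_apply, Equiv.sumCompl_symm_apply_of_pos hu,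
      Equiv.sumCompl_symm_apply_of_neg hw]
    exact (key ⟨u, hu⟩ ⟨w, hw⟩).symm
  · simp only [Equiv.trans_apply, Equiv.sumCompl_symm_apply_of_neg hu,
      Equiv.sumCompl_symm_apply_of_pos hw]
    rw [G.adj_comm]
    exact (key ⟨w, hw⟩ ⟨u, hu⟩).symm
  · simp only [Equiv.trans_apply, Equiv.sumCompl_symm_apply_of_neg hu,
      Equiv.sumCompl_symm_apply_of_neg hw]
    exact iff_of_false (fun h => h) fun h => hu ((hs.isClass _ _ h).2 hw)

theorem Extremal.nonempty_iso [Fintype V] (h : G.Extremal A B ℓ)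
    (hsum : G.degSum Finset.univ + 4 * (ℓ - 2) ≤ 2 * (2 * A.card + (ℓ - 2) * B.card))
    (hfull : G.HasFull A B (ℓ - 2)) : Nonempty (G ≃g graphB2 A.card B.card ℓ) := by
  have h4 := h.four_le
  have hi := h.le_left
  have hj := h.le_right
  obtain ⟨k, rfl⟩ := Nat.exists_eq_add_of_le' (show 2 ≤ ℓ by omega)
  rw [Nat.add_sub_cancel] at hsum hfull
  obtain ⟨X, hXA, hX, hfull⟩ := hfull
  obtain ⟨y₀, hy₀, y₁, hy₁, hne, hout⟩ := h.isSplit.exists_pair (by omega) h.noCycle hi hj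
    h.two_le_degIn hsum hXA hX hfull
  exact h.isSplit.nonempty_iso hXA hX hfull hy₀ hy₁ hne hout

end SimpleGraph

/-! ### Properties of the graph attaining the bound -/

namespace SimpleGraph

variable {V : Type*} [DecidableEq V] {G : SimpleGraph V} {A B : Finset V} {ℓ : ℕ}

theorem exists_pathOn_of_isCycle {v : V} {c : G.Walk v v} (hc : c.IsCycle) :
    ∃ b, G.Adj v b ∧ G.PathOn b v c.support.toFinset ∧ c.support.toFinset.card = c.length := by
  cases c with
  | nil => exact absurd rfl hc.ne_nil
  | @cons _ b _ ha p =>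
    have hp := ((Walk.cons_isCycle_iff p ha).1 hc).1
    have hs : (Walk.cons ha p).support.toFinset = p.support.toFinset := by
      simp
    rw [hs]
    exact ⟨b, ha, ⟨p, hp, rfl⟩, PathOn.card_eq p hp⟩

/-- If all but `k` vertices of the class `A` are joined to two given vertices only, then there are
no cycles of length at least `2 * (k + 2)`. -/
theorem IsClass.noCycleGE (hA : G.IsClass A) {X : Finset V} {k : ℕ} (hk : 1 ≤ k) (hX : X.card = k)
    {y₀ y₁ : V} (hout : ∀ u ∈ A, u ∉ X → ∀ y, G.Adj u y → y = y₀ ∨ y = y₁) :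
    G.NoCycleGE (2 * (k + 2)) := by
  intro v c hc
  by_contra hlt
  push Not at hlt
  obtain ⟨b, hvb, hp, hcard⟩ := exists_pathOn_of_isCycle hc
  obtain ⟨x, y, hxA, hxy⟩ : ∃ x y, x ∈ A ∧ G.PathOn x y c.support.toFinset := by
    by_cases hv : v ∈ A
    · exact ⟨v, b, hv, hp.symm⟩
    · exact ⟨b, v, by have := hA _ _ hvb; tauto, hp⟩
  obtain ⟨w, M, hw, rfl, -, hM, hs⟩ := hxy.exists_iPath
  have heven : ∀ {w : ℕ → V} {M : ℕ}, G.IPath w M → w 0 ∈ A → ∀ i, 2 * i ≤ M → w (2 * i) ∈ A :=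
    fun hw h0 i hi => (hw.mem_iff hA hi).2 (iff_of_true h0 (even_two_mul i))
  -- A long cycle has at least `k + 2` vertices in `A`, so two lie outside `X`. The cycle is rotated
  -- to start at one of them; its two neighbours on the cycle are then `y₀` and `y₁`.
  obtain ⟨u, hu, huX⟩ := exists_mem_not_mem_of_card_lt (T := X)
    (S := (Finset.range (k + 2)).image fun i => w (2 * i)) (by
      rw [Finset.card_image_of_injOn, Finset.card_range]
      · omega
      · intro i hi j hj he
        simp only [Finset.coe_range, Set.mem_Iio] at hi hj
        have := hw.inj _ (by omega) _ (by omega) he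
        omega)
  obtain ⟨i, hi, rfl⟩ := Finset.mem_image.1 hu
  rw [Finset.mem_range] at hi
  have huA := heven hw hxA i (by omega)
  have huc : w (2 * i) ∈ c.support := by
    rw [← List.mem_toFinset, hs]
    exact Finset.mem_image_of_mem _ (Finset.mem_Icc.2 ⟨Nat.zero_le _, by omega⟩)
  obtain ⟨b', hb', hp', hcard'⟩ := exists_pathOn_of_isCycle (hc.rotate huc)
  obtain ⟨z, N, hz, hz0, rfl, hN, -⟩ := hp'.symm.exists_iPath
  rw [Walk.length_rotate] at hcard'
  rw [← hz0] at huX huA hb'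
  have h1 := hout _ huA huX _ (hz.adj 0 (by omega))
  have h2 := hout _ huA huX _ hb'
  obtain ⟨u', hu', huX'⟩ := exists_mem_not_mem_of_card_lt (T := X)
    (S := (Finset.range (k + 1)).image fun i => z (2 * (i + 1))) (by
      rw [Finset.card_image_of_injOn, Finset.card_range]
      · omega
      · intro i hi j hj he
        simp only [Finset.coe_range, Set.mem_Iio] at hi hj
        have := hz.inj _ (by omega) _ (by omega) he
        omega)
  obtain ⟨j, hj, rfl⟩ := Finset.mem_image.1 hu'
  rw [Finset.mem_range] at hj
  have huA' := heven hz huA (j + 1) (by omega)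
  have h3 := hout _ huA' huX' _ (hz.adj _ (by omega))
  have h4 := hout _ huA' huX' _ (hz.adj (2 * j + 1) (by omega)).symm
  have h5 : z (0 + 1) ≠ z N := fun h => by
    have := hz.inj _ (by omega) _ le_rfl h
    omega
  -- Since `y₀` and `y₁` occur only at positions `1` and `N`, the second vertex outside `X`, flanked
  -- by positions `2j + 1` and `2j + 3`, would force `N = 3`, but the cycle is longer.
  have key : ∀ m ≤ N, (z m = y₀ ∨ z m = y₁) → m = 1 ∨ m = N := by
    intro m hm h
    have : z m = z (0 + 1) ∨ z m = z N := by
      rcases h1 with h1 | h1 <;> rcases h2 with h2 | h2 <;> rcases h with h | h <;>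
        simp_all
    rcases this with h | h
    · exact Or.inl (hz.inj _ hm _ (by omega) h)
    · exact Or.inr (hz.inj _ hm _ le_rfl h)
  have h6 := key _ (by omega) h3
  have h7 := key _ (by omega) h4
  omega

omit [DecidableEq V] in
theorem connected_of_forall_adj_or_adj {x y : V} (hxy : G.Adj x y)
    (h : ∀ w, G.Adj w x ∨ G.Adj w y) : G.Connected := by
  have hr : ∀ w, G.Reachable w x := fun w => by
    rcases h w with h | h
    · exact h.reachable
    · exact h.reachable.trans hxy.symm.reachable
  have : Nonempty V := ⟨x⟩
  exact ⟨fun u w => (hr u).trans (hr w).symm⟩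

section graphB2

variable {a b : ℕ}

/-- The class of `graphB2 a b ℓ` of size `a`. -/
def leftClass (a b : ℕ) : Finset (Fin a ⊕ Fin b) :=
  Finset.univ.map ⟨Sum.inl, Sum.inl_injective⟩

/-- The class of `graphB2 a b ℓ` of size `b`. -/
def rightClass (a b : ℕ) : Finset (Fin a ⊕ Fin b) :=
  Finset.univ.map ⟨Sum.inr, Sum.inr_injective⟩

theorem card_leftClass : (leftClass a b).card = a := by simp [leftClass]

theorem card_rightClass : (rightClass a b).card = b := by simp [rightClass]

theorem graphB2_isSplit : (graphB2 a b ℓ).IsSplit (leftClass a b) (rightClass a b) where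
  compl x := by cases x <;> simp [leftClass, rightClass]
  isClass x y h := by
    rcases x with x | x <;> rcases y with y | y <;> simp [leftClass] <;> exact h

theorem graphB2_isBipartition :
    (graphB2 a b ℓ).IsBipartition (leftClass a b) (rightClass a b) := by
  refine ⟨?_, ?_, ?_⟩
  · ext x
    cases x <;> simp [leftClass, rightClass]
  · rw [Finset.disjoint_coe, Finset.disjoint_left]
    intro x
    cases x <;> simp [leftClass, rightClass]
  · intro x y h
    have h1 := graphB2_isSplit.isClass x y h
    have h2 := (graphB2_isSplit (ℓ := ℓ) (a := a) (b := b)).compl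
    simp only [Finset.mem_coe, h2]
    tauto

theorem graphB2_adj {i : Fin a} {j : Fin b} :
    (graphB2 a b ℓ).Adj (Sum.inl i) (Sum.inr j) ↔ (i : ℕ) < ℓ - 2 ∨ (j : ℕ) < 2 := Iff.rfl

theorem graphB2_adj' {i : Fin a} {j : Fin b} :
    (graphB2 a b ℓ).Adj (Sum.inr j) (Sum.inl i) ↔ (i : ℕ) < ℓ - 2 ∨ (j : ℕ) < 2 := Iff.rfl

/-- A vertex of degree `b` on the left and one of the first two on the right are adjacent and
dominate the graph. Each side offers two choices, so such a pair survives the deletion of any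
vertex. -/
theorem graphB2_isTwoConnected (hℓ : 4 ≤ ℓ) (ha : 2 ≤ a) (hb : 2 ≤ b) :
    (graphB2 a b ℓ).IsTwoConnected := by
  have hadj : ∀ (i : Fin a) (j : Fin b), (i : ℕ) < ℓ - 2 → (j : ℕ) < 2 → ∀ w,
      (graphB2 a b ℓ).Adj w (Sum.inl i) ∨ (graphB2 a b ℓ).Adj w (Sum.inr j) := by
    rintro i j hi hj (w | w)
    · exact Or.inr (graphB2_adj.2 (Or.inr hj))
    · exact Or.inl (graphB2_adj'.2 (Or.inl hi))
  refine ⟨connected_of_forall_adj_or_adj (x := Sum.inl ⟨0, by omega⟩) (y := Sum.inr ⟨0, by omega⟩)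
    (graphB2_adj.2 (Or.inr (by simp))) (hadj _ _ (by simp; omega) (by simp)), fun v => ?_⟩
  obtain ⟨i, hi, hiv⟩ : ∃ i : Fin a, (i : ℕ) < ℓ - 2 ∧ Sum.inl i ≠ v := by
    by_cases h : Sum.inl ⟨0, by omega⟩ = v
    · refine ⟨⟨1, by omega⟩, by simp; omega, ?_⟩
      rw [← h]
      simp
    · exact ⟨⟨0, by omega⟩, by simp; omega, h⟩
  obtain ⟨j, hj, hjv⟩ : ∃ j : Fin b, (j : ℕ) < 2 ∧ Sum.inr j ≠ v := by
    by_cases h : Sum.inr ⟨0, by omega⟩ = v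
    · refine ⟨⟨1, by omega⟩, by simp, ?_⟩
      rw [← h]
      simp
    · exact ⟨⟨0, by omega⟩, by simp, h⟩
  refine connected_of_forall_adj_or_adj (x := ⟨Sum.inl i, hiv⟩) (y := ⟨Sum.inr j, hjv⟩)
    (graphB2_adj.2 (Or.inl hi)) fun w => hadj i j hi hj w

theorem graphB2_noCycleGE (hℓ : 4 ≤ ℓ) (ha : ℓ ≤ a) (hb : 2 ≤ b) :
    (graphB2 a b ℓ).NoCycleGE (2 * ℓ) := by
  obtain ⟨k, rfl⟩ := Nat.exists_eq_add_of_le' (show 2 ≤ ℓ by omega)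
  refine graphB2_isSplit.isClass.noCycleGE
    (X := (Finset.univ.filter fun i : Fin a => (i : ℕ) < k).map ⟨Sum.inl, Sum.inl_injective⟩)
    (y₀ := Sum.inr ⟨0, by omega⟩) (y₁ := Sum.inr ⟨1, by omega⟩) (by omega) ?_ ?_
  · rw [Finset.card_map, Fin.card_filter_val_lt]
    omega
  · rintro (i | i) hi hiX (j | j) h
    · exact h.elim
    · rw [graphB2_adj] at h
      simp only [Finset.mem_map, Finset.mem_filter, Finset.mem_univ, true_and,
        Function.Embedding.coeFn_mk, Sum.inl.injEq, exists_eq_right] at hiX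
      simp only [Sum.inr.injEq, Fin.ext_iff]
      omega
    · simp [leftClass] at hi
    · exact h.elim

theorem graphB2_degSum (ha : ℓ - 2 ≤ a) (hb : 2 ≤ b) :
    (graphB2 a b ℓ).degSum Finset.univ + 4 * (ℓ - 2) = 2 * (2 * a + (ℓ - 2) * b) := by
  classical
  have hdeg : ∀ i : Fin a, (graphB2 a b ℓ).degIn Finset.univ (Sum.inl i) =
      if (i : ℕ) < ℓ - 2 then b else 2 := by
    intro i
    have h1 : (Finset.univ.filter ((graphB2 a b ℓ).Adj (Sum.inl i))) =
        (Finset.univ.filter fun j : Fin b => (i : ℕ) < ℓ - 2 ∨ (j : ℕ) < 2).map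
          ⟨Sum.inr, Sum.inr_injective⟩ := by
      ext (j | j)
      · simp only [Finset.mem_filter, Finset.mem_univ, true_and, Finset.mem_map,
          Function.Embedding.coeFn_mk, reduceCtorEq, and_false, exists_false, iff_false]
        exact fun h => h
      · simp [graphB2_adj]
    have h2 : (graphB2 a b ℓ).degIn Finset.univ (Sum.inl i) =
        (Finset.univ.filter ((graphB2 a b ℓ).Adj (Sum.inl i))).card := by
      unfold degIn
      congr
    rw [h2, h1, Finset.card_map]
    split_ifs with hi
    · simp [hi]
    · simp only [hi, false_or, Fin.card_filter_val_lt]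
      omega
  rw [graphB2_isSplit.degSum_eq_two_mul, Finset.univ_inter, leftClass, Finset.sum_map]
  simp only [Function.Embedding.coeFn_mk, hdeg]
  rw [Finset.sum_ite, Finset.sum_const, Finset.sum_const, smul_eq_mul, smul_eq_mul,
    Fin.card_filter_val_lt]
  have h3 := Finset.card_filter_add_card_filter_not (s := (Finset.univ : Finset (Fin a)))
    fun i => (i : ℕ) < ℓ - 2
  rw [Fin.card_filter_val_lt, Finset.card_univ, Fintype.card_fin, min_eq_right ha] at h3
  rw [min_eq_right ha]
  obtain ⟨m, hm⟩ := Nat.exists_eq_add_of_le ha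
  have h4 : (Finset.univ.filter fun i : Fin a => ¬ (i : ℕ) < ℓ - 2).card = m := by omega
  rw [h4]
  subst hm
  ring

end graphB2

/-! ### Passing to an edge-maximal graph, and conclusion -/

omit [DecidableEq V] in
theorem IsTwoConnected.mono {H : SimpleGraph V} (h : G.IsTwoConnected) (hle : G ≤ H) :
    H.IsTwoConnected :=
  ⟨h.1.mono hle, fun v => (h.2 v).mono (comap_monotone _ hle)⟩

/-- If adding the edge `x y` creates a long cycle, then a long path joins `x` and `y`. -/
theorem exists_pathOn_of_sup_edge {n : ℕ} (hn : 3 ≤ n) (hG : G.NoCycleGE n) {x y : V}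
    (h : ¬ (G ⊔ edge x y).NoCycleGE n) : ∃ s, G.PathOn x y s ∧ n ≤ s.card := by
  unfold NoCycleGE at h
  push Not at h
  obtain ⟨v, c, hc, hlen⟩ := h
  have hedge : ∀ {p q : V}, (G ⊔ edge x y).Adj p q → ¬ G.Adj p q →
      p = x ∧ q = y ∨ p = y ∧ q = x := by
    intro p q h h'
    rw [sup_adj, edge_adj] at h
    rcases h with h | ⟨⟨rfl, rfl⟩ | ⟨rfl, rfl⟩, -⟩
    · exact absurd h h'
    · exact Or.inl ⟨rfl, rfl⟩
    · exact Or.inr ⟨rfl, rfl⟩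
  obtain ⟨b, hvb, hp, hcard⟩ := exists_pathOn_of_isCycle hc
  obtain ⟨w, M, hw, rfl, rfl, hM, -⟩ := hp.exists_iPath
  have hMn : n ≤ M + 1 := by omega
  have hswap : ∀ {p q : V} {s : Finset V}, G.PathOn p q s → n ≤ s.card →
      (p = x ∧ q = y ∨ p = y ∧ q = x) → ∃ s, G.PathOn x y s ∧ n ≤ s.card := by
    rintro p q s hs hsc (⟨rfl, rfl⟩ | ⟨rfl, rfl⟩)
    · exact ⟨s, hs, hsc⟩
    · exact ⟨s, hs.symm, hsc⟩
  -- The cycle is a path closed by one edge. The added edge is either the closing one, or a single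
  -- edge of the path; in the latter case the two remaining pieces are joined through the closing
  -- edge.
  by_cases hall : ∀ i < M, G.Adj (w i) (w (i + 1))
  · have hw' : G.IPath w M := ⟨hall, hw.inj⟩
    have h1 := hw'.pathOn (Nat.zero_le M) le_rfl
    have h2 := hw'.card_image (Finset.Subset.refl (Finset.Icc 0 M))
    rw [Nat.card_Icc] at h2
    by_cases ha : G.Adj (w M) (w 0)
    · have := h1.card_lt hn hG ha.symm
      omega
    · exact hswap h1.symm (by omega) (hedge hvb ha)
  · push Not at hall
    obtain ⟨i, hi, hia⟩ := hall
    have h1 := hedge (hw.adj i hi) hia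
    have hne : x ≠ y := by
      rintro rfl
      have := hw.inj i hi.le (i + 1) hi (by rcases h1 with h | h <;> rw [h.1, h.2])
      omega
    have hadj : ∀ j < M, j ≠ i → G.Adj (w j) (w (j + 1)) := by
      intro j hj hji
      by_contra hja
      have h2 := hedge (hw.adj j hj) hja
      have h3 : w j = w i ∨ w j = w (i + 1) ∧ w (j + 1) = w i := by
        rcases h1 with h | h <;> rcases h2 with h' | h' <;> simp [h.1, h.2, h'.1, h'.2]
      rcases h3 with h3 | ⟨h3, h4⟩
      · exact hji (hw.inj _ hj.le _ hi.le h3)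
      · have := hw.inj _ hj.le _ hi h3
        have := hw.inj _ hj _ hi.le h4
        omega
    have ha : G.Adj (w M) (w 0) := by
      by_contra ha
      have h2 := hedge hvb ha
      have h3 : w M = w i ∨ w M = w (i + 1) ∧ w 0 = w i := by
        rcases h1 with h | h <;> rcases h2 with h' | h' <;> simp [h.1, h.2, h'.1, h'.2]
      rcases h3 with h3 | ⟨h3, h4⟩
      · have := hw.inj _ le_rfl _ hi.le h3
        omega
      · have := hw.inj _ le_rfl _ hi h3
        have := hw.inj _ (Nat.zero_le M) _ hi.le h4
        omega
    have hw1 : G.IPath w i := ⟨fun j hj => hadj j (by omega) (by omega),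
      fun j hj k hk he => hw.inj j (by omega) k (by omega) he⟩
    have hw2 : G.IPath (fun j => w (i + 1 + j)) (M - (i + 1)) :=
      ⟨fun j hj => hadj (i + 1 + j) (by omega) (by omega), fun j hj k hk he => by
        have := hw.inj (i + 1 + j) (by omega) (i + 1 + k) (by omega) he
        omega⟩
    have hp1 := hw1.pathOn (Nat.zero_le i) le_rfl
    have hp2 := hw2.pathOn (Nat.zero_le _) le_rfl
    have c1 := hw1.card_image (Finset.Subset.refl (Finset.Icc 0 i))
    have c2 := hw2.card_image (Finset.Subset.refl (Finset.Icc 0 (M - (i + 1))))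
    rw [Nat.card_Icc] at c1 c2
    simp only [show i + 1 + (M - (i + 1)) = M by omega, add_zero] at hp2
    have hd : Disjoint ((Finset.Icc 0 (M - (i + 1))).image fun j => w (i + 1 + j))
        ((Finset.Icc 0 i).image w) := by
      simp only [Finset.disjoint_left, Finset.mem_image, Finset.mem_Icc, not_exists, not_and]
      rintro _ ⟨j, hj, rfl⟩ k hk he
      have := hw.inj _ (by omega) _ (by omega) he
      omega
    refine hswap (hp2.join ha hp1 hd).symm ?_ h1
    rw [Finset.card_union_of_disjoint hd]
    omega

/-- Every graph of the class considered lies in an edge-maximal one. -/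
theorem exists_extremal [Fintype V] (hs : G.IsSplit A B) (htwo : G.IsTwoConnected)
    (hC : G.NoCycleGE (2 * ℓ)) (hℓ : 4 ≤ ℓ) (hA : ℓ ≤ A.card) (hB : ℓ ≤ B.card) :
    ∃ H, G ≤ H ∧ H.Extremal A B ℓ := by
  -- Maximality is taken only over bipartite graphs without long cycles; 2-connectedness passes to
  -- supergraphs by itself.
  obtain ⟨H, hGH, hH⟩ := Finite.exists_le_maximal
    (p := fun H : SimpleGraph V => H.IsClass A ∧ H.NoCycleGE (2 * ℓ)) ⟨hs.isClass, hC⟩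
  refine ⟨H, hGH, hs.compl, hH.prop.1, htwo.mono hGH, hH.prop.2, fun x hx y hy ha => ?_, hℓ, hA,
    hB⟩
  have hyA := (hs.compl y).1 hy
  refine exists_pathOn_of_sup_edge (by omega) hH.prop.2 fun hC' => ha ?_
  refine hH.le_of_ge ⟨fun u w huw => ?_, hC'⟩ le_sup_left (sup_adj .. |>.2 (Or.inr ?_))
  · rw [sup_adj, edge_adj] at huw
    rcases huw with h | ⟨⟨rfl, rfl⟩ | ⟨rfl, rfl⟩, -⟩
    · exact hH.prop.1 u w h
    · exact iff_of_true hx hyA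
    · exact iff_of_false hyA (not_not.2 hx)
  · rw [edge_adj]
    exact ⟨Or.inl ⟨rfl, rfl⟩, fun h => hyA (h ▸ hx)⟩

theorem IsBipartition.isSplit [Fintype V] (h : G.IsBipartition A B) : G.IsSplit A B := by
  obtain ⟨h1, h2, h3⟩ := h
  have hc : ∀ x, x ∈ B ↔ x ∉ A := fun x => by
    rw [Finset.disjoint_coe, Finset.disjoint_left] at h2
    have h4 : x ∈ A ∪ B := h1 ▸ Finset.mem_univ x
    rw [Finset.mem_union] at h4
    have := @h2 x
    tauto
  refine ⟨hc, fun x y ha => ?_⟩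
  have := h3 ha
  simp only [Finset.mem_coe, hc] at this
  tauto

/-- The bound for the edge-maximal supergraph carries over, and equality makes the two graphs equal.
If the full vertices lie in `B`, the classes have equal size, so exchanging them gives the same
graph. -/
theorem card_edgeFinset_bound [Fintype V] [DecidableRel G.Adj] (hG : G.IsBipartition A B)
    (hle : A.card ≤ B.card) (hℓ : 4 ≤ ℓ) (hA : ℓ ≤ A.card) (htwo : G.IsTwoConnected)
    (hC : G.NoCycleGE (2 * ℓ)) :
    G.edgeFinset.card + 2 * (ℓ - 2) ≤ 2 * A.card + (ℓ - 2) * B.card ∧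
    (G.edgeFinset.card + 2 * (ℓ - 2) = 2 * A.card + (ℓ - 2) * B.card ↔
      Nonempty (G ≃g graphB2 A.card B.card ℓ)) := by
  classical
  obtain ⟨H, hGH, hH⟩ := exists_extremal hG.isSplit htwo hC hℓ hA (hA.trans hle)
  obtain ⟨h1, h2⟩ := hH.degSum_le_and hle
  have h3 := degSum_univ (G := H)
  have h4 : G.edgeFinset.card ≤ H.edgeFinset.card := Finset.card_le_card (edgeFinset_mono hGH)
  refine ⟨by omega, fun he => ?_, fun ⟨e⟩ => ?_⟩
  · have h5 : G = H := by
      rw [← edgeFinset_inj]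
      exact Finset.eq_of_subset_of_card_le (edgeFinset_mono hGH) (by omega)
    subst h5
    rcases h2 (by omega) with h6 | ⟨h6, h7⟩
    · exact hH.nonempty_iso h1 h6
    · have h8 := hH.symm.nonempty_iso (by rwa [h6] at h1 ⊢) h7
      rwa [h6] at h8 ⊢
  · have h5 := e.card_edgeFinset_eq
    have h6 := graphB2_degSum (a := A.card) (b := B.card) (ℓ := ℓ) (by omega) (by omega)
    rw [degSum_univ] at h6
    omega

end SimpleGraph

theorem theorem1 (a b ℓ : ℕ) (hℓ : 4 ≤ ℓ) (hla : ℓ ≤ a) (hab : a ≤ b) :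
    -- the bound on the number of edges, and the characterization of equality
    (∀ (V : Type*) [Fintype V] [DecidableEq V] (G : SimpleGraph V) [DecidableRel G.Adj]
      (A B : Finset V), G.IsBipartition A B → A.card = a → B.card = b →
      G.IsTwoConnected → G.NoCycleGE (2 * ℓ) →
        (G.edgeFinset.card : ℝ) ≤
            (ℓ : ℝ) / 2 * ((a : ℝ) + b) + ((ℓ : ℝ) / 2 - 2) * ((b : ℝ) - a - 4) - 4 ∧
        ((G.edgeFinset.card : ℝ) =
            (ℓ : ℝ) / 2 * ((a : ℝ) + b) + ((ℓ : ℝ) / 2 - 2) * ((b : ℝ) - a - 4) - 4 ↔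
          Nonempty (G ≃g SimpleGraph.graphB2 a b ℓ))) ∧
    -- the other form of the bound
    (ℓ : ℝ) / 2 * ((a : ℝ) + b) + ((ℓ : ℝ) / 2 - 2) * ((b : ℝ) - a - 4) - 4 =
      ((ℓ : ℝ) - 2) * b + 2 * ((a : ℝ) - ℓ + 2) ∧
    -- the extremal graph is one of the graphs considered, so the bound is attained
    (∃ A B : Finset (Fin a ⊕ Fin b), (SimpleGraph.graphB2 a b ℓ).IsBipartition A B ∧
      A.card = a ∧ B.card = b) ∧
    (SimpleGraph.graphB2 a b ℓ).IsTwoConnected ∧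
    (SimpleGraph.graphB2 a b ℓ).NoCycleGE (2 * ℓ) := by
  have hform : (ℓ : ℝ) / 2 * ((a : ℝ) + b) + ((ℓ : ℝ) / 2 - 2) * ((b : ℝ) - a - 4) - 4 =
      ((ℓ : ℝ) - 2) * b + 2 * ((a : ℝ) - ℓ + 2) := by ring
  refine ⟨?_, hform, ⟨_, _, SimpleGraph.graphB2_isBipartition, SimpleGraph.card_leftClass,
    SimpleGraph.card_rightClass⟩, SimpleGraph.graphB2_isTwoConnected hℓ (by omega) (by omega),
    SimpleGraph.graphB2_noCycleGE hℓ hla (by omega)⟩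
  intro V _ _ G _ A B hG hA hB htwo hC
  subst hA hB
  obtain ⟨h1, h2⟩ := SimpleGraph.card_edgeFinset_bound hG hab hℓ hla htwo hC
  -- Writing `ℓ = k + 2` removes the truncated subtraction before casting to the reals.
  obtain ⟨k, rfl⟩ := Nat.exists_eq_add_of_le' (show 2 ≤ ℓ by omega)
  rw [Nat.add_sub_cancel] at h1 h2
  rw [hform, ← h2]
  have h3 : (((k + 2 : ℕ) : ℝ) - 2) * B.card + 2 * ((A.card : ℝ) - (k + 2 : ℕ) + 2) =
      ((2 * A.card + k * B.card : ℕ) : ℝ) - ((2 * k : ℕ) : ℝ) := by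
    push_cast
    ring
  rw [h3, le_sub_iff_add_le, eq_sub_iff_add_eq]
  exact ⟨by exact_mod_cast h1, by exact_mod_cast Iff.rfl⟩
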